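/- Let $n\ge 1$, let $0<a_1<a_2<\dots<a_n$ be real numbers, and put $\Omega=(0,1)\times(-1,1)$, $\Omega_+=\Omega\cap\{y>0\}$, $\Omega_-=\Omega\cap\{y<0\}$ and $L=\prod_{j=1}^n\bigl(a_j^2\,\partial_x^2+\operatorname{sgn}(y)\,\partial_y^2\bigr)$. For $\varphi_s,\psi_s:[0,1]\to\mathbb R$, $s=0,\dots,n-1$, a classical solution of the Dirichlet problem is a function $u\in C^{2n-1}(\overline\Omega)\cap C^{2n}(\Omega_+\cup\Omega_-)$ with $Lu=0$ in $\Omega_+\cup\Omega_-$ and, for $s=0,\dots,n-1$, $$D_x^{2s}u(0,y)=D_x^{2s}u(1,y)=0\ (-1\le y\le 1),\qquad D_y^{2s}u(x,1)=\varphi_s(x),\quad D_y^{2s}u(x,-1)=\psi_s(x)\ (0\le x\le 1).$$ Write $\varphi_{sk}=\sqrt2\int_0^1\varphi_s(x)\sin(\pi kx)\,dx$ and $\psi_{sk}=\sqrt2\int_0^1\psi_s(x)\sin(\pi kx)\,dx$, $k=1,2,\dots$. The $k$-th coefficient problem asks for $u_k\in C^{2n-1}[-1,1]\cap C^{2n}((-1,0)\cup(0,1))$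 with $$\prod_{j=1}^n\Bigl(-(a_jk\pi)^2+\operatorname{sgn}(y)\tfrac{d^2}{dy^2}\Bigr)u_k=0\ (y\ne 0),\qquad u_k^{(2s)}(1)=\varphi_{sk},\quad u_k^{(2s)}(-1)=\psi_{sk}\quad(0\le s\le n-1).$$ Let $\Delta(k)$ be the determinant of the $4n\times 4n$ linear system that this problem imposes on the coefficients $c_i,d_i$ of $u_k=\sum_{s=1}^n(c_{2s-1}e^{a_s\pi ky}+c_{2s}e^{-a_s\pi ky})$ $(y>0)$, $u_k=\sum_{s=1}^n(d_{2s-1}\cos\pi ka_sy+d_{2s}\sin\pi ka_sy)$ $(y<0)$. In this system the conditions on the derivatives of order $2m$ at $y=\pm1$ ($0\le m\le n-1$) are divided by $(\pi k)^{2m}$ (those at $y=-1$ also by $(-1)^m$), and the matching conditions at $y=0$ for the derivatives of order $t$ ($0\le t\le 2n-1$) are divided by $(\pi k)^t$. Let $\Delta_2(k)=(-\tfrac i2)^n\det B(k)$, where $B(k)$ is the $3n\times3n$ matrix with $n$ columns indexed by $-a_s$, $n$ by $ia_s$ and $n$ by $-ia_s$, whose first $n$ rows ($m=0,\dots,n-1$)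 have in these columns the entries $0$, $a_s^{2m}e^{-i\pi ka_s}$, $a_s^{2m}e^{i\pi ka_s}$, and whose last $2n$ rows ($t=0,\dots,2n-1$) have the entries $(-a_s)^t$, $(ia_s)^t$, $(-ia_s)^t$. (The signs of $\Delta$ and $\Delta_2$ play no role.) For $\gamma\ge0$ say that $(19)_\gamma$ holds if there is $M>0$ with $|\Delta_2(k)|>M/k^{\gamma}$ for all but finitely many $k\ge1$. **(A)** If all $a_j$ are natural numbers, then $(19)_0$ holds. **(B)** Suppose all $a_j$ are rational. For $S\subseteq\{1,\dots,n\}$ write $\sum_{j\in S}a_j=\sigma_S/t_S$ in lowest terms, let $T$ be the least common multiple of all $t_S$, let $m_S(k)$ be the remainder of $k\sigma_S$ modulo $t_S$, and put $$P_k(z)=\sum_{S}(-1)^{|S|}\,V(a_1,\dots,a_n,i\varepsilon^S_1a_1,\dots,i\varepsilon^S_na_n)\,z^{m_S(k)T/t_S},\qquad V(b_1,\dots,b_N)=\prod_{j>l}(b_j-b_l),$$ with $\varepsilon^S_j=-1$ for $j\in S$ and $\varepsilon_j^S=1$ otherwise. If $\gcd(T,2c)=1$ whenever $k\ge1$ and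 $z=e^{i\pi b/c}$ is a root of $P_k$ with coprime natural numbers $b,c$, $0<b<2c$ (condition (17)), then $(19)_0$ holds. **(C)** Let $\gamma\ge 0$, suppose that $(19)_\gamma$ holds, and let $\alpha=\lceil\gamma\rceil$ (that is, $\alpha=\gamma$ if $\gamma$ is an integer and $\alpha=[\gamma]+1$ otherwise). Then $\Delta(k)=0$ for at most finitely many $k$. Suppose that all $f\in\{\varphi_s,\psi_s: 0\le s\le n-1\}$ belong to $C^{2n+1+\alpha}[0,1]$ and satisfy, for all $k\ge1$ and $r=1,\dots,2n+1+\alpha$, $$\Bigl(f^{(r-1)}(x)\sin\bigl(\pi kx+\tfrac{\pi}{2}r\bigr)\Bigr)\Big|_{x=0}^{x=1}=0.$$ Then: 1. if $\Delta(k)\neq0$, the $k$-th coefficient problem has exactly one solution on $[-1,1]$; 2. for every choice of solutions $u_k$ of the coefficient problems, $k=1,2,\dots$, the series $$u(x,y)=\sqrt2\sum_{k=1}^\infty u_k(y)\sin\pi kx\qquad(20)$$ is a classical solution of the Dirichlet problem; the termwise differentiated series of every order at most $2n-1$ converge uniformly on $\overline\Omega$, and those of every order at most $2n$ converge uniformly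 on $\Omega_+\cup\Omega_-$, to the corresponding derivatives of $u$; 3. if $\varphi_{sk}=\psi_{sk}=0$ ($0\le s\le n-1$) for each of the finitely many $k$ with $\Delta(k)=0$ (no condition if there is no such $k$), then solutions $u_k$ exist for all $k$, so that a classical solution of the form (20) exists; 4. if $\Delta(k)\ne0$ for all $k$, the classical solution is unique; if $\Delta(k)=0$ for some $k$, no classical solution is unique: to each one there is another that differs from it on $\overline\Omega$. -/

import Mathlib

open Real Set Filter Topology
open scoped BigOperators

noncomputable section

namespace DirichletProblem

/-! ### The domain, the equation and classical solutions -/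

/-- The open upper part `Ω₊ = (0,1) × (0,1)`. -/
def omegaPlus : Set (ℝ × ℝ) := Ioo 0 1 ×ˢ Ioo 0 1

/-- The open lower part `Ω₋ = (0,1) × (-1,0)`. -/
def omegaMinus : Set (ℝ × ℝ) := Ioo 0 1 ×ˢ Ioo (-1) 0

/-- The closed rectangle `[0,1] × [-1,1]`. -/
def omegaClosure : Set (ℝ × ℝ) := Icc 0 1 ×ˢ Icc (-1) 1

/-- One factor `c² ∂²/∂x² + sgn y ∂²/∂y²` of the operator. -/
def factorOp (c : ℝ) (v : ℝ → ℝ → ℝ) : ℝ → ℝ → ℝ := fun x y =>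
  c ^ 2 * iteratedDeriv 2 (fun x' => v x' y) x
    + Real.sign y * iteratedDeriv 2 (fun y' => v x y') y

/-- `L u = ∏ⱼ (aⱼ² ∂²/∂x² + sgn y ∂²/∂y²) u`, the product being composition of operators. -/
def operatorL {n : ℕ} (a : Fin n → ℝ) (u : ℝ → ℝ → ℝ) : ℝ → ℝ → ℝ :=
  (List.ofFn a).foldr factorOp u

/-- Classical solutions of the Dirichlet problem. Only the values of `u` on the closed rectangle
matter. Derivatives on the boundary are one-sided ones. -/
structure IsClassicalSolution {n : ℕ} (a : Fin n → ℝ) (φ ψ : Fin n → ℝ → ℝ)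
    (u : ℝ → ℝ → ℝ) : Prop where
  contDiffOn_closure :
    ContDiffOn ℝ ((2 * n - 1 : ℕ) : WithTop ℕ∞) (Function.uncurry u) omegaClosure
  contDiffOn_parts :
    ContDiffOn ℝ ((2 * n : ℕ) : WithTop ℕ∞) (Function.uncurry u) (omegaPlus ∪ omegaMinus)
  equation : ∀ x y : ℝ, (x, y) ∈ omegaPlus ∪ omegaMinus → operatorL a u x y = 0
  left : ∀ s : Fin n, ∀ y ∈ Icc (-1 : ℝ) 1,
    iteratedDerivWithin (2 * s) (fun x => u x y) (Icc 0 1) 0 = 0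
  right : ∀ s : Fin n, ∀ y ∈ Icc (-1 : ℝ) 1,
    iteratedDerivWithin (2 * s) (fun x => u x y) (Icc 0 1) 1 = 0
  top : ∀ s : Fin n, ∀ x ∈ Icc (0 : ℝ) 1,
    iteratedDerivWithin (2 * s) (fun y => u x y) (Icc (-1) 1) 1 = φ s x
  bottom : ∀ s : Fin n, ∀ x ∈ Icc (0 : ℝ) 1,
    iteratedDerivWithin (2 * s) (fun y => u x y) (Icc (-1) 1) (-1) = ψ s x

/-! ### The problem for the Fourier coefficients and the sine series -/

/-- The sine coefficient `√2 ∫₀¹ f(x) sin(πkx) dx`. -/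
def sineCoeff (f : ℝ → ℝ) (k : ℕ+) : ℝ :=
  √2 * ∫ x in (0 : ℝ)..1, f x * Real.sin (π * k * x)

/-- One factor `-(cπk)² + sgn y d²/dy²` of the ordinary differential operator. -/
def modeFactorOp (k : ℕ+) (c : ℝ) (v : ℝ → ℝ) : ℝ → ℝ := fun y =>
  -(c * k * π) ^ 2 * v y + Real.sign y * iteratedDeriv 2 v y

/-- `w` solves the boundary value problem for the `k`-th coefficient: the ordinary differential
equation holds on both sides of `0`, the even derivatives at `±1` are the coefficients of the data,
and the derivatives of order at most `2n - 1` match at `0` (`w` is `C^{2n-1}` on `[-1,1]`). -/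
structure IsModeSolution {n : ℕ} (a : Fin n → ℝ) (φ ψ : Fin n → ℝ → ℝ) (k : ℕ+)
    (w : ℝ → ℝ) : Prop where
  contDiffOn_closure : ContDiffOn ℝ ((2 * n - 1 : ℕ) : WithTop ℕ∞) w (Icc (-1) 1)
  contDiffOn_parts : ContDiffOn ℝ ((2 * n : ℕ) : WithTop ℕ∞) w (Ioo 0 1 ∪ Ioo (-1) 0)
  equation : ∀ y ∈ Ioo (0 : ℝ) 1 ∪ Ioo (-1 : ℝ) 0,
    (List.ofFn a).foldr (modeFactorOp k) w y = 0
  top : ∀ s : Fin n, iteratedDerivWithin (2 * s) w (Icc (-1) 1) 1 = sineCoeff (φ s) k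
  bottom : ∀ s : Fin n, iteratedDerivWithin (2 * s) w (Icc (-1) 1) (-1) = sineCoeff (ψ s) k

/-- The sum `√2 ∑ₖ w_k(y) sin(πkx)` of the sine series. -/
def sineSeries (w : ℕ+ → ℝ → ℝ) : ℝ → ℝ → ℝ := fun x y =>
  √2 * ∑' k : ℕ+, w k y * Real.sin (π * k * x)

/-- The sine series may be differentiated term by term: all series of derivatives of order at most
`2n - 1` converge uniformly on the closed rectangle, and all those of order at most `2n` converge
uniformly on `Ω₊ ∪ Ω₋`, to the corresponding derivative of the sum. -/
def ConvergesTermwise (n : ℕ) (w : ℕ+ → ℝ → ℝ) : Prop :=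
  (∀ i j : ℕ, i + j ≤ 2 * n - 1 →
    HasSumUniformlyOn
      (fun (k : ℕ+) (p : ℝ × ℝ) =>
        √2 * (iteratedDerivWithin j (w k) (Icc (-1) 1) p.2
          * iteratedDeriv i (fun x : ℝ => Real.sin (π * k * x)) p.1))
      (fun p : ℝ × ℝ => iteratedDerivWithin i
        (fun x => iteratedDerivWithin j (fun y => sineSeries w x y) (Icc (-1) 1) p.2)
        (Icc 0 1) p.1)
      omegaClosure) ∧
  (∀ i j : ℕ, i + j ≤ 2 * n →
    HasSumUniformlyOn
      (fun (k : ℕ+) (p : ℝ × ℝ) =>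
        √2 * (iteratedDeriv j (w k) p.2
          * iteratedDeriv i (fun x : ℝ => Real.sin (π * k * x)) p.1))
      (fun p : ℝ × ℝ => iteratedDeriv i
        (fun x => iteratedDeriv j (fun y => sineSeries w x y) p.2) p.1)
      (omegaPlus ∪ omegaMinus))

/-! ### The determinants -/

/-- The order `t = 0, …, 2n - 1` of the matching condition attached to a row index: `0, …, n - 1`
in the left summand and `n, …, 2n - 1` in the right one. -/
def matchOrder {n : ℕ} : Fin n ⊕ Fin n → ℕ :=
  Sum.elim (fun i => (i : ℕ)) (fun i => n + (i : ℕ))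

/-- The matrix of the linear system for the coefficients of
`w(y) = ∑ₛ (c₂ₛ₋₁ exp(aₛπky) + c₂ₛ exp(-aₛπky))` for `y > 0` and
`w(y) = ∑ₛ (d₂ₛ₋₁ cos(πkaₛy) + d₂ₛ sin(πkaₛy))` for `y < 0`.
Rows: conditions at `y = 1`, conditions at `y = -1`, matching conditions at `y = 0`.
Columns: `c₂ₛ₋₁`, `c₂ₛ`, `d₂ₛ₋₁`, `d₂ₛ`. -/
def mainMatrix {n : ℕ} (a : Fin n → ℝ) (k : ℕ+) :
    Matrix ((Fin n ⊕ Fin n) ⊕ (Fin n ⊕ Fin n)) ((Fin n ⊕ Fin n) ⊕ (Fin n ⊕ Fin n)) ℝ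
  | .inl (.inl m), .inl (.inl s) => a s ^ (2 * (m : ℕ)) * Real.exp (π * k * a s)
  | .inl (.inl m), .inl (.inr s) => a s ^ (2 * (m : ℕ)) * Real.exp (-(π * k * a s))
  | .inl (.inl _), .inr _ => 0
  | .inl (.inr _), .inl _ => 0
  | .inl (.inr m), .inr (.inl s) => a s ^ (2 * (m : ℕ)) * Real.cos (π * k * (-a s))
  | .inl (.inr m), .inr (.inr s) => a s ^ (2 * (m : ℕ)) * Real.sin (π * k * (-a s))
  | .inr t, .inl (.inl s) => a s ^ matchOrder t
  | .inr t, .inl (.inr s) => (-a s) ^ matchOrder t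
  | .inr t, .inr (.inl s) => -(a s ^ matchOrder t * Real.cos (π * matchOrder t / 2))
  | .inr t, .inr (.inr s) => -(a s ^ matchOrder t * Real.sin (π * matchOrder t / 2))

/-- The main determinant `Δ = Δ(k)` (up to a sign, which depends on the order of the unknowns). -/
def delta {n : ℕ} (a : Fin n → ℝ) (k : ℕ+) : ℝ := (mainMatrix a k).det

/-- The matrix of `Δ₂`. Columns: `-aₛ`, `iaₛ`, `-iaₛ`. -/
def delta2Matrix {n : ℕ} (a : Fin n → ℝ) (k : ℕ+) :
    Matrix (Fin n ⊕ (Fin n ⊕ Fin n)) (Fin n ⊕ (Fin n ⊕ Fin n)) ℂ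
  | .inl _, .inl _ => 0
  | .inl m, .inr (.inl s) =>
      (a s : ℂ) ^ (2 * (m : ℕ)) * Complex.exp (-(Complex.I * π * k * a s))
  | .inl m, .inr (.inr s) =>
      (a s : ℂ) ^ (2 * (m : ℕ)) * Complex.exp (Complex.I * π * k * a s)
  | .inr t, .inl s => (-(a s : ℂ)) ^ matchOrder t
  | .inr t, .inr (.inl s) => (Complex.I * a s) ^ matchOrder t
  | .inr t, .inr (.inr s) => (-(Complex.I * a s)) ^ matchOrder t

/-- The determinant `Δ₂ = Δ₂(k)` (up to a sign, which depends on the order of the columns): the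
limiting form of `Δ(k)` after division by `exp(πk(a₁ + … + aₙ)) ∏_{j > s} (aⱼ² - aₛ²)`. -/
def delta2 {n : ℕ} (a : Fin n → ℝ) (k : ℕ+) : ℂ :=
  (-(Complex.I / 2)) ^ n * (delta2Matrix a k).det

/-- The small-denominator bound `|Δ₂(k)| > M / k^γ` with a constant `M > 0`, for all `k` with the
possible exception of a finite number. -/
def SmallDenominatorBound {n : ℕ} (a : Fin n → ℝ) (γ : ℝ) : Prop :=
  ∃ M : ℝ, 0 < M ∧ ∀ᶠ k : ℕ+ in cofinite, M / (k : ℝ) ^ γ < ‖delta2 a k‖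

/-! ### The arithmetic condition for rational coefficients -/

/-- `∏_{j > i} (bⱼ - bᵢ)` for the tuple `(a₁, …, aₙ, i ε₁ a₁, …, i εₙ aₙ)`, where `εⱼ = -1` for
`j ∈ S` and `εⱼ = 1` otherwise. -/
def differenceProduct {n : ℕ} (q : Fin n → ℚ) (S : Finset (Fin n)) : ℂ :=
  let b : Fin (n + n) → ℂ := Fin.append (fun j => (q j : ℂ))
    (fun j => if j ∈ S then -(Complex.I * (q j : ℂ)) else Complex.I * (q j : ℂ))
  ∏ i, ∏ j ∈ Finset.Ioi i, (b j - b i)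

/-- The least common multiple of the denominators of all the sums of the `qⱼ`. -/
def commonDenominator {n : ℕ} (q : Fin n → ℚ) : ℕ :=
  (Finset.univ : Finset (Finset (Fin n))).lcm (fun S => (∑ j ∈ S, q j).den)

/-- For `∑_{j ∈ S} qⱼ = s/t` in lowest terms, the exponent `m · (commonDenominator / t)`, where `m`
is the remainder of `k s` modulo `t`. -/
def phaseExponent {n : ℕ} (q : Fin n → ℚ) (k : ℕ+) (S : Finset (Fin n)) : ℕ :=
  ((k : ℕ) * (∑ j ∈ S, q j).num.toNat) % (∑ j ∈ S, q j).den
    * (commonDenominator q / (∑ j ∈ S, q j).den)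

/-- The polynomial in `z` whose value at `exp(2πi / commonDenominator)` is, up to a factor that is
nonzero and of modulus independent of `k`, the determinant `Δ₂(k)`. -/
def phasePolynomial {n : ℕ} (q : Fin n → ℚ) (k : ℕ+) (z : ℂ) : ℂ :=
  ∑ S : Finset (Fin n), (-1) ^ S.card * differenceProduct q S * z ^ phaseExponent q k S

/-- Whenever a root of one of the polynomials has modulus one and argument `πb/c` in `(0, 2π)`, with
`b/c` in lowest terms, the common denominator is coprime to `2c`. -/
def RationalCondition {n : ℕ} (q : Fin n → ℚ) : Prop :=
  ∀ (k : ℕ+) (z : ℂ), phasePolynomial q k z = 0 →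
    ∀ b c : ℕ, 0 < b → b < 2 * c → Nat.Coprime b c →
      z = Complex.exp (Complex.I * (π * b / c)) →
      Nat.gcd (commonDenominator q) (2 * c) = 1

/-! ### Conditions on the data -/

/-- The order `2n + 1 + α` of smoothness, where `α = γ` if `γ` is an integer and `α = [γ] + 1`
otherwise. -/
def dataOrder (n : ℕ) (γ : ℝ) : ℕ := 2 * n + 1 + ⌈γ⌉₊

/-- Smoothness `C^N[0,1]` of a boundary function, together with the conditions
`(f^{(s-1)}(x) sin(πkx + πs/2)) |_{x=0}^{x=1} = 0` for `s = 1, …, N` and all `k`. -/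
structure IsAdmissibleDatum (N : ℕ) (f : ℝ → ℝ) : Prop where
  contDiffOn : ContDiffOn ℝ (N : WithTop ℕ∞) f (Icc 0 1)
  compatible : ∀ k : ℕ+, ∀ s : ℕ, 1 ≤ s → s ≤ N →
    iteratedDerivWithin (s - 1) f (Icc 0 1) 1 * Real.sin (π * k * 1 + π / 2 * s)
      - iteratedDerivWithin (s - 1) f (Icc 0 1) 0 * Real.sin (π * k * 0 + π / 2 * s) = 0

end DirichletProblem

end

open DirichletProblem

open DirichletProblem

/-! Separation of variables reduces the problem to one finite linear system per frequency `k`;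
everything rests on a lower bound for its determinant.

Every solution of the mode equation on a half is a combination of exponentials (`y > 0`) or of sines
and cosines (`y < 0`), so the coefficient problem is equivalent to the linear system with matrix
`mainMatrix` (`IsModeSolution.exists_eq_modeJet`, `isModeSolution_modeJet`). Once the columns
growing like exp(πk aₛ) are normalised, this matrix is exponentially close to one whose determinant
is, up to a constant factor, Δ₂ in modulus. An exponentially small error cannot compete with k^(-γ),
so the small-denominator bound passes from Δ₂ to the normalised determinant, and Cramer's rule
bounds the normalised coefficients by k^γ times the data (`SmallDenominatorBound.eventually_bound`).

The modulus of Δ₂(k) depends only on the phases wₛ = exp(2πi k aₛ). For natural aₛ all phases are 1,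
and the remaining determinant is a nonzero constant by a root count for polynomials
(`det_reducedMatrix_one_ne_zero`). For rational aₛ, expanding it in the phases gives P_k(ζ) with ζ =
exp(2πi/T). Only finitely many values of its modulus occur, and the arithmetic condition excludes
zero among them unless T = 1, which is the natural case.

For the series, integration by parts 2n + 1 + α times makes the sine coefficients of the data small.
Of these powers of k, 2n pay for derivatives, α for small denominators, and the last one, combined
with Parseval, gives absolute summability (`summable_pow_mul_sineCoeff`, `summable_scaledSize`).
Hence all termwise derivatives up to order 2n have one summable majorant. The finitely many
exceptional k do not affect convergence.

For uniqueness, the sine coefficients of a solution with zero data should solve the homogeneous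
coefficient problem. The obstacle is that derivatives of order 2n need not extend to the sides x =
0, 1. Integrating the equation in y first leaves only derivatives of order 2n - 1, which are
continuous there (`integral_topDeriv_sub`). Conversely, a kernel vector of the system gives a
nonzero solution with zero data, because the functions in the ansatz are linearly independent. -/

/-! ### The determinant Δ₂ and natural coefficients -/

/-- The matrix left over from `delta2Matrix` after elimination of its first `n` rows. -/
noncomputable def reducedMatrix {n : ℕ} (a : Fin n → ℝ) (w : Fin n → ℂ) :
    Matrix (Fin n ⊕ Fin n) (Fin n ⊕ Fin n) ℂ
  | t, .inl s => (-(a s : ℂ)) ^ matchOrder t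
  | t, .inr s => (-(Complex.I * a s)) ^ matchOrder t - w s * (Complex.I * a s) ^ matchOrder t

theorem matchOrder_eq_finSumFinEquiv {n : ℕ} (t : Fin n ⊕ Fin n) :
    matchOrder t = (finSumFinEquiv t : ℕ) := by
  rcases t with t | t <;> simp [matchOrder, add_comm]

theorem det_evenVandermonde_ne_zero {K : Type*} [Field K] {n : ℕ} (b : Fin n → K)
    (hb : Function.Injective fun s => b s ^ 2) :
    (Matrix.of fun m s : Fin n => b s ^ (2 * (m : ℕ))).det ≠ 0 := by
  have h : (Matrix.of fun m s : Fin n => b s ^ (2 * (m : ℕ)))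
      = (Matrix.vandermonde fun s => b s ^ 2).transpose := by
    ext m s; simp [Matrix.vandermonde_apply, pow_mul]
  rw [h, Matrix.det_transpose]
  exact Matrix.det_vandermonde_ne_zero_iff.2 hb

/-- Subtracting wₛ times the column of `iaₛ` from that of `-iaₛ` clears the first n rows of the
latter. The determinant then splits into blocks, and the factors exp(-πik aₛ) left in the
Vandermonde block have modulus one. -/
theorem norm_det_delta2Matrix {n : ℕ} (a : Fin n → ℝ) (k : ℕ+) :
    ‖(delta2Matrix a k).det‖ = ‖(Matrix.of fun m s : Fin n => (a s : ℂ) ^ (2 * (m : ℕ))).det‖ *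
      ‖(reducedMatrix a fun s => Complex.exp (2 * Complex.I * π * k * a s)).det‖ := by
  classical
  set w : Fin n → ℂ := fun s => Complex.exp (2 * Complex.I * π * k * a s) with hw
  let e : Fin n → ℂ := fun s => Complex.exp (-(Complex.I * π * k * a s))
  have hew : ∀ s, e s * w s = Complex.exp (Complex.I * π * k * a s) := fun s => by
    simp only [e, hw, ← Complex.exp_add]; congr 1; ring
  let C : Matrix (Fin n ⊕ (Fin n ⊕ Fin n)) (Fin n ⊕ (Fin n ⊕ Fin n)) ℂ :=
    Matrix.fromBlocks 1 0 0 (Matrix.fromBlocks 1 (-Matrix.diagonal w) 0 1)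
  have hC : C.det = 1 := by simp [C, Matrix.det_fromBlocks_zero₂₁]
  -- Exchanging the first two column blocks makes the matrix block triangular; only a sign changes.
  let σ : Equiv.Perm (Fin n ⊕ (Fin n ⊕ Fin n)) :=
    ((Equiv.sumAssoc _ _ _).symm.trans ((Equiv.sumComm _ _).sumCongr (Equiv.refl _))).trans
      (Equiv.sumAssoc _ _ _)
  let F : Matrix (Fin n ⊕ Fin n) (Fin n) ℂ := Matrix.of fun t s => (Complex.I * a s) ^ matchOrder t
  have key : (delta2Matrix a k * C).submatrix id σ =
      Matrix.fromBlocks ((Matrix.of fun m s : Fin n => (a s : ℂ) ^ (2 * (m : ℕ))) *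
        Matrix.diagonal e) 0 F (reducedMatrix a w) := by
    ext i j
    rcases i with i | i <;> rcases j with j | j | j <;>
      simp [σ, C, Matrix.mul_apply, Fintype.sum_sum_type, Matrix.fromBlocks, delta2Matrix,
        Matrix.one_apply, Matrix.diagonal_apply, F, reducedMatrix, e, -Matrix.of_zero]
    · rw [← hew]; simp only [e]; ring
    · ring
  have h1 := Matrix.det_permute' σ (delta2Matrix a k * C)
  rw [key, Matrix.det_fromBlocks_zero₁₂, Matrix.det_mul, Matrix.det_mul, hC, mul_one,
    Matrix.det_diagonal] at h1
  have h2 := congrArg norm h1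
  have he : ‖∏ i, e i‖ = 1 := by
    rw [norm_prod]
    refine Finset.prod_eq_one fun s _ => ?_
    simp only [e]
    rw [show -(Complex.I * π * k * a s) = ((-(π * k * a s) : ℝ) : ℂ) * Complex.I by
      push_cast; ring, Complex.norm_exp_ofReal_mul_I]
  have hs : ‖(((Equiv.Perm.sign σ : ℤˣ) : ℤ) : ℂ)‖ = 1 := by
    rcases Int.units_eq_one_or (Equiv.Perm.sign σ) with h | h <;> simp [h]
  rw [norm_mul, norm_mul, norm_mul, he, hs, mul_one, one_mul] at h2
  exact h2.symm

/-- A left null vector is the coefficient vector of a polynomial p of degree below 2n with p(-aₛ) =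
0 and p(iaₛ) = p(-iaₛ). The second condition forces p to be even, and then p has the 2n distinct
roots ±aₛ. -/
theorem det_reducedMatrix_one_ne_zero {n : ℕ} (a : Fin n → ℝ) (hpos : ∀ j, 0 < a j)
    (ha : Function.Injective a) : (reducedMatrix a fun _ => 1).det ≠ 0 := by
  classical
  intro h
  obtain ⟨v, hv, hv0⟩ := Matrix.exists_vecMul_eq_zero_iff.2 h
  let p : Polynomial ℂ := ∑ t, Polynomial.C (v t) * Polynomial.X ^ matchOrder t
  have hev : ∀ z, p.eval z = ∑ t, v t * z ^ matchOrder t := fun z => by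
    simp [p, Polynomial.eval_finsetSum]
  have hdeg : p.degree < (2 * n : ℕ) := by
    refine (Polynomial.degree_sum_le _ _).trans_lt ?_
    rw [Finset.sup_lt_iff (WithBot.bot_lt_coe _)]
    intro t _
    refine (Polynomial.degree_C_mul_X_pow_le _ _).trans_lt ?_
    rw [matchOrder_eq_finSumFinEquiv]
    have := (finSumFinEquiv t).2
    exact_mod_cast (by omega : ((finSumFinEquiv t : Fin (n + n)) : ℕ) < 2 * n)
  -- Twice the odd part of p; it has the 2n roots ±iaₛ and degree below 2n.
  let r : Polynomial ℂ := p - p.comp (-Polynomial.X)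
  have hrdeg : r.degree < (2 * n : ℕ) := by
    refine (Polynomial.degree_sub_le _ _).trans_lt (max_lt hdeg ?_)
    rcases eq_or_ne p 0 with h0 | h0
    · rw [h0, Polynomial.zero_comp, Polynomial.degree_zero]; exact WithBot.bot_lt_coe _
    · have h3 : (p.comp (-Polynomial.X)).natDegree ≤ p.natDegree := by
        refine Polynomial.natDegree_comp_le.trans ?_
        simp
      have h4 := (Polynomial.natDegree_lt_iff_degree_lt h0).2 hdeg
      exact (Polynomial.degree_le_of_natDegree_le (h3)).trans_lt (by exact_mod_cast h4)
  have card : ∀ (q : Polynomial ℂ) (b : Fin n → ℂ), q.degree < (2 * n : ℕ) →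
      Function.Injective (Sum.elim b (fun s => - b s)) →
      (∀ s, q.eval (b s) = 0 ∧ q.eval (- b s) = 0) → q = 0 := by
    intro q b hq hb hroot
    refine Polynomial.eq_zero_of_degree_lt_of_eval_finset_eq_zero
      (Finset.univ.image (Sum.elim b (fun s => - b s))) ?_ ?_
    · rw [Finset.card_image_of_injective _ hb]
      simpa [two_mul] using hq
    · intro x hx
      obtain ⟨t, -, rfl⟩ := Finset.mem_image.1 hx
      rcases t with t | t
      · exact (hroot t).1
      · exact (hroot t).2
  have inj : ∀ c : ℂ, c ≠ 0 → Function.Injective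
      (Sum.elim (fun s => c * (a s : ℂ)) (fun s => - (c * (a s : ℂ)))) := by
    intro c hc x y hxy
    rcases x with x | x <;> rcases y with y | y <;> simp [hc] at hxy
    · rw [ha hxy]
    · rw [← mul_neg] at hxy
      have h5 := mul_left_cancel₀ hc hxy
      have h6 : a x = - a y := by exact_mod_cast h5
      linarith [hpos x, hpos y]
    · rw [← mul_neg] at hxy
      have h5 := mul_left_cancel₀ hc hxy
      have h6 : - a x = a y := by exact_mod_cast h5
      linarith [hpos x, hpos y]
    · rw [ha hxy]
  have hI : ∀ s, p.eval (-(Complex.I * a s)) = p.eval (Complex.I * a s) := fun s => by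
    have := congrFun hv0 (Sum.inr s)
    rw [hev, hev, ← sub_eq_zero, ← Finset.sum_sub_distrib]
    simpa [Matrix.vecMul, dotProduct, reducedMatrix, mul_sub] using this
  have hr : r = 0 := card r (fun s => Complex.I * a s) hrdeg (inj _ Complex.I_ne_zero)
    fun s => by simp [r, Polynomial.eval_comp, hI s]
  have hneg : ∀ s, p.eval (-(a s : ℂ)) = 0 := fun s => by
    have := congrFun hv0 (Sum.inl s)
    rw [hev]
    simpa [Matrix.vecMul, dotProduct, reducedMatrix] using this
  have hp : p = 0 := card p (fun s => 1 * a s) hdeg (inj 1 one_ne_zero) fun s => by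
    have h7 := congrArg (Polynomial.eval (a s : ℂ)) hr
    simp [r, Polynomial.eval_comp, hneg s] at h7
    simp [h7, hneg s]
  refine hv (funext fun t => ?_)
  have h8 := congrArg (fun q => Polynomial.coeff q (matchOrder t)) hp
  simp only [p, Polynomial.finsetSum_coeff, Polynomial.coeff_C_mul, Polynomial.coeff_X_pow,
    Polynomial.coeff_zero] at h8
  rw [Finset.sum_eq_single t] at h8
  · simpa using h8
  · intro b _ hb
    rw [if_neg, mul_zero]
    rw [matchOrder_eq_finSumFinEquiv, matchOrder_eq_finSumFinEquiv]
    intro hh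
    exact hb (finSumFinEquiv.injective (Fin.ext hh)).symm
  · simp

theorem norm_delta2 {n : ℕ} (a : Fin n → ℝ) (k : ℕ+) :
    ‖delta2 a k‖ = (1 / 2) ^ n * ‖(delta2Matrix a k).det‖ := by
  simp [delta2]

theorem injective_sq_cast {n : ℕ} (a : Fin n → ℝ) (hpos : ∀ j, 0 < a j)
    (ha : Function.Injective a) : Function.Injective fun s => (a s : ℂ) ^ 2 := by
  intro x y h
  have h' : a x ^ 2 = a y ^ 2 := by
    dsimp only at h
    exact_mod_cast h
  exact ha ((pow_left_inj₀ (hpos x).le (hpos y).le two_ne_zero).1 h')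

/-- All phases exp(2πik aₛ) equal 1, so the modulus of Δ₂(k) is a positive constant. Half of it
serves as M because the bound is strict. -/
theorem smallDenominatorBound_of_nat {n : ℕ} (a : Fin n → ℝ)
    (hpos : ∀ j, 0 < a j) (ha : Function.Injective a) (hnat : ∀ j, ∃ m : ℕ, a j = m) :
    SmallDenominatorBound a 0 := by
  have h1 := det_evenVandermonde_ne_zero (fun s => (a s : ℂ)) (injective_sq_cast a hpos ha)
  have h2 := det_reducedMatrix_one_ne_zero a hpos ha
  have hk : ∀ k : ℕ+, ‖delta2 a k‖ = (1 / 2) ^ n *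
      (‖(Matrix.of fun m s : Fin n => (a s : ℂ) ^ (2 * (m : ℕ))).det‖ *
        ‖(reducedMatrix a fun _ => 1).det‖) := by
    intro k
    have : (fun s => Complex.exp (2 * Complex.I * π * k * a s)) = fun _ => 1 := by
      funext s
      obtain ⟨m, hm⟩ := hnat s
      rw [hm, Complex.exp_eq_one_iff]
      exact ⟨k * m, by push_cast; ring⟩
    rw [norm_delta2, norm_det_delta2Matrix, this]
  have hc : 0 < (1 / 2 : ℝ) ^ n *
      (‖(Matrix.of fun m s : Fin n => (a s : ℂ) ^ (2 * (m : ℕ))).det‖ *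
        ‖(reducedMatrix a fun _ => 1).det‖) := by positivity
  refine ⟨_, half_pos hc, Eventually.of_forall fun k => ?_⟩
  rw [hk, rpow_zero, div_one]
  exact half_lt_self hc

/-! ### Rational coefficients -/

/-- The determinant is multilinear in the n columns gₛ - wₛ fₛ. Choosing the second term for s in S
and the first elsewhere leaves a Vandermonde determinant for each S. -/
theorem det_reducedMatrix_eq_sum {n : ℕ} (q : Fin n → ℚ) (w : Fin n → ℂ) :
    (reducedMatrix (fun j => (q j : ℝ)) w).det =
      (∏ i : Fin n ⊕ Fin n, (-1) ^ matchOrder i) *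
        ∑ S : Finset (Fin n), (-1) ^ S.card * differenceProduct q S * ∏ j ∈ S, w j := by
  classical
  let D := (Matrix.detRowAlternating (R := ℂ) (n := Fin n ⊕ Fin n)).toMultilinearMap
  let u : Fin n → (Fin n ⊕ Fin n → ℂ) := fun s t => (-(q s : ℂ)) ^ matchOrder t
  let f : Fin n → (Fin n ⊕ Fin n → ℂ) := fun s t => (Complex.I * q s) ^ matchOrder t
  let g : Fin n → (Fin n ⊕ Fin n → ℂ) := fun s t => (-(Complex.I * q s)) ^ matchOrder t
  let c : Fin n → ℂ := fun s => - w s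
  let T := MultilinearMap.currySum D u
  have hT : ∀ m, T m = (Matrix.of (Sum.elim u m)).det := by
    intro m
    simp only [T, D, MultilinearMap.currySum_apply]
    change Matrix.det _ = Matrix.det _
    congr 1
  have h1 : (reducedMatrix (fun j => (q j : ℝ)) w).det = T ((fun s => c s • f s) + g) := by
    rw [hT, ← Matrix.det_transpose]
    congr 1
    ext i j
    rcases i with i | i
    · simp [reducedMatrix, u]
    · simp [reducedMatrix, c, f, g, sub_eq_neg_add]
  rw [h1, MultilinearMap.map_add_univ, Finset.mul_sum]
  refine Finset.sum_congr rfl fun S _ => ?_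
  have h2 : S.piecewise (fun s => c s • f s) g =
      S.piecewise (fun s => c s • (S.piecewise f g) s) (S.piecewise f g) := by
    ext s t
    by_cases hs : s ∈ S <;> simp [hs]
  rw [h2, MultilinearMap.map_piecewise_smul, hT]
  let b : Fin (n + n) → ℂ := Fin.append (fun j => (q j : ℂ))
    (fun j => if j ∈ S then -(Complex.I * (q j : ℂ)) else Complex.I * (q j : ℂ))
  -- Extracting (-1)^t from the matching condition of order t reverses the sign of all nodes, so
  -- that they become those of `differenceProduct`.
  have h3 : (Matrix.of (Sum.elim u (S.piecewise f g))) =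
      Matrix.of (fun i j : Fin n ⊕ Fin n => ((-1 : ℂ)) ^ matchOrder j *
        ((Matrix.vandermonde b).submatrix finSumFinEquiv finSumFinEquiv) i j) := by
    ext i j
    rcases i with i | i
    · simp [u, Matrix.vandermonde_apply, b, matchOrder_eq_finSumFinEquiv, ← mul_pow]
    · have hb : b (finSumFinEquiv (Sum.inr i)) =
          if i ∈ S then -(Complex.I * (q i : ℂ)) else Complex.I * (q i : ℂ) := by
        rw [finSumFinEquiv_apply_right]
        exact Fin.append_right _ _ i
      rw [Matrix.of_apply, Matrix.of_apply, Matrix.submatrix_apply, Matrix.vandermonde_apply, hb]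
      by_cases hs : i ∈ S <;> simp [f, g, hs, matchOrder_eq_finSumFinEquiv, ← mul_pow]
  rw [h3, Matrix.det_mul_row, Matrix.det_submatrix_equiv_self, Matrix.det_vandermonde]
  simp only [c, differenceProduct, smul_eq_mul, b, Finset.prod_neg]
  ring

theorem commonDenominator_ne_zero {n : ℕ} (q : Fin n → ℚ) : commonDenominator q ≠ 0 := by
  unfold commonDenominator
  rw [Ne, Finset.lcm_eq_zero_iff]
  simp

/-- The product of the phases is exp(2πik s/t) for the reduced fraction s/t of the partial sum, so
only ks modulo t matters. This makes it a power of the single root of unity exp(2πi/T). -/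
theorem prod_exp_eq_pow_phaseExponent {n : ℕ} (q : Fin n → ℚ) (hpos : ∀ j, 0 < q j) (k : ℕ+)
    (S : Finset (Fin n)) :
    ∏ j ∈ S, Complex.exp (2 * Complex.I * π * k * ((q j : ℝ) : ℂ)) =
      Complex.exp (2 * π * Complex.I / commonDenominator q) ^ phaseExponent q k S := by
  set r : ℚ := ∑ j ∈ S, q j with hr
  have hr0 : 0 ≤ r := Finset.sum_nonneg fun j _ => (hpos j).le
  have hdvd : r.den ∣ commonDenominator q := Finset.dvd_lcm (f := fun S => (∑ j ∈ S, q j).den)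
    (Finset.mem_univ S)
  have hT0 := commonDenominator_ne_zero q
  obtain ⟨d, hd⟩ := hdvd
  have hden : (r.den : ℂ) ≠ 0 := by exact_mod_cast r.den_nz
  have hd0 : (d : ℂ) ≠ 0 := by
    have : d ≠ 0 := fun h => hT0 (by rw [hd, h, mul_zero])
    exact_mod_cast this
  have hnum : ((r.num.toNat : ℕ) : ℂ) = (r.num : ℂ) := by
    have : ((r.num.toNat : ℕ) : ℤ) = r.num := Int.toNat_of_nonneg (Rat.num_nonneg.2 hr0)
    exact_mod_cast congrArg (Int.cast : ℤ → ℂ) this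
  have hrC : (r : ℂ) = r.num / r.den := by exact_mod_cast (Rat.cast_def r : (r : ℂ) = _)
  have hdiv : commonDenominator q / r.den = d := by
    rw [hd]; exact Nat.mul_div_cancel_left _ r.den_pos
  have hsum : ∑ j ∈ S, 2 * Complex.I * π * k * ((q j : ℝ) : ℂ) = 2 * Complex.I * π * k * r := by
    rw [← Finset.mul_sum, hr]; push_cast; rfl
  rw [← Complex.exp_sum, ← Complex.exp_nat_mul, phaseExponent, ← hr, hdiv, hsum, hd,
    Complex.exp_eq_exp_iff_exists_int]
  -- The two exponents differ by 2πi times the quotient in the division with remainder.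
  refine ⟨((k : ℕ) * r.num.toNat / r.den : ℕ), ?_⟩
  have hmod : (((k : ℕ) * r.num.toNat : ℕ) : ℂ) = r.den * (((k : ℕ) * r.num.toNat / r.den : ℕ) : ℂ)
      + (((k : ℕ) * r.num.toNat % r.den : ℕ) : ℂ) := by
    exact_mod_cast (Nat.div_add_mod _ _).symm
  rw [Nat.cast_mul, hnum] at hmod
  rw [hrC, Nat.cast_mul r.den d, Nat.cast_mul _ d]
  simp only [Int.cast_natCast]
  field_simp
  rw [hmod]
  ring

/-- The argument 2π/T of the root of unity is πb/c with b = 1, c = T/2 for even T and b = 2, c = T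
for odd T. In both cases T divides 2c, so the condition would force T = 1. -/
theorem phasePolynomial_ne_zero_of_rationalCondition {n : ℕ} (q : Fin n → ℚ)
    (h : RationalCondition q) (hT : commonDenominator q ≠ 1) (k : ℕ+) :
    phasePolynomial q k (Complex.exp (2 * π * Complex.I / commonDenominator q)) ≠ 0 := by
  intro h0
  have hT0 := commonDenominator_ne_zero q
  have := h k _ h0
  set T := commonDenominator q
  rcases Nat.even_or_odd' T with ⟨c, hc | hc⟩
  · have h1 := this 1 c one_pos (by omega) (Nat.coprime_one_left c) (by
      congr 1; rw [hc]; push_cast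
      have : (c : ℂ) ≠ 0 := by
        have : c ≠ 0 := by omega
        exact_mod_cast this
      field_simp)
    rw [← hc, Nat.gcd_self] at h1
    exact hT h1
  · have h1 := this 2 T two_pos (by omega) (by rw [Nat.coprime_two_left]; exact ⟨c, hc⟩) (by
      congr 1; push_cast; ring)
    rw [Nat.gcd_eq_left (Dvd.intro_left 2 rfl)] at h1
    exact hT h1

theorem phaseExponent_lt {n : ℕ} (q : Fin n → ℚ) (k : ℕ+) (S : Finset (Fin n)) :
    phaseExponent q k S < commonDenominator q := by
  have hdvd : (∑ j ∈ S, q j).den ∣ commonDenominator q :=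
    Finset.dvd_lcm (f := fun S => (∑ j ∈ S, q j).den) (Finset.mem_univ S)
  have hT0 := Nat.pos_of_ne_zero (commonDenominator_ne_zero q)
  calc phaseExponent q k S < (∑ j ∈ S, q j).den * (commonDenominator q / (∑ j ∈ S, q j).den) := by
        refine Nat.mul_lt_mul_of_pos_right (Nat.mod_lt _ (Rat.den_pos _)) ?_
        exact Nat.div_pos (Nat.le_of_dvd hT0 hdvd) (Rat.den_pos _)
    _ = _ := Nat.mul_div_cancel' hdvd

theorem smallDenominatorBound_of_rat {n : ℕ} (q : Fin n → ℚ)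
    (hpos : ∀ j, 0 < q j) (ha : Function.Injective q) (h : RationalCondition q) :
    SmallDenominatorBound (fun j => (q j : ℝ)) 0 := by
  have hpos' : ∀ j, (0 : ℝ) < q j := fun j => by exact_mod_cast hpos j
  have ha' : Function.Injective fun j => (q j : ℝ) := fun x y hxy => ha (by
    dsimp only at hxy
    exact_mod_cast hxy)
  -- For T = 1 the root of unity is 1, whose argument lies outside (0, 2π), and the condition says
  -- nothing about it. But then every coefficient is natural, as singletons S show.
  by_cases hT : commonDenominator q = 1
  · refine smallDenominatorBound_of_nat _ hpos' ha' fun j => ⟨(q j).num.toNat, ?_⟩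
    have hdvd : (q j).den ∣ commonDenominator q := by
      simpa [commonDenominator] using Finset.dvd_lcm (f := fun S => (∑ j ∈ S, q j).den) (Finset.mem_univ {j})
    rw [hT, Nat.dvd_one] at hdvd
    have h1 : (((q j).num.toNat : ℕ) : ℤ) = (q j).num :=
      Int.toNat_of_nonneg (Rat.num_nonneg.2 (hpos j).le)
    have h2 : q j = (((q j).num.toNat : ℕ) : ℚ) := by
      conv_lhs => rw [← Rat.num_div_den (q j), hdvd, ← h1]
      rw [Nat.cast_one, div_one, Int.cast_natCast]
    exact_mod_cast congrArg (Rat.cast : ℚ → ℝ) h2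
  set T := commonDenominator q
  set ζ := Complex.exp (2 * π * Complex.I / T) with hζ
  set A : ℝ := (1 / 2) ^ n *
    ‖(Matrix.of fun m s : Fin n => (((q s : ℝ)) : ℂ) ^ (2 * (m : ℕ))).det‖ with hA
  have hA0 : 0 < A := by
    have := det_evenVandermonde_ne_zero (fun s => (((q s : ℝ)) : ℂ)) (injective_sq_cast _ hpos' ha')
    positivity
  have hk : ∀ k : ℕ+, ‖delta2 (fun j => (q j : ℝ)) k‖ = A * ‖phasePolynomial q k ζ‖ := by
    intro k
    rw [norm_delta2, norm_det_delta2Matrix, det_reducedMatrix_eq_sum, hA, norm_mul (∏ i, _),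
      norm_prod, mul_assoc ((1 / 2 : ℝ) ^ n)]
    have h1 := prod_exp_eq_pow_phaseExponent q hpos k
    simp only [h1, norm_pow, norm_neg, norm_one, one_pow, Finset.prod_const_one, one_mul]
    rfl
  -- All exponents are below T, so there are finitely many exponent patterns; the least modulus over
  -- k is attained and hence positive.
  have hfin : (range fun k => ‖phasePolynomial q k ζ‖).Finite := by
    let G : (Finset (Fin n) → Fin T) → ℝ := fun m =>
      ‖∑ S : Finset (Fin n), (-1) ^ S.card * differenceProduct q S * ζ ^ (m S : ℕ)‖
    refine (Set.finite_range G).subset ?_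
    rintro _ ⟨k, rfl⟩
    exact ⟨fun S => ⟨_, phaseExponent_lt q k S⟩, rfl⟩
  obtain ⟨x, ⟨k₀, rfl⟩, hx⟩ := hfin.exists_minimalFor id _ ⟨_, mem_range_self 1⟩
  have hmin : ∀ k, ‖phasePolynomial q k₀ ζ‖ ≤ ‖phasePolynomial q k ζ‖ := fun k => by
    rcases le_total ‖phasePolynomial q k₀ ζ‖ ‖phasePolynomial q k ζ‖ with h | h
    · exact h
    · exact hx (mem_range_self k) h
  have hk0 : 0 < ‖phasePolynomial q k₀ ζ‖ :=
    norm_pos_iff.2 (phasePolynomial_ne_zero_of_rationalCondition q h hT k₀)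
  refine ⟨A * ‖phasePolynomial q k₀ ζ‖ / 2, by positivity, Eventually.of_forall fun k => ?_⟩
  rw [hk, rpow_zero, div_one]
  have := mul_le_mul_of_nonneg_left (hmin k) hA0.le
  have := mul_pos hA0 hk0
  linarith

/-! ### From Δ₂ to Δ: perturbation of determinants -/

theorem abs_det_le_factorial_mul_prod {ι : Type*} [Fintype ι] [DecidableEq ι]
    (m : ι → ι → ℝ) : ‖(Matrix.of m).det‖ ≤ (Fintype.card ι).factorial * ∏ i, ‖m i‖ := by
  rw [Matrix.det_apply]
  refine (norm_sum_le _ _).trans ?_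
  refine (Finset.sum_le_card_nsmul _ _ (∏ i, ‖m i‖) fun σ _ => ?_).trans ?_
  · have h1 : ‖Equiv.Perm.sign σ • ∏ i, (Matrix.of m) (σ i) i‖ = ∏ i, ‖m (σ i) i‖ := by
      rw [← norm_prod]
      rcases Int.units_eq_one_or (Equiv.Perm.sign σ) with h | h <;> simp [h]
    rw [h1, ← Equiv.prod_comp σ fun i => ‖m i‖]
    exact Finset.prod_le_prod (fun _ _ => norm_nonneg _) fun i _ => norm_le_pi_norm _ _
  · simp [Fintype.card_perm]

/-- The determinant is Lipschitz on bounded sets of matrices, as a bounded multilinear map of the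
rows. -/
theorem abs_det_sub_det_le {ι : Type*} [Fintype ι] [DecidableEq ι] (A B : Matrix ι ι ℝ)
    {K ε : ℝ} (hK : 0 ≤ K) (hε : 0 ≤ ε) (hA : ∀ i j, |A i j| ≤ K) (hB : ∀ i j, |B i j| ≤ K)
    (hAB : ∀ i j, |A i j - B i j| ≤ ε) :
    |A.det - B.det| ≤
      (Fintype.card ι).factorial * Fintype.card ι * K ^ (Fintype.card ι - 1) * ε := by
  have h := MultilinearMap.norm_image_sub_le_of_bound
    (Matrix.detRowAlternating (R := ℝ) (n := ι)).toMultilinearMap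
    (C := (Fintype.card ι).factorial) (by positivity) abs_det_le_factorial_mul_prod
    (fun i => A i) (fun i => B i)
  have e1 : ∀ (M : ι → ι → ℝ) (c : ℝ), 0 ≤ c → (∀ i j, |M i j| ≤ c) → ‖M‖ ≤ c := fun M c hc hM =>
    (pi_norm_le_iff_of_nonneg hc).2 fun i => (pi_norm_le_iff_of_nonneg hc).2 fun j => hM i j
  refine h.trans ?_
  gcongr
  · exact max_le (e1 _ _ hK hA) (e1 _ _ hK hB)
  · exact e1 _ _ hε hAB

/-- Cramer's rule without division: multiply by the adjugate. Its entries are determinants with one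
row replaced by a unit vector, which is why `1 ≤ K` is convenient. -/
theorem abs_det_mul_le_of_mulVec_eq {ι : Type*} [Fintype ι] [DecidableEq ι] (A : Matrix ι ι ℝ)
    {K : ℝ} (hK : 1 ≤ K) (hA : ∀ i j, |A i j| ≤ K) (x r : ι → ℝ) (h : A.mulVec x = r) (i : ι) :
    |A.det * x i| ≤ (Fintype.card ι).factorial * K ^ Fintype.card ι * ∑ j, |r j| := by
  have h1 : A.det * x i = ∑ j, A.adjugate i j * r j := by
    have h2 : A.adjugate.mulVec r = A.det • x := by
      rw [← h, Matrix.mulVec_mulVec, Matrix.adjugate_mul, Matrix.smul_mulVec, Matrix.one_mulVec]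
    have := congrFun h2 i
    simpa [Matrix.mulVec, dotProduct] using this.symm
  rw [h1, Finset.mul_sum]
  refine (Finset.abs_sum_le_sum_abs _ _).trans (Finset.sum_le_sum fun j _ => ?_)
  rw [abs_mul]
  refine mul_le_mul_of_nonneg_right ?_ (abs_nonneg _)
  rw [Matrix.adjugate_apply]
  have := Matrix.det_le (A := A.updateRow j (Pi.single i 1)) (abv := AbsoluteValue.abs) (x := K) ?_
  · simpa [nsmul_eq_mul] using this
  · intro p q
    rw [AbsoluteValue.abs_apply, Matrix.updateRow_apply]
    split_ifs
    · rw [Pi.single_apply]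
      split_ifs <;> simp <;> linarith
    · exact hA p q

/-- The factors that make the columns of `mainMatrix` bounded. -/
noncomputable def columnScale {n : ℕ} (a : Fin n → ℝ) (k : ℕ+) :
    (Fin n ⊕ Fin n) ⊕ (Fin n ⊕ Fin n) → ℝ
  | .inl (.inl s) => Real.exp (-(π * k * a s))
  | _ => 1

/-- The unknowns of the scaled system are `x i / columnScale a k i`. -/
noncomputable def scaledMatrix {n : ℕ} (a : Fin n → ℝ) (k : ℕ+) :
    Matrix ((Fin n ⊕ Fin n) ⊕ (Fin n ⊕ Fin n)) ((Fin n ⊕ Fin n) ⊕ (Fin n ⊕ Fin n)) ℝ :=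
  mainMatrix a k * Matrix.diagonal (columnScale a k)

/-- The nontrivial block of the limiting form of `scaledMatrix`. -/
noncomputable def limitBlock {n : ℕ} (a : Fin n → ℝ) (k : ℕ+) :
    Matrix (Fin n ⊕ (Fin n ⊕ Fin n)) (Fin n ⊕ (Fin n ⊕ Fin n)) ℝ
  | .inl _, .inl _ => 0
  | .inl m, .inr (.inl s) => a s ^ (2 * (m : ℕ)) * Real.cos (π * k * (-a s))
  | .inl m, .inr (.inr s) => a s ^ (2 * (m : ℕ)) * Real.sin (π * k * (-a s))
  | .inr t, .inl s => (-a s) ^ matchOrder t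
  | .inr t, .inr (.inl s) => -(a s ^ matchOrder t * Real.cos (π * matchOrder t / 2))
  | .inr t, .inr (.inr s) => -(a s ^ matchOrder t * Real.sin (π * matchOrder t / 2))

/-- The limiting form of `scaledMatrix`: all decaying exponentials are dropped. -/
noncomputable def limitMatrix {n : ℕ} (a : Fin n → ℝ) (k : ℕ+) :
    Matrix ((Fin n ⊕ Fin n) ⊕ (Fin n ⊕ Fin n)) ((Fin n ⊕ Fin n) ⊕ (Fin n ⊕ Fin n)) ℝ :=
  (Matrix.fromBlocks (Matrix.of fun m s : Fin n => a s ^ (2 * (m : ℕ))) 0 0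
    (limitBlock a k)).submatrix (Equiv.sumAssoc _ _ _) (Equiv.sumAssoc _ _ _)

/-- In the limit the growing exponentials enter only the conditions at `y = 1`, and no other column
does. -/
theorem det_limitMatrix {n : ℕ} (a : Fin n → ℝ) (k : ℕ+) :
    (limitMatrix a k).det =
      (Matrix.of fun m s : Fin n => a s ^ (2 * (m : ℕ))).det * (limitBlock a k).det := by
  rw [limitMatrix, Matrix.det_submatrix_equiv_self, Matrix.det_fromBlocks_zero₁₂]

theorem I_pow_eq (t : ℕ) :
    Complex.I ^ t = (Real.cos (π * t / 2) : ℂ) + Complex.I * Real.sin (π * t / 2) := by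
  have h : Complex.I = Complex.exp (π / 2 * Complex.I) := by
    rw [Complex.exp_mul_I]
    have h1 : Complex.cos (π / 2) = 0 := by exact_mod_cast congrArg Complex.ofReal Real.cos_pi_div_two
    have h2 : Complex.sin (π / 2) = 1 := by exact_mod_cast congrArg Complex.ofReal Real.sin_pi_div_two
    rw [h1, h2]; simp
  conv_lhs => rw [h, ← Complex.exp_nat_mul]
  rw [show (t : ℂ) * (π / 2 * Complex.I) = ((π * t / 2 : ℝ) : ℂ) * Complex.I by push_cast; ring,
    Complex.exp_mul_I]
  push_cast; ring

/-- Passing from cosine and sine to exp(±iπk aₛ y) is a column operation independent of `k`; it and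
a few signs relate the complex matrix to the real one. -/
theorem exists_norm_delta2_eq {n : ℕ} (a : Fin n → ℝ) :
    ∃ c : ℝ, 0 ≤ c ∧ ∀ k : ℕ+, ‖delta2 a k‖ = c * |(limitBlock a k).det| := by
  classical
  let D1 : Matrix (Fin n ⊕ (Fin n ⊕ Fin n)) (Fin n ⊕ (Fin n ⊕ Fin n)) ℂ :=
    Matrix.diagonal (Sum.elim (fun _ => 1) (fun _ => -1))
  let D2 : Matrix (Fin n ⊕ (Fin n ⊕ Fin n)) (Fin n ⊕ (Fin n ⊕ Fin n)) ℂ :=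
    Matrix.fromBlocks (-1) 0 0 (Matrix.fromBlocks 1 1 (Matrix.diagonal fun _ => Complex.I)
      (Matrix.diagonal fun _ => -Complex.I))
  refine ⟨(1 / 2) ^ n * (‖D1.det‖ * ‖D2.det‖), by positivity, fun k => ?_⟩
  have h1 : delta2Matrix a k = D1 * (limitBlock a k).map (Complex.ofRealHom) * D2 := by
    have e1 : ∀ s, Complex.exp (-(Complex.I * π * k * a s)) =
        (Real.cos (π * k * (-a s)) : ℂ) + Real.sin (π * k * (-a s)) * Complex.I := fun s => by
      rw [show -(Complex.I * π * k * a s) = ((π * k * (-a s) : ℝ) : ℂ) * Complex.I by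
        push_cast; ring, Complex.exp_mul_I]
      push_cast; ring
    have e2 : ∀ s, Complex.exp (Complex.I * π * k * a s) =
        (Real.cos (π * k * (-a s)) : ℂ) - Real.sin (π * k * (-a s)) * Complex.I := fun s => by
      rw [show Complex.I * π * k * a s = ((-(π * k * (-a s)) : ℝ) : ℂ) * Complex.I by
        push_cast; ring, Complex.exp_mul_I, ← Complex.ofReal_cos, ← Complex.ofReal_sin,
        Real.cos_neg, Real.sin_neg]
      push_cast; ring
    have e3 : ∀ (s : Fin n) (t : ℕ), (-(Complex.I * a s)) ^ t = (a s : ℂ) ^ t *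
        ((Real.cos (π * t / 2) : ℂ) - Complex.I * Real.sin (π * t / 2)) := fun s t => by
      have h := congrArg (starRingEnd ℂ) (I_pow_eq t)
      rw [map_pow, map_add, map_mul, Complex.conj_I, Complex.conj_ofReal, Complex.conj_ofReal] at h
      rw [← neg_mul, mul_pow, h]; ring
    ext i j
    rw [Matrix.mul_apply]
    rcases i with i | i <;> rcases j with j | j | j <;>
      simp only [delta2Matrix, D1, D2, Fintype.sum_sum_type, Matrix.diagonal_mul, Matrix.fromBlocks_apply₁₁, Matrix.fromBlocks_apply₁₂,
        Matrix.fromBlocks_apply₂₁, Matrix.fromBlocks_apply₂₂, Matrix.map_apply, limitBlock,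
        Sum.elim_inl, Sum.elim_inr, e1, e2, e3, mul_pow, I_pow_eq] <;>
      simp [Matrix.one_apply, Matrix.diagonal_apply] <;> ring
  rw [norm_delta2, h1, Matrix.det_mul, Matrix.det_mul, norm_mul, norm_mul, ← RingHom.mapMatrix_apply,
    ← RingHom.map_det]
  simp only [Complex.ofRealHom_eq_coe, Complex.norm_real, Real.norm_eq_abs]
  ring

theorem matchOrder_lt {n : ℕ} (t : Fin n ⊕ Fin n) : matchOrder t < 2 * n := by
  have := (finSumFinEquiv t).2
  rw [matchOrder_eq_finSumFinEquiv]; omega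

theorem tendsto_pnat_cofinite_atTop : Tendsto (fun k : ℕ+ => (k : ℝ)) cofinite atTop := by
  have h : Tendsto (fun k : ℕ+ => (k : ℕ)) cofinite atTop := by
    rw [← Nat.cofinite_eq_atTop]
    exact PNat.coe_injective.tendsto_cofinite
  exact tendsto_natCast_atTop_atTop.comp h

/-- The entries that differ are powers of the aₛ times exp(-πk aₛ), so the rate can be π times the
least aₛ. -/
theorem exists_scaledMatrix_bounds {n : ℕ} (a : Fin n → ℝ) (hpos : ∀ j, 0 < a j) :
    ∃ K δ : ℝ, 1 ≤ K ∧ 0 < δ ∧ ∀ k : ℕ+, (∀ i j, |scaledMatrix a k i j| ≤ K) ∧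
      (∀ i j, |limitMatrix a k i j| ≤ K) ∧
      ∀ i j, |scaledMatrix a k i j - limitMatrix a k i j| ≤ K * Real.exp (-(δ * k)) := by
  classical
  obtain ⟨d, hd, hda⟩ : ∃ d : ℝ, 0 < d ∧ ∀ s, d ≤ a s := by
    rcases isEmpty_or_nonempty (Fin n) with h | h
    · exact ⟨1, one_pos, fun s => h.elim s⟩
    · obtain ⟨s, hs⟩ := Finite.exists_min a
      exact ⟨a s, hpos s, hs⟩
  set B : ℝ := 1 + ∑ s, a s with hB
  have hB1 : 1 ≤ B := by
    have := Finset.sum_nonneg fun s (_ : s ∈ Finset.univ) => (hpos s).le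
    linarith
  have haB : ∀ s, a s ≤ B := fun s => by
    have := Finset.single_le_sum (fun s _ => (hpos s).le) (Finset.mem_univ s)
    linarith
  have hpow : ∀ s t, t < 2 * n → a s ^ t ≤ B ^ (2 * n) := fun s t ht =>
    (pow_le_pow_left₀ (hpos s).le (haB s) t).trans (pow_le_pow_right₀ hB1 ht.le)
  have hK1 : 1 ≤ B ^ (2 * n) := one_le_pow₀ hB1
  refine ⟨B ^ (2 * n), π * d, hK1, by positivity, fun k => ?_⟩
  have hk : (0 : ℝ) < k := by exact_mod_cast k.pos
  set E := Real.exp (-(π * d * k)) with hE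
  have hE1 : E ≤ 1 := Real.exp_le_one_iff.2 (by have : 0 ≤ π * d * k := by positivity
                                                linarith)
  have he : ∀ s, Real.exp (-(π * k * a s)) ≤ E := fun s => Real.exp_le_exp.2 (by
    have : π * k * d ≤ π * k * a s := by gcongr; exact hda s
    linarith)
  have hm : ∀ m : Fin n, 2 * (m : ℕ) < 2 * n := fun m => by omega
  have g1 : ∀ s t c, t < 2 * n → |c| ≤ 1 → |a s ^ t * c| ≤ B ^ (2 * n) := fun s t c ht hc => by
    rw [abs_mul, abs_of_nonneg (pow_nonneg (hpos s).le t)]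
    exact (mul_le_of_le_one_right (pow_nonneg (hpos s).le t) hc).trans (hpow s t ht)
  have g2 : ∀ s t, t < 2 * n → |a s ^ t * Real.exp (-(π * k * a s))| ≤ B ^ (2 * n) * E :=
    fun s t ht => by
      rw [abs_of_nonneg (mul_nonneg (pow_nonneg (hpos s).le t) (Real.exp_nonneg _))]
      exact mul_le_mul (hpow s t ht) (he s) (Real.exp_nonneg _) (by positivity)
  have g2' : B ^ (2 * n) * E ≤ B ^ (2 * n) := mul_le_of_le_one_right (by positivity) hE1
  have g3 : ∀ s t, t < 2 * n → |a s ^ t| ≤ B ^ (2 * n) := fun s t ht => by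
    simpa using g1 s t 1 ht (by simp)
  have g4 : ∀ s t, t < 2 * n → |(-a s) ^ t| ≤ B ^ (2 * n) := fun s t ht => by
    rw [abs_pow, abs_neg, ← abs_pow]; exact g3 s t ht
  have p0 : 0 ≤ B ^ (2 * n) := by positivity
  have p1 : 0 ≤ B ^ (2 * n) * E := by positivity
  have hx : ∀ s, Real.exp (π * k * a s) * Real.exp (-(π * k * a s)) = 1 := fun s => by
    rw [← Real.exp_add]; simp
  refine ⟨?_, ?_, ?_⟩
  · intro i j
    rw [scaledMatrix, Matrix.mul_diagonal]
    rcases i with (i | i) | i <;> rcases j with (j | j) | (j | j) <;>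
      simp only [mainMatrix, columnScale, mul_one, zero_mul, abs_zero, p0, mul_assoc, abs_neg]
    · simpa [← mul_assoc, hx] using g3 j _ (hm i)
    · simpa [mul_assoc] using (g2 j _ (hm i)).trans g2'
    · simpa [mul_assoc] using g1 j _ _ (hm i) (Real.abs_cos_le_one _)
    · simpa [mul_assoc] using g1 j _ _ (hm i) (Real.abs_sin_le_one _)
    · simpa [mul_assoc] using (g2 j _ (matchOrder_lt i)).trans g2'
    · exact g4 j _ (matchOrder_lt i)
    · exact g1 j _ _ (matchOrder_lt i) (Real.abs_cos_le_one _)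
    · exact g1 j _ _ (matchOrder_lt i) (Real.abs_sin_le_one _)
  · intro i j
    rw [limitMatrix, Matrix.submatrix_apply]
    rcases i with (i | i) | i <;> rcases j with (j | j) | (j | j) <;>
      simp [limitBlock, p0, -abs_pow, -abs_mul]
    · exact g3 j _ (hm i)
    · simpa using g1 j _ _ (hm i) (Real.abs_cos_le_one (π * k * (-a j)))
    · simpa using g1 j _ (Real.sin (π * k * (-a j))) (hm i) (Real.abs_sin_le_one _)
    · exact g4 j _ (matchOrder_lt i)
    · exact g1 j _ _ (matchOrder_lt i) (Real.abs_cos_le_one _)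
    · exact g1 j _ _ (matchOrder_lt i) (Real.abs_sin_le_one _)
  · intro i j
    rw [scaledMatrix, Matrix.mul_diagonal, limitMatrix, Matrix.submatrix_apply]
    rcases i with (i | i) | i <;> rcases j with (j | j) | (j | j) <;>
      simp [mainMatrix, columnScale, limitBlock, p1, mul_assoc, -abs_pow, -abs_mul]
    · have := hx j
      rw [mul_assoc] at this
      rw [this]; simpa using p1
    · simpa [mul_assoc] using g2 j _ (hm i)
    · simpa [mul_assoc] using g2 j _ (matchOrder_lt i)

/-- For all but finitely many `k`, the system with matrix `mainMatrix a k` is uniquely solvable and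
its solution is controlled by the data, with a loss of `k ^ γ`. -/
theorem DirichletProblem.SmallDenominatorBound.eventually_bound {n : ℕ} {a : Fin n → ℝ} (hpos : ∀ j, 0 < a j)
    (hinj : Function.Injective a) {γ : ℝ} (h : SmallDenominatorBound a γ) :
    ∃ C : ℝ, ∀ᶠ k : ℕ+ in cofinite, delta a k ≠ 0 ∧
      ∀ x r, (mainMatrix a k).mulVec x = r →
        ∀ i, |x i / columnScale a k i| ≤ C * (k : ℝ) ^ γ * ∑ j, |r j| := by
  classical
  obtain ⟨M, hM, hev⟩ := h
  obtain ⟨c, hc, hdelta2⟩ := exists_norm_delta2_eq a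
  obtain ⟨K, δ, hK, hδ, hbd⟩ := exists_scaledMatrix_bounds a hpos
  set N := Fintype.card ((Fin n ⊕ Fin n) ⊕ (Fin n ⊕ Fin n)) with hN
  set v := |(Matrix.of fun m s : Fin n => a s ^ (2 * (m : ℕ))).det| with hv
  have hv0 : 0 < v := abs_pos.2 (det_evenVandermonde_ne_zero a fun x y hxy =>
    hinj ((pow_left_inj₀ (hpos x).le (hpos y).le two_ne_zero).1 hxy))
  set L : ℝ := N.factorial * N * K ^ (N - 1) * K with hL
  -- Dividing by `c + 1` instead of `c` makes positivity of `c` unnecessary.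
  set m : ℝ := v * (M / (c + 1)) with hm
  have hm0 : 0 < m := by positivity
  -- The perturbation of the determinant stays negligible after multiplication by k^γ, so for large
  -- `k` it takes at most half of the lower bound.
  have hlim : Tendsto (fun k : ℕ+ => L * ((k : ℝ) ^ γ * Real.exp (-δ * k))) cofinite (𝓝 0) := by
    have := ((tendsto_rpow_mul_exp_neg_mul_atTop_nhds_zero γ δ hδ).comp
      tendsto_pnat_cofinite_atTop).const_mul L
    simpa using this
  refine ⟨N.factorial * K ^ N / (m / 2), ?_⟩
  filter_upwards [hev, hlim.eventually_lt_const (half_pos hm0)] with k h1 h2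
  have hk : (0 : ℝ) < k := by exact_mod_cast k.pos
  have hkγ : 0 < (k : ℝ) ^ γ := rpow_pos_of_pos hk γ
  obtain ⟨b1, b2, b3⟩ := hbd k
  have h3 : M / (c + 1) / (k : ℝ) ^ γ ≤ |(limitBlock a k).det| := by
    rw [hdelta2] at h1
    rw [div_right_comm, div_le_iff₀ (by positivity)]
    nlinarith [abs_nonneg (limitBlock a k).det]
  have h4 : m / (k : ℝ) ^ γ ≤ |(limitMatrix a k).det| := by
    rw [det_limitMatrix, abs_mul, hm, mul_div_assoc]
    exact mul_le_mul_of_nonneg_left h3 hv0.le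
  have h5 := abs_det_sub_det_le (scaledMatrix a k) (limitMatrix a k) (by linarith) (by positivity)
    b1 b2 b3
  have h6 : L * Real.exp (-(δ * k)) ≤ m / 2 / (k : ℝ) ^ γ := by
    rw [le_div_iff₀ hkγ]
    rw [neg_mul] at h2
    linarith
  have h7 : m / 2 / (k : ℝ) ^ γ ≤ |(scaledMatrix a k).det| := by
    have e1 : m / (k : ℝ) ^ γ = m / 2 / (k : ℝ) ^ γ + m / 2 / (k : ℝ) ^ γ := by ring
    have e2 := abs_sub_abs_le_abs_sub (limitMatrix a k).det (scaledMatrix a k).det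
    rw [abs_sub_comm] at e2
    rw [← hN, ← mul_assoc, ← hL] at h5
    linarith
  have h8 : 0 < m / 2 / (k : ℝ) ^ γ := by positivity
  have hdet : (scaledMatrix a k).det = delta a k * ∏ i, columnScale a k i := by
    rw [scaledMatrix, Matrix.det_mul, Matrix.det_diagonal, delta]
  have hsc : ∀ i, columnScale a k i ≠ 0 := by
    rintro ((i | i) | i) <;> simp [columnScale]
  refine ⟨fun h0 => ?_, fun x r hx i => ?_⟩
  · rw [hdet, h0, zero_mul, abs_zero] at h7
    linarith
  · have hx' : (scaledMatrix a k).mulVec (fun i => x i / columnScale a k i) = r := by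
      rw [scaledMatrix, ← Matrix.mulVec_mulVec, ← hx]
      congr 1
      funext i
      rw [Matrix.mulVec_diagonal, mul_div_cancel₀ _ (hsc i)]
    have h9 := abs_det_mul_le_of_mulVec_eq (scaledMatrix a k) hK b1 _ r hx' i
    rw [abs_mul, ← hN] at h9
    have h10 : m / 2 / (k : ℝ) ^ γ * |x i / columnScale a k i| ≤
        N.factorial * K ^ N * ∑ j, |r j| :=
      (mul_le_mul_of_nonneg_right h7 (abs_nonneg _)).trans h9
    calc |x i / columnScale a k i|
        = (m / 2 / (k : ℝ) ^ γ * |x i / columnScale a k i|) * ((k : ℝ) ^ γ / (m / 2)) := by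
          field_simp
      _ ≤ (N.factorial * K ^ N * ∑ j, |r j|) * ((k : ℝ) ^ γ / (m / 2)) := by gcongr
      _ = _ := by ring

/-! ### Chains of derivatives -/

/-- `W (j + 1)` is the derivative of `W j` on `s`, for `j < M`. -/
def IsDerivChainOn (W : ℕ → ℝ → ℝ) (s : Set ℝ) (M : ℕ) : Prop :=
  ∀ j < M, ∀ y ∈ s, HasDerivWithinAt (W j) (W (j + 1) y) s y

namespace IsDerivChainOn

variable {W : ℕ → ℝ → ℝ} {s t : Set ℝ} {M N : ℕ} {f : ℝ → ℝ}

theorem mono (h : IsDerivChainOn W s M) (hst : t ⊆ s) (hN : N ≤ M) : IsDerivChainOn W t N :=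
  fun j hj y hy => (h j (hj.trans_le hN) y (hst hy)).mono hst

theorem hasDerivAt (h : IsDerivChainOn W s M) (hs : IsOpen s) {j : ℕ} (hj : j < M) {y : ℝ}
    (hy : y ∈ s) : HasDerivAt (W j) (W (j + 1) y) y :=
  (h j hj y hy).hasDerivAt (hs.mem_nhds hy)

/-- This lets explicit formulas for derivatives replace iterated ones, whose value at a point
depends on the function on the whole set. -/
theorem iteratedDerivWithin_eq (h : IsDerivChainOn W s M) (hs : UniqueDiffOn ℝ s)
    (h0 : EqOn f (W 0) s) : ∀ j ≤ M, EqOn (iteratedDerivWithin j f s) (W j) s := by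
  intro j
  induction j with
  | zero => intro _; rwa [iteratedDerivWithin_zero]
  | succ j ih =>
    intro hj y hy
    have ih' := ih (by omega)
    rw [iteratedDerivWithin_succ, derivWithin_congr ih' (ih' hy)]
    exact (h j hj y hy).derivWithin (hs y hy)

theorem iteratedDeriv_eq (h : IsDerivChainOn W s M) (hs : IsOpen s)
    (h0 : EqOn f (W 0) s) {j : ℕ} (hj : j ≤ M) : EqOn (iteratedDeriv j f) (W j) s :=
  (iteratedDerivWithin_of_isOpen hs).symm.trans (h.iteratedDerivWithin_eq hs.uniqueDiffOn h0 j hj)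

theorem contDiffOn (h : IsDerivChainOn W s M) (hs : UniqueDiffOn ℝ s)
    (h0 : EqOn f (W 0) s) (hc : ContinuousOn (W M) s) : ContDiffOn ℝ M f s := by
  have h1 := h.iteratedDerivWithin_eq hs h0
  rw [contDiffOn_nat_iff_continuousOn_differentiableOn_deriv hs]
  have hd : ∀ m < M, DifferentiableOn ℝ (iteratedDerivWithin m f s) s := fun m hm y hy =>
    ((h m hm y hy).congr (h1 m hm.le) (h1 m hm.le hy)).differentiableWithinAt
  refine ⟨fun m hm => ?_, hd⟩
  rcases hm.lt_or_eq with hm | rfl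
  · exact (hd m hm).continuousOn
  · exact hc.congr (h1 _ le_rfl)

end IsDerivChainOn

theorem ContDiffOn.isDerivChainOn {f : ℝ → ℝ} {s : Set ℝ} {M : ℕ}
    (h : ContDiffOn ℝ M f s) (hs : UniqueDiffOn ℝ s) :
    IsDerivChainOn (fun j => iteratedDerivWithin j f s) s M := by
  intro j hj y hy
  have := (h.differentiableOn_iteratedDerivWithin (m := j) (by exact_mod_cast hj) hs) y hy
  simp only [iteratedDerivWithin_succ]
  exact this.hasDerivWithinAt

/-! ### Expansion of products of second order operators -/

/-- The result of applying `∏ (c² X + σ Y)`, `c ∈ l`, where `X` and `Y` shift the first and the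
second index of `G`. -/
def shiftProduct (σ : ℝ) : List ℝ → (ℕ → ℕ → ℝ) → ℝ
  | [], G => G 0 0
  | c :: l, G => c ^ 2 * shiftProduct σ l (fun p q => G (p + 1) q)
      + σ * shiftProduct σ l (fun p q => G p (q + 1))

theorem shiftProduct_lin (σ : ℝ) (l : List ℝ) (α β : ℝ) (G H : ℕ → ℕ → ℝ) :
    shiftProduct σ l (fun p q => α * G p q + β * H p q) =
      α * shiftProduct σ l G + β * shiftProduct σ l H := by
  induction l generalizing G H with
  | nil => rfl
  | cons c l ih => simp only [shiftProduct]; rw [ih, ih]; ring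

theorem shiftProduct_smul (σ : ℝ) (l : List ℝ) (α : ℝ) (G : ℕ → ℕ → ℝ) :
    shiftProduct σ l (fun p q => α * G p q) = α * shiftProduct σ l G := by
  have := shiftProduct_lin σ l α 0 G G
  simpa using this

/-- Each factor raises exactly one of the two indices by one, so only entries of total degree
`l.length` occur. -/
theorem shiftProduct_congr (σ : ℝ) (l : List ℝ) {G H : ℕ → ℕ → ℝ}
    (h : ∀ p q, p + q = l.length → G p q = H p q) : shiftProduct σ l G = shiftProduct σ l H := by
  induction l generalizing G H with
  | nil => exact h 0 0 rfl
  | cons c l ih =>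
    simp only [shiftProduct]
    rw [ih (H := fun p q => H (p + 1) q) fun p q hpq => h _ _ (by simp; omega),
      ih (H := fun p q => H p (q + 1)) fun p q hpq => h _ _ (by simp; omega)]

theorem shiftProduct_hasSum {ι : Type*} (σ : ℝ) (l : List ℝ) {G : ι → ℕ → ℕ → ℝ}
    {H : ℕ → ℕ → ℝ} (h : ∀ p q, p + q = l.length → HasSum (fun k => G k p q) (H p q)) :
    HasSum (fun k => shiftProduct σ l (G k)) (shiftProduct σ l H) := by
  induction l generalizing G H with
  | nil => exact h 0 0 rfl
  | cons c l ih =>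
    exact ((ih (G := fun k p q => G k (p + 1) q) fun p q hpq => h _ _ (by simp; omega)).mul_left
      (c ^ 2)).add ((ih (G := fun k p q => G k p (q + 1))
        fun p q hpq => h _ _ (by simp; omega)).mul_left σ)

theorem shiftProduct_hasDerivAt (σ : ℝ) (l : List ℝ) {G : ℝ → ℕ → ℕ → ℝ} {H : ℕ → ℕ → ℝ} {x : ℝ}
    (h : ∀ p q, p + q = l.length → HasDerivAt (fun x => G x p q) (H p q) x) :
    HasDerivAt (fun x => shiftProduct σ l (G x)) (shiftProduct σ l H) x := by
  induction l generalizing G H with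
  | nil => exact h 0 0 rfl
  | cons c l ih =>
    exact ((ih (G := fun x p q => G x (p + 1) q) fun p q hpq => h _ _ (by simp; omega)).const_mul
      (c ^ 2)).add ((ih (G := fun x p q => G x p (q + 1))
        fun p q hpq => h _ _ (by simp; omega)).const_mul σ)

/-- On a joint eigenvector of the two shifts the operator acts by its symbol. -/
theorem shiftProduct_geom (σ : ℝ) (l : List ℝ) (X Y g : ℝ) :
    shiftProduct σ l (fun p q => X ^ p * Y ^ q * g) =
      (l.map fun c => c ^ 2 * X + σ * Y).prod * g := by
  induction l generalizing g with
  | nil => simp [shiftProduct]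
  | cons c l ih =>
    have h1 := ih (X * g)
    have h2 := ih (Y * g)
    simp only [shiftProduct, List.map_cons, List.prod_cons]
    rw [show (fun p q => X ^ (p + 1) * Y ^ q * g) = fun p q => X ^ p * Y ^ q * (X * g) by
      funext p q; ring, show (fun p q => X ^ p * Y ^ (q + 1) * g) =
      fun p q => X ^ p * Y ^ q * (Y * g) by funext p q; ring, h1, h2]
    ring

/-- The value of `e 0`, a power of the sign, shows that the equation can be solved for the highest
pure y-derivative. -/
theorem exists_shiftProduct_eq_sum (σ : ℝ) (l : List ℝ) :
    ∃ e : ℕ → ℝ, e 0 = σ ^ l.length ∧ ∀ G : ℕ → ℕ → ℝ,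
      shiftProduct σ l G = ∑ p ∈ Finset.range (l.length + 1), e p * G p (l.length - p) := by
  induction l with
  | nil => exact ⟨fun _ => 1, by simp, fun G => by simp [shiftProduct]⟩
  | cons c l ih =>
    obtain ⟨e, he0, he⟩ := ih
    -- The coefficients are those of a product with a linear factor; the two conditions cut off the
    -- terms outside the old range.
    refine ⟨fun p => (if p = 0 then 0 else c ^ 2 * e (p - 1)) +
      (if p = l.length + 1 then 0 else σ * e p), ?_, fun G => ?_⟩
    · simp [he0]; ring
    · simp only [shiftProduct, he, List.length_cons, add_mul, Finset.sum_add_distrib]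
      congr 1
      · rw [Finset.sum_range_succ' _ (l.length + 1), Finset.mul_sum]
        simp only [Nat.add_eq_zero_iff, one_ne_zero, and_false, if_false, if_true, zero_mul,
          add_zero, Nat.add_sub_cancel, mul_assoc, Nat.add_sub_add_right]
      · rw [Finset.sum_range_succ _ (l.length + 1), if_pos rfl, zero_mul, add_zero, Finset.mul_sum]
        refine Finset.sum_congr rfl fun p hp => ?_
        have := Finset.mem_range.1 hp
        rw [if_neg (by omega), mul_assoc, show l.length + 1 - p = l.length - p + 1 by omega]

/-- `F i j` are the partial derivatives of order `i` in the first and `j` in the second variable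
on `I × J`, as far as `i + j ≤ M`. -/
structure IsJetOn (F : ℕ → ℕ → ℝ → ℝ → ℝ) (I J : Set ℝ) (M : ℕ) : Prop where
  dx : ∀ i j, i + j < M → ∀ x ∈ I, ∀ y ∈ J,
    HasDerivWithinAt (fun x => F i j x y) (F (i + 1) j x y) I x
  dy : ∀ i j, i + j < M → ∀ x ∈ I, ∀ y ∈ J,
    HasDerivWithinAt (fun y => F i j x y) (F i (j + 1) x y) J y

namespace IsJetOn

variable {F : ℕ → ℕ → ℝ → ℝ → ℝ} {I J : Set ℝ} {M : ℕ}

theorem chain_dx (h : IsJetOn F I J M) (j : ℕ) {y : ℝ} (hy : y ∈ J) :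
    IsDerivChainOn (fun i x => F i j x y) I (M - j) :=
  fun i hi x hx => h.dx i j (by omega) x hx y hy

theorem chain_dy (h : IsJetOn F I J M) (i : ℕ) {x : ℝ} (hx : x ∈ I) :
    IsDerivChainOn (fun j y => F i j x y) J (M - i) :=
  fun j hj y hy => h.dy i j (by omega) x hx y hy

end IsJetOn

theorem iteratedDeriv_two_eq {f f' : ℝ → ℝ} {f'' x : ℝ} {s : Set ℝ} (hs : IsOpen s) (hx : x ∈ s)
    (h1 : ∀ y ∈ s, HasDerivAt f (f' y) y) (h2 : HasDerivAt f' f'' x) :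
    iteratedDeriv 2 f x = f'' := by
  have h3 : iteratedDeriv 2 f = deriv (deriv f) := by
    rw [iteratedDeriv_succ, iteratedDeriv_one]
  rw [h3]
  have : deriv f =ᶠ[𝓝 x] f' := by
    filter_upwards [hs.mem_nhds hx] with y hy
    exact (h1 y hy).deriv
  rw [this.deriv_eq]
  exact h2.deriv

/-- On an open half the sign is constant, so the operator has constant coefficients there. Openness
matters because each factor differentiates an identity known only locally. -/
theorem foldr_factorOp_eq {F : ℕ → ℕ → ℝ → ℝ → ℝ} {I J : Set ℝ} {M : ℕ} {σ : ℝ}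
    (hI : IsOpen I) (hJ : IsOpen J) (hF : IsJetOn F I J M) (hσ : ∀ y ∈ J, Real.sign y = σ)
    {u : ℝ → ℝ → ℝ} (hu : ∀ x ∈ I, ∀ y ∈ J, u x y = F 0 0 x y) (l : List ℝ)
    (hl : 2 * l.length ≤ M) : ∀ x ∈ I, ∀ y ∈ J,
      l.foldr factorOp u x y = shiftProduct σ l (fun p q => F (2 * p) (2 * q) x y) := by
  induction l with
  | nil => exact hu
  | cons c l ih =>
    intro x hx y hy
    simp only [List.length_cons] at hl
    have ih' := ih (by omega)
    rw [List.foldr_cons, factorOp, hσ y hy]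
    simp only [shiftProduct]
    congr 2
    · have e : iteratedDeriv 2 (fun x' => List.foldr factorOp u l x' y) x =
          iteratedDeriv 2 (fun x' => shiftProduct σ l (fun p q => F (2 * p) (2 * q) x' y)) x := by
        refine Filter.EventuallyEq.iteratedDeriv_eq 2 ?_
        filter_upwards [hI.mem_nhds hx] with x' hx'
        exact ih' x' hx' y hy
      rw [e]
      refine iteratedDeriv_two_eq (f' := fun x' => shiftProduct σ l
        (fun p q => F (2 * p + 1) (2 * q) x' y)) hI hx (fun x' hx' => ?_) ?_
      · exact shiftProduct_hasDerivAt σ l fun p q hpq =>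
          (hF.dx _ _ (by omega) x' hx' y hy).hasDerivAt (hI.mem_nhds hx')
      · exact shiftProduct_hasDerivAt σ l fun p q hpq =>
          (hF.dx (2 * p + 1) _ (by omega) x hx y hy).hasDerivAt (hI.mem_nhds hx)
    · have e : iteratedDeriv 2 (fun y' => List.foldr factorOp u l x y') y =
          iteratedDeriv 2 (fun y' => shiftProduct σ l (fun p q => F (2 * p) (2 * q) x y')) y := by
        refine Filter.EventuallyEq.iteratedDeriv_eq 2 ?_
        filter_upwards [hJ.mem_nhds hy] with y' hy'
        exact ih' x hx y' hy'
      rw [e]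
      refine iteratedDeriv_two_eq (f' := fun y' => shiftProduct σ l
        (fun p q => F (2 * p) (2 * q + 1) x y')) hJ hy (fun y' hy' => ?_) ?_
      · exact shiftProduct_hasDerivAt σ l fun p q hpq =>
          (hF.dy _ _ (by omega) x hx y' hy').hasDerivAt (hJ.mem_nhds hy')
      · exact shiftProduct_hasDerivAt σ l fun p q hpq =>
          (hF.dy _ (2 * q + 1) (by omega) x hx y hy).hasDerivAt (hJ.mem_nhds hy)

/-- The ordinary differential operator of the `k`-th mode, in terms of the derivatives `W j` at a
point. -/
noncomputable def modeSymbol (k : ℕ+) (σ : ℝ) (l : List ℝ) (W : ℕ → ℝ) : ℝ :=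
  shiftProduct σ l (fun p q => (-(π * k) ^ 2) ^ p * W (2 * q))

/-- The factors commute, so the factor of `c` may be applied to the function first; this is the form
needed for induction on the list. -/
theorem modeSymbol_cons (k : ℕ+) (σ c : ℝ) (l : List ℝ) (W : ℕ → ℝ) :
    modeSymbol k σ (c :: l) W =
      modeSymbol k σ l (fun j => -(π * k * c) ^ 2 * W j + σ * W (j + 2)) := by
  have h := shiftProduct_lin σ l (c ^ 2) σ (fun p q => (-(π * k) ^ 2) ^ (p + 1) * W (2 * q))
    (fun p q => (-(π * k) ^ 2) ^ p * W (2 * (q + 1)))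
  simp only [modeSymbol, shiftProduct]
  rw [← h]
  congr 1
  funext p q
  rw [show 2 * (q + 1) = 2 * q + 2 by ring]
  ring

theorem foldr_modeFactorOp_eq {W : ℕ → ℝ → ℝ} {J : Set ℝ} {M : ℕ} {σ : ℝ} (k : ℕ+)
    (hJ : IsOpen J) (hW : IsDerivChainOn W J M) (hσ : ∀ y ∈ J, Real.sign y = σ)
    {w : ℝ → ℝ} (hw : EqOn w (W 0) J) (l : List ℝ) (hl : 2 * l.length ≤ M) :
    ∀ y ∈ J, l.foldr (modeFactorOp k) w y = modeSymbol k σ l (fun j => W j y) := by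
  induction l with
  | nil => intro y hy; simpa [modeSymbol, shiftProduct] using hw hy
  | cons c l ih =>
    intro y hy
    simp only [List.length_cons] at hl
    have ih' := ih (by omega)
    have e : iteratedDeriv 2 (List.foldr (modeFactorOp k) w l) y =
        iteratedDeriv 2 (fun y => modeSymbol k σ l (fun j => W j y)) y := by
      refine Filter.EventuallyEq.iteratedDeriv_eq 2 ?_
      filter_upwards [hJ.mem_nhds hy] with y' hy'
      exact ih' y' hy'
    have e2 : iteratedDeriv 2 (fun y => modeSymbol k σ l (fun j => W j y)) y =
        modeSymbol k σ l (fun j => W (j + 2) y) := by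
      refine iteratedDeriv_two_eq (f' := fun y => modeSymbol k σ l (fun j => W (j + 1) y)) hJ hy
        (fun y' hy' => ?_) ?_
      · exact shiftProduct_hasDerivAt σ l fun p q hpq =>
          (hW.hasDerivAt hJ (by omega) hy').const_mul _
      · exact shiftProduct_hasDerivAt σ l fun p q hpq =>
          (hW.hasDerivAt hJ (by omega) hy).const_mul _
    have e3 := shiftProduct_lin σ l (-(π * k * c) ^ 2) σ
      (fun p q => (-(π * k) ^ 2) ^ p * W (2 * q) y) (fun p q => (-(π * k) ^ 2) ^ p * W (2 * q + 2) y)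
    rw [List.foldr_cons, modeFactorOp, hσ y hy, ih' y hy, e, e2, modeSymbol_cons]
    simp only [modeSymbol] at e3 ⊢
    rw [show -(c * k * π) ^ 2 = -(π * k * c) ^ 2 by ring, ← e3]
    congr 1
    funext p q
    ring

/-! ### Solutions of the equation of a mode -/

theorem exists_const_of_hasDerivAt_zero {J : Set ℝ} (hJ : IsOpen J) (hJ' : IsPreconnected J)
    {f : ℝ → ℝ} (h : ∀ y ∈ J, HasDerivAt f 0 y) : ∃ c, ∀ y ∈ J, f y = c :=
  hJ.exists_is_const_of_deriv_eq_zero hJ'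
    (fun y hy => (h y hy).differentiableAt.differentiableWithinAt) fun y hy => (h y hy).deriv

/-- A fundamental system `p b`, `q b` of `v'' = σ b² v` for every `b > 0`, with derivatives. -/
structure IsFundamental (σ : ℝ) (J : Set ℝ) (p q : ℝ → ℕ → ℝ → ℝ) : Prop where
  deriv_p : ∀ b j y, HasDerivAt (p b j) (p b (j + 1) y) y
  deriv_q : ∀ b j y, HasDerivAt (q b j) (q b (j + 1) y) y
  eq_p : ∀ b y, p b 2 y = σ * b ^ 2 * p b 0 y
  eq_q : ∀ b y, q b 2 y = σ * b ^ 2 * q b 0 y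
  exists_eq : ∀ b > 0, ∀ v₀ v₁ : ℝ → ℝ, (∀ y ∈ J, HasDerivAt v₀ (v₁ y) y) →
    (∀ y ∈ J, HasDerivAt v₁ (σ * b ^ 2 * v₀ y) y) →
      ∃ A B, ∀ y ∈ J, v₀ y = A * p b 0 y + B * q b 0 y

/-- Applying one factor to W gives a solution of the shorter equation, known by induction. Since the
aₛ are distinct, dividing its coefficients by the eigenvalues of that factor gives a particular
solution P, and W - P lies in the kernel of the single factor. -/
theorem IsFundamental.exists_eq_sum {σ : ℝ} {J : Set ℝ} {p q : ℝ → ℕ → ℝ → ℝ}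
    (h : IsFundamental σ J p q) (hσ : σ * σ = 1) (hJ : IsOpen J) (k : ℕ+) (l : List ℝ)
    (hpos : ∀ c ∈ l, 0 < c) (hl : l.Nodup) (W : ℕ → ℝ → ℝ) (M : ℕ) (hM : 2 * l.length ≤ M)
    (hW : IsDerivChainOn W J M) (h0 : ∀ y ∈ J, modeSymbol k σ l (fun j => W j y) = 0) :
    ∃ A B : ℝ → ℝ, ∀ y ∈ J,
      W 0 y = ∑ c ∈ l.toFinset, (A c * p (π * k * c) 0 y + B c * q (π * k * c) 0 y) := by
  classical
  have hk : (0 : ℝ) < k := by exact_mod_cast k.pos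
  induction l generalizing W M with
  | nil => exact ⟨0, 0, fun y hy => by simpa [modeSymbol, shiftProduct] using h0 y hy⟩
  | cons c l ih =>
    simp only [List.length_cons] at hM
    have hcl : c ∉ l := (List.nodup_cons.1 hl).1
    set b := π * k * c with hb
    have hc : 0 < c := hpos c (by simp)
    have hb0 : 0 < b := by positivity
    obtain ⟨A, B, hAB⟩ := ih (fun c hc => hpos c (by simp [hc])) (List.nodup_cons.1 hl).2
      (fun j y => -b ^ 2 * W j y + σ * W (j + 2) y) (M - 2) (by omega)
      (fun j hj y hy => ((hW j (by omega) y hy).const_mul _).add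
        ((hW (j + 2) (by omega) y hy).const_mul _))
      (fun y hy => by rw [hb, ← modeSymbol_cons]; exact h0 y hy)
    -- The eigenvalue of the factor of `c` on the modes of `x`; it does not vanish because both
    -- frequencies are positive and distinct.
    let D : ℝ → ℝ := fun x => (π * k * x) ^ 2 - b ^ 2
    have hD : ∀ x ∈ l.toFinset, D x ≠ 0 := by
      intro x hx
      have hx' : x ∈ l := List.mem_toFinset.1 hx
      have hx0 := hpos x (by simp [hx'])
      have hne : x ≠ c := fun e => hcl (e ▸ hx')
      intro e
      have e1 : (π * k * x) ^ 2 = b ^ 2 := by simp only [D] at e; linarith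
      rw [pow_left_inj₀ (by positivity) hb0.le two_ne_zero] at e1
      exact hne (mul_left_cancel₀ (by positivity) e1)
    let P : ℕ → ℝ → ℝ := fun j y => ∑ x ∈ l.toFinset,
      (A x / D x * p (π * k * x) j y + B x / D x * q (π * k * x) j y)
    have hP : ∀ j y, HasDerivAt (P j) (P (j + 1) y) y := fun j y =>
      HasDerivAt.fun_sum fun x _ => ((h.deriv_p _ j y).const_mul _).add
        ((h.deriv_q _ j y).const_mul _)
    -- W and P have the same image under the factor of `c`; `σ * σ = 1` allows solving for the
    -- second derivative.
    have hP2 : ∀ y ∈ J, P 2 y - W 2 y = σ * b ^ 2 * (P 0 y - W 0 y) := by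
      intro y hy
      have e1 : -b ^ 2 * P 0 y + σ * P 2 y = -b ^ 2 * W 0 y + σ * W 2 y := by
        rw [hAB y hy]
        simp only [P, Finset.mul_sum, ← Finset.sum_add_distrib]
        refine Finset.sum_congr rfl fun x hx => ?_
        have := hD x hx
        have e2 : -b ^ 2 + σ * σ * (π * k * x) ^ 2 = D x := by simp only [D]; rw [hσ]; ring
        rw [h.eq_p, h.eq_q]
        calc _ = (-b ^ 2 + σ * σ * (π * k * x) ^ 2) / D x *
              (A x * p (π * k * x) 0 y + B x * q (π * k * x) 0 y) := by ring
          _ = _ := by rw [e2, div_self this, one_mul]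
      linear_combination σ * e1 - (P 2 y - W 2 y) * hσ
    obtain ⟨A', B', hAB'⟩ := h.exists_eq b hb0 (fun y => W 0 y - P 0 y) (fun y => W 1 y - P 1 y)
      (fun y hy => (hW.hasDerivAt hJ (by omega) hy).sub (hP 0 y))
      (fun y hy => by
        have := (hW.hasDerivAt (j := 1) hJ (by omega) hy).sub (hP 1 y)
        refine this.congr_deriv ?_
        have := hP2 y hy
        simp only [Nat.reduceAdd]
        linarith)
    refine ⟨fun x => if x = c then A' else A x / D x, fun x => if x = c then B' else B x / D x,
      fun y hy => ?_⟩
    rw [List.toFinset_cons, Finset.sum_insert (by simpa using hcl)]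
    simp only [if_true]
    rw [← hAB' y hy]
    have e3 : ∑ x ∈ l.toFinset, ((if x = c then A' else A x / D x) * p (π * k * x) 0 y +
        (if x = c then B' else B x / D x) * q (π * k * x) 0 y) = P 0 y := by
      refine Finset.sum_congr rfl fun x hx => ?_
      have hne : x ≠ c := fun e => hcl (e ▸ List.mem_toFinset.1 hx)
      rw [if_neg hne, if_neg hne]
    rw [e3]; ring

theorem IsFundamental.exists_jet_eq_sum {σ : ℝ} {J : Set ℝ} {p q : ℝ → ℕ → ℝ → ℝ}
    (h : IsFundamental σ J p q) (hσ : σ * σ = 1) (hJ : IsOpen J) (k : ℕ+) {n : ℕ} (a : Fin n → ℝ)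
    (hpos : ∀ s, 0 < a s) (ha : Function.Injective a) (W : ℕ → ℝ → ℝ)
    (hW : IsDerivChainOn W J (2 * n))
    (h0 : ∀ y ∈ J, modeSymbol k σ (List.ofFn a) (fun j => W j y) = 0) :
    ∃ A B : Fin n → ℝ, ∀ j ≤ 2 * n, ∀ y ∈ J,
      W j y = ∑ s, (A s * p (π * k * a s) j y + B s * q (π * k * a s) j y) := by
  classical
  obtain ⟨A, B, hAB⟩ := h.exists_eq_sum hσ hJ k (List.ofFn a)
    (fun c hc => by obtain ⟨s, rfl⟩ := (List.mem_ofFn' a c).1 hc; exact hpos s)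
    (List.nodup_ofFn.2 ha) W (2 * n) (by simp) hW h0
  have hset : (List.ofFn a).toFinset = Finset.univ.image a := by
    ext c; simp [List.mem_ofFn']
  refine ⟨A ∘ a, B ∘ a, fun j => ?_⟩
  induction j with
  | zero =>
    intro _ y hy
    rw [hAB y hy, hset, Finset.sum_image fun x _ y _ e => ha e]
    rfl
  | succ j ih =>
    intro hj y hy
    have h1 := hW.hasDerivAt hJ (j := j) (by omega) hy
    have h2 : HasDerivAt (fun y => ∑ s, ((A ∘ a) s * p (π * k * a s) j y +
        (B ∘ a) s * q (π * k * a s) j y)) (∑ s, ((A ∘ a) s * p (π * k * a s) (j + 1) y +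
        (B ∘ a) s * q (π * k * a s) (j + 1) y)) y :=
      HasDerivAt.fun_sum fun x _ => ((h.deriv_p _ j y).const_mul _).add
        ((h.deriv_q _ j y).const_mul _)
    refine h1.unique (h2.congr_of_eventuallyEq ?_)
    filter_upwards [hJ.mem_nhds hy] with z hz
    exact ih (by omega) z hz

/-- Derivatives of `exp (b y)`. -/
noncomputable def expJet (b : ℝ) (j : ℕ) (y : ℝ) : ℝ := b ^ j * Real.exp (b * y)

/-- Derivatives of `cos (b y)`. -/
noncomputable def cosJet (b : ℝ) (j : ℕ) (y : ℝ) : ℝ := b ^ j * Real.cos (b * y + π * j / 2)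

/-- Derivatives of `sin (b y)`. -/
noncomputable def sinJet (b : ℝ) (j : ℕ) (y : ℝ) : ℝ := b ^ j * Real.sin (b * y + π * j / 2)

theorem hasDerivAt_expJet (b : ℝ) (j : ℕ) (y : ℝ) :
    HasDerivAt (expJet b j) (expJet b (j + 1) y) y := by
  have := (((hasDerivAt_id y).const_mul b).exp).const_mul (b ^ j)
  refine this.congr_deriv ?_
  simp only [expJet, id]; ring

theorem hasDerivAt_cosJet (b : ℝ) (j : ℕ) (y : ℝ) :
    HasDerivAt (cosJet b j) (cosJet b (j + 1) y) y := by
  have := ((((hasDerivAt_id y).const_mul b).add_const (π * j / 2)).cos).const_mul (b ^ j)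
  refine this.congr_deriv ?_
  simp only [cosJet, id]
  rw [show b * y + π * (j + 1 : ℕ) / 2 = (b * y + π * j / 2) + π / 2 by push_cast; ring,
    Real.cos_add_pi_div_two]
  ring

theorem hasDerivAt_sinJet (b : ℝ) (j : ℕ) (y : ℝ) :
    HasDerivAt (sinJet b j) (sinJet b (j + 1) y) y := by
  have := ((((hasDerivAt_id y).const_mul b).add_const (π * j / 2)).sin).const_mul (b ^ j)
  refine this.congr_deriv ?_
  simp only [sinJet, id]
  rw [show b * y + π * (j + 1 : ℕ) / 2 = (b * y + π * j / 2) + π / 2 by push_cast; ring,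
    Real.sin_add_pi_div_two]
  ring

theorem cosJet_add_two (b : ℝ) (j : ℕ) (y : ℝ) : cosJet b (j + 2) y = -b ^ 2 * cosJet b j y := by
  simp only [cosJet]
  rw [show b * y + π * (j + 2 : ℕ) / 2 = (b * y + π * j / 2) + π by push_cast; ring,
    Real.cos_add_pi]
  ring

theorem sinJet_add_two (b : ℝ) (j : ℕ) (y : ℝ) : sinJet b (j + 2) y = -b ^ 2 * sinJet b j y := by
  simp only [sinJet]
  rw [show b * y + π * (j + 2 : ℕ) / 2 = (b * y + π * j / 2) + π by push_cast; ring,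
    Real.sin_add_pi]
  ring

theorem cosJet_two_mul (b : ℝ) (m : ℕ) (y : ℝ) :
    cosJet b (2 * m) y = (-b ^ 2) ^ m * Real.cos (b * y) := by
  induction m with
  | zero => simp [cosJet]
  | succ m ih => rw [show 2 * (m + 1) = 2 * m + 2 by ring, cosJet_add_two, ih]; ring

theorem sinJet_two_mul (b : ℝ) (m : ℕ) (y : ℝ) :
    sinJet b (2 * m) y = (-b ^ 2) ^ m * Real.sin (b * y) := by
  induction m with
  | zero => simp [sinJet]
  | succ m ih => rw [show 2 * (m + 1) = 2 * m + 2 by ring, sinJet_add_two, ih]; ring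

/-- For c = ±b the combination v' + cv satisfies a first-order equation and equals A exp(cy); the
two identities determine v. -/
theorem isFundamental_exp {J : Set ℝ} (hJ : IsOpen J) (hJ' : IsPreconnected J) :
    IsFundamental 1 J expJet (fun b => expJet (-b)) where
  deriv_p := hasDerivAt_expJet
  deriv_q b := hasDerivAt_expJet (-b)
  eq_p b y := by simp [expJet]
  eq_q b y := by simp [expJet]
  exists_eq b hb v₀ v₁ h₀ h₁ := by
    have e1 : ∀ c : ℝ, c ^ 2 = b ^ 2 →
        ∃ A, ∀ y ∈ J, v₁ y + c * v₀ y = A * Real.exp (c * y) := by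
      intro c hc
      obtain ⟨A, hA⟩ := exists_const_of_hasDerivAt_zero hJ hJ'
        (f := fun y => (v₁ y + c * v₀ y) * Real.exp (-c * y)) fun y hy => by
          have h3 := ((h₁ y hy).add ((h₀ y hy).const_mul c)).mul
            (((hasDerivAt_id y).const_mul (-c)).exp)
          refine h3.congr_deriv ?_
          simp only [Pi.add_apply, id]
          linear_combination -Real.exp (-c * y) * v₀ y * hc
      refine ⟨A, fun y hy => ?_⟩
      rw [← hA y hy, mul_assoc, ← Real.exp_add]
      simp
    obtain ⟨A, hA⟩ := e1 b rfl
    obtain ⟨B, hB⟩ := e1 (-b) (by ring)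
    refine ⟨A / (2 * b), -B / (2 * b), fun y hy => ?_⟩
    have h4 := hA y hy
    have h5 := hB y hy
    simp only [expJet, pow_zero, one_mul]
    field_simp
    rw [neg_mul b y] at h5
    linear_combination h4 - h5

/-- Rotating the vector (bv, v') by the angle by gives two first integrals, and rotating back
recovers v. -/
theorem isFundamental_trig {J : Set ℝ} (hJ : IsOpen J) (hJ' : IsPreconnected J) :
    IsFundamental (-1) J cosJet sinJet where
  deriv_p := hasDerivAt_cosJet
  deriv_q := hasDerivAt_sinJet
  eq_p b y := by rw [cosJet_add_two b 0]; ring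
  eq_q b y := by rw [sinJet_add_two b 0]; ring
  exists_eq b hb v₀ v₁ h₀ h₁ := by
    have hc : ∀ y, HasDerivAt (fun y => Real.cos (b * y)) (-b * Real.sin (b * y)) y := fun y =>
      (((hasDerivAt_id y).const_mul b).cos).congr_deriv (by simp only [id]; ring)
    have hs : ∀ y, HasDerivAt (fun y => Real.sin (b * y)) (b * Real.cos (b * y)) y := fun y =>
      (((hasDerivAt_id y).const_mul b).sin).congr_deriv (by simp only [id]; ring)
    obtain ⟨A, hA⟩ := exists_const_of_hasDerivAt_zero hJ hJ'
      (f := fun y => b * (v₀ y * Real.cos (b * y)) - v₁ y * Real.sin (b * y)) fun y hy => by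
        refine ((((h₀ y hy).mul (hc y)).const_mul b).sub ((h₁ y hy).mul (hs y))).congr_deriv ?_
        ring
    obtain ⟨B, hB⟩ := exists_const_of_hasDerivAt_zero hJ hJ'
      (f := fun y => b * (v₀ y * Real.sin (b * y)) + v₁ y * Real.cos (b * y)) fun y hy => by
        refine ((((h₀ y hy).mul (hs y)).const_mul b).add ((h₁ y hy).mul (hc y))).congr_deriv ?_
        ring
    refine ⟨A / b, B / b, fun y hy => ?_⟩
    have h4 := hA y hy
    have h5 := hB y hy
    have h6 := Real.sin_sq_add_cos_sq (b * y)
    simp only [cosJet, sinJet, pow_zero, one_mul, Nat.cast_zero, mul_zero, zero_div, add_zero]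
    field_simp
    rw [← h4, ← h5]
    linear_combination -(b * v₀ y) * h6

/-! ### The solutions in terms of the linear system -/

/-- The `j`-th derivative of the solution with coefficients `x` for `y > 0`. -/
noncomputable def upperJet {n : ℕ} (a : Fin n → ℝ) (k : ℕ+)
    (x : (Fin n ⊕ Fin n) ⊕ (Fin n ⊕ Fin n) → ℝ) (j : ℕ) (y : ℝ) : ℝ :=
  ∑ s, (x (.inl (.inl s)) * expJet (π * k * a s) j y
    + x (.inl (.inr s)) * expJet (-(π * k * a s)) j y)

/-- The `j`-th derivative of the solution with coefficients `x` for `y < 0`. -/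
noncomputable def lowerJet {n : ℕ} (a : Fin n → ℝ) (k : ℕ+)
    (x : (Fin n ⊕ Fin n) ⊕ (Fin n ⊕ Fin n) → ℝ) (j : ℕ) (y : ℝ) : ℝ :=
  ∑ s, (x (.inr (.inl s)) * cosJet (π * k * a s) j y
    + x (.inr (.inr s)) * sinJet (π * k * a s) j y)

/-- The `j`-th derivative of the solution with coefficients `x`. -/
noncomputable def modeJet {n : ℕ} (a : Fin n → ℝ) (k : ℕ+)
    (x : (Fin n ⊕ Fin n) ⊕ (Fin n ⊕ Fin n) → ℝ) (j : ℕ) (y : ℝ) : ℝ :=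
  if 0 ≤ y then upperJet a k x j y else lowerJet a k x j y

/-- The right-hand side of the linear system, for boundary values `α` at `1` and `β` at `-1`. -/
noncomputable def dataVector {n : ℕ} (k : ℕ+) (α β : Fin n → ℝ) :
    (Fin n ⊕ Fin n) ⊕ (Fin n ⊕ Fin n) → ℝ
  | .inl (.inl m) => α m / (π * k) ^ (2 * (m : ℕ))
  | .inl (.inr m) => (-1) ^ (m : ℕ) * (β m / (π * k) ^ (2 * (m : ℕ)))
  | .inr _ => 0

section ModeJet

variable {n : ℕ} {a : Fin n → ℝ} {k : ℕ+} {x : (Fin n ⊕ Fin n) ⊕ (Fin n ⊕ Fin n) → ℝ}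

theorem hasDerivAt_upperJet (j : ℕ) (y : ℝ) :
    HasDerivAt (upperJet a k x j) (upperJet a k x (j + 1) y) y :=
  HasDerivAt.fun_sum fun _ _ => ((hasDerivAt_expJet _ j y).const_mul _).add
    ((hasDerivAt_expJet _ j y).const_mul _)

theorem hasDerivAt_lowerJet (j : ℕ) (y : ℝ) :
    HasDerivAt (lowerJet a k x j) (lowerJet a k x (j + 1) y) y :=
  HasDerivAt.fun_sum fun _ _ => ((hasDerivAt_cosJet _ j y).const_mul _).add
    ((hasDerivAt_sinJet _ j y).const_mul _)

theorem continuous_upperJet (j : ℕ) : Continuous (upperJet a k x j) :=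
  continuous_iff_continuousAt.2 fun y => (hasDerivAt_upperJet j y).continuousAt

theorem continuous_lowerJet (j : ℕ) : Continuous (lowerJet a k x j) :=
  continuous_iff_continuousAt.2 fun y => (hasDerivAt_lowerJet j y).continuousAt

theorem mainMatrix_mulVec_top (m : Fin n) :
    (π * k) ^ (2 * (m : ℕ)) * (mainMatrix a k).mulVec x (.inl (.inl m)) =
      upperJet a k x (2 * m) 1 := by
  simp only [Matrix.mulVec, dotProduct, Fintype.sum_sum_type, mainMatrix, upperJet, expJet,
    zero_mul, Finset.sum_const_zero, add_zero, ← Finset.sum_add_distrib, Finset.mul_sum]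
  refine Finset.sum_congr rfl fun s _ => ?_
  rw [(even_two_mul (m : ℕ)).neg_pow]
  simp only [mul_pow, mul_one]
  ring

theorem mainMatrix_mulVec_bottom (m : Fin n) :
    (-1) ^ (m : ℕ) * (π * k) ^ (2 * (m : ℕ)) * (mainMatrix a k).mulVec x (.inl (.inr m)) =
      lowerJet a k x (2 * m) (-1) := by
  simp only [Matrix.mulVec, dotProduct, Fintype.sum_sum_type, mainMatrix, lowerJet, cosJet_two_mul,
    sinJet_two_mul, zero_mul, Finset.sum_const_zero, zero_add, ← Finset.sum_add_distrib,
    Finset.mul_sum]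
  refine Finset.sum_congr rfl fun s _ => ?_
  rw [show π * k * a s * -1 = π * k * (-a s) by ring, neg_pow ((π * k * a s) ^ 2)]
  simp only [mul_pow, pow_mul]
  ring

theorem mainMatrix_mulVec_match (t : Fin n ⊕ Fin n) :
    (π * k) ^ matchOrder t * (mainMatrix a k).mulVec x (.inr t) =
      upperJet a k x (matchOrder t) 0 - lowerJet a k x (matchOrder t) 0 := by
  simp only [Matrix.mulVec, dotProduct, Fintype.sum_sum_type, mainMatrix, lowerJet, upperJet,
    cosJet, sinJet, expJet, ← Finset.sum_add_distrib, mul_add, Finset.mul_sum,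
    ← Finset.sum_sub_distrib]
  refine Finset.sum_congr rfl fun s _ => ?_
  rw [show -(π * k * a s) = π * k * (-a s) by ring]
  simp only [mul_pow, mul_zero, Real.exp_zero, zero_add]
  ring

theorem exists_matchOrder_eq {t : ℕ} (ht : t < 2 * n) : ∃ i : Fin n ⊕ Fin n, matchOrder i = t := by
  refine ⟨finSumFinEquiv.symm ⟨t, by omega⟩, ?_⟩
  rw [matchOrder_eq_finSumFinEquiv, Equiv.apply_symm_apply]

theorem mainMatrix_mulVec_eq_dataVector_iff {α β : Fin n → ℝ} :
    (mainMatrix a k).mulVec x = dataVector k α β ↔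
      (∀ m : Fin n, upperJet a k x (2 * m) 1 = α m) ∧
      (∀ m : Fin n, lowerJet a k x (2 * m) (-1) = β m) ∧
      ∀ t < 2 * n, upperJet a k x t 0 = lowerJet a k x t 0 := by
  have hk : (0 : ℝ) < π * k := mul_pos Real.pi_pos (by exact_mod_cast k.pos)
  have hsq : ∀ m : ℕ, ((-1 : ℝ) ^ m) * (-1) ^ m = 1 := fun m => by rw [← mul_pow]; simp
  constructor
  · intro h
    refine ⟨fun m => ?_, fun m => ?_, fun t ht => ?_⟩
    · rw [← mainMatrix_mulVec_top, h, dataVector, mul_div_cancel₀ _ (by positivity)]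
    · rw [← mainMatrix_mulVec_bottom, h, dataVector]
      calc _ = ((-1 : ℝ) ^ (m : ℕ)) * (-1) ^ (m : ℕ) *
            ((π * k) ^ (2 * (m : ℕ)) * (β m / (π * k) ^ (2 * (m : ℕ)))) := by ring
        _ = β m := by rw [hsq, mul_div_cancel₀ _ (by positivity), one_mul]
    · obtain ⟨i, rfl⟩ := exists_matchOrder_eq ht
      rw [← sub_eq_zero, ← mainMatrix_mulVec_match, h, dataVector, mul_zero]
  · rintro ⟨h1, h2, h3⟩
    funext i
    rcases i with (m | m) | t
    · rw [dataVector, ← h1, ← mainMatrix_mulVec_top, mul_div_cancel_left₀ _ (by positivity)]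
    · rw [dataVector, ← h2, ← mainMatrix_mulVec_bottom, mul_assoc, mul_div_assoc,
        mul_div_cancel_left₀ _ (by positivity), ← mul_assoc, hsq, one_mul]
    · have := mainMatrix_mulVec_match (a := a) (k := k) (x := x) t
      rw [h3 _ (matchOrder_lt t), sub_self] at this
      exact (mul_eq_zero.1 this).resolve_left (by positivity)

end ModeJet

theorem shiftProduct_sum {ι : Type*} [Fintype ι] (σ : ℝ) (l : List ℝ) (G : ι → ℕ → ℕ → ℝ) :
    shiftProduct σ l (fun p q => ∑ s, G s p q) = ∑ s, shiftProduct σ l (G s) :=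
  (shiftProduct_hasSum σ l fun p q _ => hasSum_fintype fun s => G s p q).unique
    (hasSum_fintype _)

/-- The symbol is a product, and the factor belonging to `c` vanishes at this frequency. -/
theorem modeSymbol_geom_eq_zero (k : ℕ+) (σ : ℝ) (l : List ℝ) (W : ℕ → ℝ) (Y g c : ℝ)
    (hW : ∀ q, W (2 * q) = Y ^ q * g) (hc : c ∈ l) (hY : c ^ 2 * -(π * k) ^ 2 + σ * Y = 0) :
    modeSymbol k σ l W = 0 := by
  have h := shiftProduct_geom σ l (-(π * k) ^ 2) Y g
  have h0 : (l.map fun c => c ^ 2 * -(π * k) ^ 2 + σ * Y).prod = 0 :=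
    List.prod_eq_zero (List.mem_map.2 ⟨c, hc, hY⟩)
  rw [h0, zero_mul] at h
  rw [modeSymbol, ← h]
  exact shiftProduct_congr σ l fun p q _ => by rw [hW]; ring

theorem modeSymbol_sum {ι : Type*} [Fintype ι] (k : ℕ+) (σ : ℝ) (l : List ℝ) (A B : ι → ℝ)
    (V W : ι → ℕ → ℝ) : modeSymbol k σ l (fun j => ∑ s, (A s * V s j + B s * W s j)) =
      ∑ s, (A s * modeSymbol k σ l (V s) + B s * modeSymbol k σ l (W s)) := by
  simp only [modeSymbol, Finset.mul_sum]
  rw [shiftProduct_sum]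
  refine Finset.sum_congr rfl fun s _ => ?_
  rw [← shiftProduct_lin]
  exact shiftProduct_congr σ l fun p q _ => by ring

section ModeJet

variable {n : ℕ} {a : Fin n → ℝ} {k : ℕ+} {x : (Fin n ⊕ Fin n) ⊕ (Fin n ⊕ Fin n) → ℝ}

theorem modeSymbol_upperJet (y : ℝ) :
    modeSymbol k 1 (List.ofFn a) (fun j => upperJet a k x j y) = 0 := by
  simp only [upperJet]
  rw [modeSymbol_sum]
  refine Finset.sum_eq_zero fun s _ => ?_
  have hs : a s ∈ List.ofFn a := (List.mem_ofFn' a _).2 ⟨s, rfl⟩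
  rw [modeSymbol_geom_eq_zero k 1 _ _ ((π * k * a s) ^ 2) (Real.exp (π * k * a s * y)) (a s)
      (fun q => by rw [expJet, pow_mul]) hs (by ring),
    modeSymbol_geom_eq_zero k 1 _ _ ((π * k * a s) ^ 2) (Real.exp (-(π * k * a s) * y)) (a s)
      (fun q => by rw [expJet, pow_mul, neg_sq]) hs (by ring)]
  simp

theorem modeSymbol_lowerJet (y : ℝ) :
    modeSymbol k (-1) (List.ofFn a) (fun j => lowerJet a k x j y) = 0 := by
  simp only [lowerJet]
  rw [modeSymbol_sum]
  refine Finset.sum_eq_zero fun s _ => ?_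
  have hs : a s ∈ List.ofFn a := (List.mem_ofFn' a _).2 ⟨s, rfl⟩
  rw [modeSymbol_geom_eq_zero k (-1) _ _ (-(π * k * a s) ^ 2) (Real.cos (π * k * a s * y)) (a s)
      (fun q => by rw [cosJet_two_mul]) hs (by ring),
    modeSymbol_geom_eq_zero k (-1) _ _ (-(π * k * a s) ^ 2) (Real.sin (π * k * a s * y)) (a s)
      (fun q => by rw [sinJet_two_mul]) hs (by ring)]
  simp

theorem modeJet_of_nonneg {j : ℕ} {y : ℝ} (hy : 0 ≤ y) :
    modeJet a k x j y = upperJet a k x j y := if_pos hy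

theorem modeJet_of_neg {j : ℕ} {y : ℝ} (hy : y < 0) :
    modeJet a k x j y = lowerJet a k x j y := if_neg hy.not_ge

theorem hasDerivAt_modeJet_of_ne (j : ℕ) {y : ℝ} (hy : y ≠ 0) :
    HasDerivAt (modeJet a k x j) (modeJet a k x (j + 1) y) y := by
  rcases lt_or_gt_of_ne hy with h | h
  · rw [modeJet_of_neg h]
    refine (hasDerivAt_lowerJet j y).congr_of_eventuallyEq ?_
    filter_upwards [gt_mem_nhds h] with z hz using modeJet_of_neg hz
  · rw [modeJet_of_nonneg h.le]
    refine (hasDerivAt_upperJet j y).congr_of_eventuallyEq ?_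
    filter_upwards [lt_mem_nhds h] with z hz using modeJet_of_nonneg hz.le

/-- At the interface the two one-sided derivatives exist; equality of values and of derivatives
glues them. -/
theorem hasDerivAt_modeJet {j : ℕ} (hj : upperJet a k x j 0 = lowerJet a k x j 0)
    (hj' : upperJet a k x (j + 1) 0 = lowerJet a k x (j + 1) 0) (y : ℝ) :
    HasDerivAt (modeJet a k x j) (modeJet a k x (j + 1) y) y := by
  rcases eq_or_ne y 0 with rfl | hy
  · have h0 : modeJet a k x j 0 = upperJet a k x j 0 := modeJet_of_nonneg le_rfl
    have h1 : HasDerivWithinAt (modeJet a k x j) (modeJet a k x (j + 1) 0) (Ici 0) 0 := by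
      rw [modeJet_of_nonneg le_rfl]
      exact (hasDerivAt_upperJet j 0).hasDerivWithinAt.congr (fun z hz => modeJet_of_nonneg hz) h0
    have h2 : HasDerivWithinAt (modeJet a k x j) (modeJet a k x (j + 1) 0) (Iic 0) 0 := by
      rw [modeJet_of_nonneg le_rfl, hj']
      refine (hasDerivAt_lowerJet j 0).hasDerivWithinAt.congr (fun z hz => ?_) (h0.trans hj)
      rcases (mem_Iic.1 hz).lt_or_eq with h | rfl
      · exact modeJet_of_neg h
      · exact h0.trans hj
    have := h1.union h2
    rwa [Ici_union_Iic, hasDerivWithinAt_univ] at this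
  · exact hasDerivAt_modeJet_of_ne j hy

theorem continuous_modeJet {j : ℕ} (hj : upperJet a k x j 0 = lowerJet a k x j 0) :
    Continuous (modeJet a k x j) :=
  Continuous.if_le (continuous_upperJet j) (continuous_lowerJet j) continuous_const continuous_id
    fun y hy => by subst hy; exact hj

theorem isDerivChainOn_modeJet (M : ℕ) :
    IsDerivChainOn (modeJet a k x) (Ioo 0 1 ∪ Ioo (-1) 0) M := fun j _ y hy =>
  (hasDerivAt_modeJet_of_ne j (by rcases hy with h | h; exacts [h.1.ne', h.2.ne])).hasDerivWithinAt

theorem modeSymbol_modeJet_of_pos {y : ℝ} (hy : 0 < y) :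
    modeSymbol k 1 (List.ofFn a) (fun j => modeJet a k x j y) = 0 := by
  simp only [modeJet_of_nonneg hy.le, modeSymbol_upperJet]

theorem modeSymbol_modeJet_of_neg {y : ℝ} (hy : y < 0) :
    modeSymbol k (-1) (List.ofFn a) (fun j => modeJet a k x j y) = 0 := by
  simp only [modeJet_of_neg hy, modeSymbol_lowerJet]

theorem uniqueDiffOn_Icc_neg_one_one : UniqueDiffOn ℝ (Icc (-1 : ℝ) 1) :=
  uniqueDiffOn_Icc (by norm_num)

theorem isDerivChainOn_modeJet_closed
    (h : ∀ t < 2 * n, upperJet a k x t 0 = lowerJet a k x t 0) (s : Set ℝ) :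
    IsDerivChainOn (modeJet a k x) s (2 * n - 1) := fun j hj y _ =>
  (hasDerivAt_modeJet (h j (by omega)) (h (j + 1) (by omega)) y).hasDerivWithinAt

/-- Every solution of the linear system yields a solution of the coefficient problem. -/
theorem isModeSolution_modeJet (hn : 1 ≤ n) {φ ψ : Fin n → ℝ → ℝ}
    (h : (mainMatrix a k).mulVec x = dataVector k (fun s => sineCoeff (φ s) k)
      (fun s => sineCoeff (ψ s) k)) : IsModeSolution a φ ψ k (modeJet a k x 0) := by
  obtain ⟨h1, h2, h3⟩ := mainMatrix_mulVec_eq_dataVector_iff.1 h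
  have hch := isDerivChainOn_modeJet_closed h3 (Icc (-1) 1)
  have hit := hch.iteratedDerivWithin_eq uniqueDiffOn_Icc_neg_one_one (eqOn_refl _ _)
  refine ⟨hch.contDiffOn uniqueDiffOn_Icc_neg_one_one (eqOn_refl _ _)
      (continuous_modeJet (h3 _ (by omega))).continuousOn,
    (isDerivChainOn_modeJet (2 * n)).contDiffOn (isOpen_Ioo.union isOpen_Ioo).uniqueDiffOn
      (eqOn_refl _ _) fun y hy => (isDerivChainOn_modeJet (2 * n + 1) (2 * n) (by omega) y
        hy).continuousWithinAt, ?_, fun s => ?_, fun s => ?_⟩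
  · rintro y (hy | hy)
    · rw [foldr_modeFactorOp_eq (σ := 1) k isOpen_Ioo ((isDerivChainOn_modeJet (2 * n)).mono
        subset_union_left le_rfl) (fun z hz => Real.sign_of_pos hz.1) (eqOn_refl _ _) _ (by simp)
        y hy, modeSymbol_modeJet_of_pos hy.1]
    · rw [foldr_modeFactorOp_eq (σ := -1) k isOpen_Ioo ((isDerivChainOn_modeJet (2 * n)).mono
        subset_union_right le_rfl) (fun z hz => Real.sign_of_neg hz.2) (eqOn_refl _ _) _ (by simp)
        y hy, modeSymbol_modeJet_of_neg hy.2]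
  · rw [hit _ (by omega) (by norm_num), modeJet_of_nonneg zero_le_one, h1]
  · rw [hit _ (by omega) (by norm_num), modeJet_of_neg (by norm_num), h2]

end ModeJet

/-- A chain of derivatives that solves the equation of the mode on both sides of `0` and is
continuous up to order `2n - 1` comes from a solution of the linear system. -/
theorem exists_eq_modeJet {n : ℕ} {a : Fin n → ℝ} (hpos : ∀ s, 0 < a s)
    (ha : Function.Injective a) (k : ℕ+) (W : ℕ → ℝ → ℝ) (α β : Fin n → ℝ)
    (hc : ∀ j < 2 * n, ContinuousOn (W j) (Icc (-1) 1))
    (hU : IsDerivChainOn W (Ioo 0 1) (2 * n)) (hL : IsDerivChainOn W (Ioo (-1) 0) (2 * n))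
    (eU : ∀ y ∈ Ioo (0 : ℝ) 1, modeSymbol k 1 (List.ofFn a) (fun j => W j y) = 0)
    (eL : ∀ y ∈ Ioo (-1 : ℝ) 0, modeSymbol k (-1) (List.ofFn a) (fun j => W j y) = 0)
    (h1 : ∀ m : Fin n, W (2 * m) 1 = α m) (h2 : ∀ m : Fin n, W (2 * m) (-1) = β m) :
    ∃ x, (mainMatrix a k).mulVec x = dataVector k α β ∧
      (∀ j ≤ 2 * n, EqOn (W j) (modeJet a k x j) (Ioo 0 1 ∪ Ioo (-1) 0)) ∧
      ∀ j < 2 * n, EqOn (W j) (modeJet a k x j) (Icc (-1) 1) := by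
  obtain ⟨A, B, hAB⟩ := (isFundamental_exp isOpen_Ioo isPreconnected_Ioo).exists_jet_eq_sum
    (by norm_num) isOpen_Ioo k a hpos ha W hU eU
  obtain ⟨A', B', hAB'⟩ := (isFundamental_trig isOpen_Ioo isPreconnected_Ioo).exists_jet_eq_sum
    (by norm_num) isOpen_Ioo k a hpos ha W hL eL
  let x : (Fin n ⊕ Fin n) ⊕ (Fin n ⊕ Fin n) → ℝ := Sum.elim (Sum.elim A B) (Sum.elim A' B')
  have u1 : ∀ j ≤ 2 * n, EqOn (W j) (upperJet a k x j) (Ioo 0 1) := fun j hj y hy => hAB j hj y hy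
  have l1 : ∀ j ≤ 2 * n, EqOn (W j) (lowerJet a k x j) (Ioo (-1) 0) := fun j hj y hy =>
    hAB' j hj y hy
  -- Continuity carries the identities to the end points, where the boundary and matching conditions
  -- are read off. This is not available for order 2n.
  have u2 : ∀ j < 2 * n, EqOn (W j) (upperJet a k x j) (Icc 0 1) := fun j hj =>
    (u1 j hj.le).of_subset_closure ((hc j hj).mono (Icc_subset_Icc (by norm_num) le_rfl))
      (continuous_upperJet j).continuousOn Ioo_subset_Icc_self
      (by rw [closure_Ioo (by norm_num)])
  have l2 : ∀ j < 2 * n, EqOn (W j) (lowerJet a k x j) (Icc (-1) 0) := fun j hj =>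
    (l1 j hj.le).of_subset_closure ((hc j hj).mono (Icc_subset_Icc le_rfl (by norm_num)))
      (continuous_lowerJet j).continuousOn Ioo_subset_Icc_self
      (by rw [closure_Ioo (by norm_num)])
  refine ⟨x, mainMatrix_mulVec_eq_dataVector_iff.2 ⟨fun m => ?_, fun m => ?_, fun t ht => ?_⟩,
    fun j hj y hy => ?_, fun j hj y hy => ?_⟩
  · rw [← h1 m, u2 _ (by omega) (by norm_num)]
  · rw [← h2 m, l2 _ (by omega) (by norm_num)]
  · rw [← u2 t ht (by norm_num), l2 t ht (by norm_num)]
  · rcases hy with hy | hy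
    · rw [modeJet_of_nonneg hy.1.le, u1 j hj hy]
    · rw [modeJet_of_neg hy.2, l1 j hj hy]
  · rcases lt_or_ge y 0 with h | h
    · rw [modeJet_of_neg h, l2 j hj ⟨hy.1, h.le⟩]
    · rw [modeJet_of_nonneg h, u2 j hj ⟨h, hy.2⟩]

/-- Every solution of the coefficient problem comes from a solution of the linear system. -/
theorem DirichletProblem.IsModeSolution.exists_eq_modeJet {n : ℕ} (hn : 1 ≤ n) {a : Fin n → ℝ}
    (hpos : ∀ s, 0 < a s) (ha : Function.Injective a) {k : ℕ+} {φ ψ : Fin n → ℝ → ℝ} {w : ℝ → ℝ}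
    (h : IsModeSolution a φ ψ k w) :
    ∃ x, (mainMatrix a k).mulVec x = dataVector k (fun s => sineCoeff (φ s) k)
        (fun s => sineCoeff (ψ s) k) ∧
      (∀ j ≤ 2 * n, EqOn (iteratedDeriv j w) (modeJet a k x j) (Ioo 0 1 ∪ Ioo (-1) 0)) ∧
      ∀ j < 2 * n, EqOn (iteratedDerivWithin j w (Icc (-1) 1)) (modeJet a k x j) (Icc (-1) 1) := by
  set O : Set ℝ := Ioo 0 1 ∪ Ioo (-1) 0 with hO
  have hOo : IsOpen O := isOpen_Ioo.union isOpen_Ioo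
  have hOI : O ⊆ Icc (-1) 1 := by
    rintro y (hy | hy)
    · exact ⟨by linarith [hy.1], hy.2.le⟩
    · exact ⟨hy.1.le, by linarith [hy.2]⟩
  -- Up to order 2n - 1 the derivatives live on the closed interval; the one of order 2n is used
  -- only off 0.
  let W : ℕ → ℝ → ℝ := fun j => if j < 2 * n then iteratedDerivWithin j w (Icc (-1) 1)
    else iteratedDeriv j w
  have hch := h.contDiffOn_closure.isDerivChainOn uniqueDiffOn_Icc_neg_one_one
  have hWO : ∀ j, EqOn (W j) (iteratedDeriv j w) O := by
    intro j
    by_cases hj : j < 2 * n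
    · simp only [W, if_pos hj]
      exact ((hch.mono hOI le_rfl).iteratedDeriv_eq hOo
        (by simp only [iteratedDerivWithin_zero]; exact eqOn_refl _ _) (by omega)).symm
    · simp only [W, if_neg hj]; exact eqOn_refl _ _
  have hchO : IsDerivChainOn W O (2 * n) := by
    intro j hj y hy
    have h1 := h.contDiffOn_parts.isDerivChainOn hOo.uniqueDiffOn j hj y hy
    have h2 : ∀ i, EqOn (W i) (iteratedDerivWithin i w O) O := fun i =>
      (hWO i).trans (iteratedDerivWithin_of_isOpen hOo).symm
    rw [h2 (j + 1) hy]
    exact h1.congr (h2 j) (h2 j hy)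
  have hU := hchO.mono (t := Ioo 0 1) subset_union_left le_rfl
  have hL := hchO.mono (t := Ioo (-1) 0) subset_union_right le_rfl
  have hw0 : EqOn w (W 0) O := fun y hy => by rw [hWO 0 hy, iteratedDeriv_zero]
  have hWj : ∀ j < 2 * n, W j = iteratedDerivWithin j w (Icc (-1) 1) := fun j hj => if_pos hj
  obtain ⟨x, hx, hx1, hx2⟩ := _root_.exists_eq_modeJet hpos ha k W _ _
    (fun j hj => by
      rw [hWj j hj]
      exact h.contDiffOn_closure.continuousOn_iteratedDerivWithin
        (by exact_mod_cast (by omega : j ≤ 2 * n - 1)) uniqueDiffOn_Icc_neg_one_one) hU hL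
    (fun y hy => by
      rw [← h.equation y (Or.inl hy), foldr_modeFactorOp_eq (σ := 1) k isOpen_Ioo hU
        (fun z hz => Real.sign_of_pos hz.1) (hw0.mono subset_union_left) _ (by simp) y hy])
    (fun y hy => by
      rw [← h.equation y (Or.inr hy), foldr_modeFactorOp_eq (σ := -1) k isOpen_Ioo hL
        (fun z hz => Real.sign_of_neg hz.2) (hw0.mono subset_union_right) _ (by simp) y hy])
    (fun m => by rw [hWj _ (by omega), h.top m]) (fun m => by rw [hWj _ (by omega), h.bottom m])
  exact ⟨x, hx, fun j hj y hy => by rw [← hWO j hy, hx1 j hj hy],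
    fun j hj y hy => by rw [← hWj j hj, hx2 j hj hy]⟩

/-! ### Solvability of the coefficient problem -/

theorem exists_isModeSolution {n : ℕ} (hn : 1 ≤ n) {a : Fin n → ℝ} (hpos : ∀ s, 0 < a s)
    (ha : Function.Injective a) {k : ℕ+} (hk : delta a k ≠ 0) (φ ψ : Fin n → ℝ → ℝ) :
    ∃ w : ℝ → ℝ, IsModeSolution a φ ψ k w ∧
      ∀ w' : ℝ → ℝ, IsModeSolution a φ ψ k w' → EqOn w' w (Icc (-1) 1) := by
  have hu : IsUnit (mainMatrix a k).det := isUnit_iff_ne_zero.2 hk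
  set d := dataVector k (fun s => sineCoeff (φ s) k) (fun s => sineCoeff (ψ s) k)
  have hx : (mainMatrix a k).mulVec ((mainMatrix a k)⁻¹.mulVec d) = d := by
    rw [Matrix.mulVec_mulVec, Matrix.mul_nonsing_inv _ hu, Matrix.one_mulVec]
  refine ⟨_, isModeSolution_modeJet hn hx, fun w' hw' => ?_⟩
  obtain ⟨x, hx', -, h2⟩ := hw'.exists_eq_modeJet hn hpos ha
  have : x = (mainMatrix a k)⁻¹.mulVec d := by
    change x = (mainMatrix a k)⁻¹.mulVec (dataVector k _ _)
    rw [← hx', Matrix.mulVec_mulVec, Matrix.nonsing_inv_mul _ hu, Matrix.one_mulVec]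
  rw [← this]
  simpa using h2 0 (by omega)

theorem dataVector_zero {n : ℕ} (k : ℕ+) : dataVector k (0 : Fin n → ℝ) 0 = 0 := by
  funext i
  rcases i with (i | i) | i <;> simp [dataVector]

/-- If the determinant vanishes, the homogeneous coefficient problem has a nonzero solution. -/
theorem exists_isModeSolution_ne_zero {n : ℕ} (hn : 1 ≤ n) {a : Fin n → ℝ}
    (hpos : ∀ s, 0 < a s) (ha : Function.Injective a) {k : ℕ+} (hk : delta a k = 0)
    {φ ψ : Fin n → ℝ → ℝ} (hφ : ∀ s, sineCoeff (φ s) k = 0) (hψ : ∀ s, sineCoeff (ψ s) k = 0) :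
    ∃ w : ℝ → ℝ, IsModeSolution a φ ψ k w ∧ ∃ y ∈ Icc (-1 : ℝ) 1, w y ≠ 0 := by
  obtain ⟨x, hx0, hx⟩ := Matrix.exists_mulVec_eq_zero_iff.2 hk
  have hx' : (mainMatrix a k).mulVec x = dataVector k (fun s => sineCoeff (φ s) k)
      (fun s => sineCoeff (ψ s) k) := by
    simp only [hφ, hψ]; exact hx.trans (dataVector_zero k).symm
  refine ⟨_, isModeSolution_modeJet hn hx', ?_⟩
  by_contra! hzero
  refine hx0 ?_
  have hkp : (0 : ℝ) < π * k := mul_pos Real.pi_pos (by exact_mod_cast k.pos)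
  have hb : ∀ s, 0 < π * k * a s := fun s => mul_pos hkp (hpos s)
  have hinj : Function.Injective fun s => (π * k * a s) ^ 2 := fun s t hst => by
    have h1 := (pow_left_inj₀ (hb s).le (hb t).le two_ne_zero).1 hst
    exact ha (mul_left_cancel₀ hkp.ne' h1)
  have hinj' : Function.Injective fun s => -(π * k * a s) ^ 2 := fun s t hst =>
    hinj (neg_injective hst)
  -- A mode that vanishes on each half has all derivatives zero at 0, from either side.
  have hU : ∀ j, upperJet a k x j 0 = 0 := fun j => by
    have h1 : EqOn (upperJet a k x j) 0 (Ioo 0 1) := by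
      have h2 : IsDerivChainOn (upperJet a k x) (Ioo 0 1) j := fun i _ y _ =>
        (hasDerivAt_upperJet i y).hasDerivWithinAt
      refine (h2.iteratedDeriv_eq (f := fun _ => 0) isOpen_Ioo (fun y hy => ?_) le_rfl).symm.trans
        fun y _ => by simp
      rw [← hzero y ⟨by linarith [hy.1], hy.2.le⟩, modeJet_of_nonneg hy.1.le]
    exact (h1.closure (continuous_upperJet j) continuous_const)
      (by rw [closure_Ioo (by norm_num)]; norm_num)
  have hL : ∀ j, lowerJet a k x j 0 = 0 := fun j => by
    have h1 : EqOn (lowerJet a k x j) 0 (Ioo (-1) 0) := by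
      have h2 : IsDerivChainOn (lowerJet a k x) (Ioo (-1) 0) j := fun i _ y _ =>
        (hasDerivAt_lowerJet i y).hasDerivWithinAt
      refine (h2.iteratedDeriv_eq (f := fun _ => 0) isOpen_Ioo (fun y hy => ?_) le_rfl).symm.trans
        fun y _ => by simp
      rw [← hzero y ⟨hy.1.le, by linarith [hy.2]⟩, modeJet_of_neg hy.2]
    exact (h1.closure (continuous_lowerJet j) continuous_const)
      (by rw [closure_Ioo (by norm_num)]; norm_num)
  -- Even derivatives at 0 give a Vandermonde system in the squared frequencies for sums of
  -- coefficients, odd ones for differences; these squares are distinct, so all coefficients vanish.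
  have hA : ∀ s, x (.inl (.inl s)) + x (.inl (.inr s)) = 0 := congrFun
    (Matrix.eq_zero_of_forall_pow_sum_mul_pow_eq_zero hinj fun m => by
      rw [← hU (2 * m), upperJet]
      refine Finset.sum_congr rfl fun s _ => ?_
      simp only [expJet, pow_mul, neg_sq, mul_zero, Real.exp_zero]; ring)
  have hB : ∀ s, (x (.inl (.inl s)) - x (.inl (.inr s))) * (π * k * a s) = 0 := congrFun
    (Matrix.eq_zero_of_forall_pow_sum_mul_pow_eq_zero hinj fun m => by
      rw [← hU (2 * m + 1), upperJet]
      refine Finset.sum_congr rfl fun s _ => ?_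
      simp only [expJet, pow_add, pow_mul, neg_sq, mul_zero, Real.exp_zero]; ring)
  have hC : ∀ s, x (.inr (.inl s)) = 0 := congrFun
    (Matrix.eq_zero_of_forall_pow_sum_mul_pow_eq_zero hinj' fun m => by
      rw [← hL (2 * m), lowerJet]
      refine Finset.sum_congr rfl fun s _ => ?_
      simp only [cosJet_two_mul, sinJet_two_mul, mul_zero, Real.cos_zero, Real.sin_zero]; ring)
  have hodd : ∀ (b : ℝ) (m : ℕ), cosJet b (2 * m + 1) 0 = 0 ∧
      sinJet b (2 * m + 1) 0 = (-b ^ 2) ^ m * b := fun b m => by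
    induction m with
    | zero => simp [cosJet, sinJet]
    | succ m ih =>
      rw [show 2 * (m + 1) + 1 = 2 * m + 1 + 2 by ring, cosJet_add_two, sinJet_add_two, ih.1, ih.2]
      exact ⟨by ring, by ring⟩
  have hD : ∀ s, x (.inr (.inr s)) * (π * k * a s) = 0 := congrFun
    (Matrix.eq_zero_of_forall_pow_sum_mul_pow_eq_zero hinj' fun m => by
      rw [← hL (2 * m + 1), lowerJet]
      refine Finset.sum_congr rfl fun s _ => ?_
      rw [(hodd _ _).1, (hodd _ _).2]; ring)
  funext i
  rcases i with (s | s) | (s | s)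
  · have := (mul_eq_zero.1 (hB s)).resolve_right (hb s).ne'
    change _ = (0 : ℝ)
    linarith [hA s]
  · have := (mul_eq_zero.1 (hB s)).resolve_right (hb s).ne'
    change _ = (0 : ℝ)
    linarith [hA s]
  · exact hC s
  · exact (mul_eq_zero.1 (hD s)).resolve_right (hb s).ne'

/-! ### Sine coefficients and sine series -/

/-- The real integral is the imaginary part of the complex one times a factor of modulus one. -/
theorem norm_integral_mul_sin_le {g : ℝ → ℝ} (hg : ContinuousOn g (Icc 0 1)) (b θ : ℝ) :
    |∫ x in (0 : ℝ)..1, g x * Real.sin (b * x + θ)| ≤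
      ‖∫ x in (0 : ℝ)..1, Complex.exp (b * x * Complex.I) * (g x : ℂ)‖ := by
  have hint : IntervalIntegrable (fun x : ℝ => Complex.exp (b * x * Complex.I) * (g x : ℂ))
      MeasureTheory.volume 0 1 := by
    refine ContinuousOn.intervalIntegrable ?_
    rw [uIcc_of_le zero_le_one]
    exact (Continuous.continuousOn (by fun_prop)).mul
      (Complex.continuous_ofReal.comp_continuousOn hg)
  have h1 : ∫ x in (0 : ℝ)..1, g x * Real.sin (b * x + θ) = Complex.im
      (Complex.exp (θ * Complex.I) *
        ∫ x in (0 : ℝ)..1, Complex.exp (b * x * Complex.I) * (g x : ℂ)) := by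
    rw [← intervalIntegral.integral_const_mul]
    have h2 := Complex.imCLM.intervalIntegral_comp_comm (hint.const_mul (Complex.exp (θ * Complex.I)))
    simp only [Complex.imCLM_apply] at h2
    rw [← h2]
    refine intervalIntegral.integral_congr fun x _ => ?_
    rw [← mul_assoc, ← Complex.exp_add, show (θ : ℂ) * Complex.I + b * x * Complex.I =
      ((b * x + θ : ℝ) : ℂ) * Complex.I by push_cast; ring, Complex.exp_mul_I, ← Complex.ofReal_cos,
      ← Complex.ofReal_sin]
    simp [-Complex.ofReal_cos, -Complex.ofReal_sin, mul_comm]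
  rw [h1]
  refine (Complex.abs_im_le_norm _).trans ?_
  rw [norm_mul, Complex.norm_exp_ofReal_mul_I, one_mul]

/-- Parseval on an interval of length 2, where πk becomes a full frequency, applied to g extended by
zero. -/
theorem summable_sq_integral_mul_sin {g : ℝ → ℝ} (hg : ContinuousOn g (Icc 0 1)) (θ : ℝ) :
    Summable fun k : ℕ+ => (∫ x in (0 : ℝ)..1, g x * Real.sin (π * k * x + θ)) ^ 2 := by
  let f : ℝ → ℂ := (Ioc (0 : ℝ) 1).indicator fun x => (g x : ℂ)
  have hgC : ContinuousOn (fun x => (g x : ℂ)) (Icc (0 : ℝ) 1) :=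
    Complex.continuous_ofReal.comp_continuousOn hg
  obtain ⟨B, hB⟩ := isCompact_Icc.exists_bound_of_continuousOn hgC
  have hf : MeasureTheory.MemLp f 2 (MeasureTheory.volume.restrict (Ioc (0 : ℝ) 2)) := by
    rw [MeasureTheory.memLp_indicator_iff_restrict measurableSet_Ioc,
      MeasureTheory.Measure.restrict_restrict measurableSet_Ioc,
      Set.inter_eq_left.2 (Ioc_subset_Ioc le_rfl one_le_two)]
    refine MeasureTheory.MemLp.of_bound
      ((hgC.mono Ioc_subset_Icc_self).aestronglyMeasurable measurableSet_Ioc) B ?_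
    filter_upwards [MeasureTheory.self_mem_ae_restrict measurableSet_Ioc] with x hx
    exact hB x (Ioc_subset_Icc_self hx)
  have hs := (hasSum_sq_fourierCoeffOn two_pos hf).summable
  -- Fourier coefficients pair with the conjugate character, so exp(iπkx) belongs to the index -k.
  -- The constant 4 below undoes the normalisation 1/2, squared.
  have hinj : Function.Injective fun k : ℕ+ => (-(k : ℤ) : ℤ) := fun k m h => by
    simpa using h
  refine ((hs.comp_injective hinj).mul_left 4).of_nonneg_of_le (fun _ => sq_nonneg _) fun k => ?_
  have h1 := norm_integral_mul_sin_le hg (π * k) θ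
  have h2 : fourierCoeffOn two_pos f (-(k : ℤ)) =
      (1 / 2 : ℝ) • ∫ x in (0 : ℝ)..1, Complex.exp ((π * k : ℝ) * x * Complex.I) * (g x : ℂ) := by
    rw [fourierCoeffOn_eq_integral]
    congr 1
    · norm_num
    rw [intervalIntegral.integral_of_le zero_le_two, intervalIntegral.integral_of_le zero_le_one]
    have h3 : ∀ x : ℝ, (fourier (- -(k : ℤ)) (x : AddCircle ((2 : ℝ) - 0))) • f x =
        (Ioc (0 : ℝ) 1).indicator
          (fun x : ℝ => Complex.exp ((π * k : ℝ) * x * Complex.I) * (g x : ℂ)) x := by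
      intro x
      by_cases hx : x ∈ Ioc (0 : ℝ) 1
      · rw [indicator_of_mem hx, fourier_coe_apply]
        simp only [f, indicator_of_mem hx, smul_eq_mul]
        congr 2
        push_cast
        ring
      · simp only [f, indicator_of_notMem hx, smul_zero]
    simp_rw [h3]
    rw [MeasureTheory.setIntegral_indicator measurableSet_Ioc,
      Set.inter_eq_right.2 (Ioc_subset_Ioc le_rfl one_le_two)]
  simp only [Function.comp_apply]
  rw [h2, norm_smul, Real.norm_of_nonneg (by norm_num : (0 : ℝ) ≤ 1 / 2), mul_pow, ← sq_abs]
  have := pow_le_pow_left₀ (abs_nonneg _) h1 2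
  linarith

/-- Each integration by parts gains 1/(πk) and shifts the phase by π/2; the compatibility conditions
are exactly the vanishing of the boundary terms. -/
theorem integral_mul_sin_eq {D : ℕ → ℝ → ℝ} {N : ℕ} (hD : IsDerivChainOn D (Icc 0 1) N)
    (hc : ContinuousOn (D N) (Icc 0 1)) (k : ℕ+)
    (hbd : ∀ s : ℕ, 1 ≤ s → s ≤ N → D (s - 1) 1 * Real.sin (π * k * 1 + π / 2 * s)
      - D (s - 1) 0 * Real.sin (π * k * 0 + π / 2 * s) = 0) :
    ∀ r ≤ N, ∫ x in (0 : ℝ)..1, D 0 x * Real.sin (π * k * x) =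
      (1 / (π * k)) ^ r * ∫ x in (0 : ℝ)..1, D r x * Real.sin (π * k * x + π / 2 * r) := by
  have hk : (0 : ℝ) < π * k := mul_pos Real.pi_pos (by exact_mod_cast k.pos)
  have hcont : ∀ j ≤ N, ContinuousOn (D j) (Icc 0 1) := fun j hj => by
    rcases hj.lt_or_eq with h | rfl
    · exact fun x hx => (hD j h x hx).continuousWithinAt
    · exact hc
  intro r
  induction r with
  | zero => simp
  | succ r ih =>
    intro hr
    rw [ih (by omega), pow_succ, mul_assoc]
    congr 1
    have hv : ∀ x : ℝ, HasDerivAt (fun x => -(1 / (π * k)) * Real.sin (π * k * x + π / 2 * (r + 1 : ℕ)))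
        (Real.sin (π * k * x + π / 2 * r)) x := fun x => by
      refine (((((hasDerivAt_id x).const_mul (π * k)).add_const
        (π / 2 * (r + 1 : ℕ))).sin).const_mul (-(1 / (π * k)))).congr_deriv ?_
      simp only [id]
      rw [show π * k * x + π / 2 * (r + 1 : ℕ) = (π * k * x + π / 2 * r) + π / 2 by push_cast; ring,
        Real.cos_add_pi_div_two]
      field_simp
    have h1 := intervalIntegral.integral_mul_deriv_eq_deriv_mul_of_hasDerivWithinAt
      (a := 0) (b := 1) (u := D r) (u' := D (r + 1))
      (v := fun x => -(1 / (π * k)) * Real.sin (π * k * x + π / 2 * (r + 1 : ℕ)))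
      (v' := fun x => Real.sin (π * k * x + π / 2 * r))
      (by rw [uIcc_of_le zero_le_one]; exact hD r (by omega))
      (fun x _ => (hv x).hasDerivWithinAt)
      (ContinuousOn.intervalIntegrable (by rw [uIcc_of_le zero_le_one]; exact hcont _ hr))
      (Continuous.intervalIntegrable (by fun_prop) _ _)
    rw [h1]
    have h2 := hbd (r + 1) (by omega) hr
    rw [Nat.add_sub_cancel] at h2
    have h3 : ∀ x, D (r + 1) x * (-(1 / (π * k)) * Real.sin (π * k * x + π / 2 * (r + 1 : ℕ))) =
        -(1 / (π * k)) * (D (r + 1) x * Real.sin (π * k * x + π / 2 * (r + 1 : ℕ))) := fun x => by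
      ring
    simp_rw [h3]
    rw [intervalIntegral.integral_const_mul]
    linear_combination -(1 / (π * k)) * h2

/-- After N + 1 integrations by parts, a factor 1/k remains in front of a square summable sequence
c; the product is at most c² + 1/k². -/
theorem summable_pow_mul_sineCoeff {N : ℕ} {f : ℝ → ℝ} (hf : IsAdmissibleDatum (N + 1) f) :
    Summable fun k : ℕ+ => (k : ℝ) ^ N * |sineCoeff f k| := by
  have hu : UniqueDiffOn ℝ (Icc (0 : ℝ) 1) := uniqueDiffOn_Icc zero_lt_one
  have hD := hf.contDiffOn.isDerivChainOn hu
  have hc := hf.contDiffOn.continuousOn_iteratedDerivWithin le_rfl hu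
  have h1 := fun k => integral_mul_sin_eq hD hc k (hf.compatible k) (N + 1) le_rfl
  simp only [iteratedDerivWithin_zero] at h1
  have hs := summable_sq_integral_mul_sin hc (π / 2 * (N + 1 : ℕ))
  have hs2 : Summable fun k : ℕ+ => 1 / (k : ℝ) ^ 2 :=
    (Real.summable_one_div_nat_pow.2 one_lt_two).comp_injective PNat.coe_injective
  refine ((hs.add hs2).mul_left √2).of_nonneg_of_le (fun k => by positivity) fun k => ?_
  have hk : (0 : ℝ) < k := by exact_mod_cast k.pos
  rw [sineCoeff, h1 k, abs_mul, abs_mul, abs_of_nonneg (sqrt_nonneg 2),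
    abs_of_nonneg (by positivity : (0 : ℝ) ≤ (1 / (π * k)) ^ (N + 1))]
  set c := ∫ x in (0 : ℝ)..1, iteratedDerivWithin (N + 1) f (Icc 0 1) x *
    Real.sin (π * k * x + π / 2 * (N + 1 : ℕ))
  have h2 : (k : ℝ) ^ N * (1 / (π * k)) ^ (N + 1) ≤ 1 / k := by
    calc (k : ℝ) ^ N * (1 / (π * k)) ^ (N + 1) ≤ (k : ℝ) ^ N * (1 / k) ^ (N + 1) := by
          gcongr
          exact le_mul_of_one_le_left hk.le (by linarith [Real.pi_gt_three])
      _ = 1 / k := by rw [pow_succ, one_div, inv_pow]; field_simp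
  have h3 : 1 / (k : ℝ) * |c| ≤ c ^ 2 + 1 / (k : ℝ) ^ 2 := by
    have h4 : (1 / (k : ℝ)) ^ 2 = 1 / (k : ℝ) ^ 2 := by rw [div_pow, one_pow]
    nlinarith [sq_nonneg (1 / (k : ℝ) - |c|), sq_abs c, sq_nonneg (1 / (k : ℝ)), sq_nonneg c]
  calc (k : ℝ) ^ N * (√2 * ((1 / (π * k)) ^ (N + 1) * |c|))
      = √2 * (((k : ℝ) ^ N * (1 / (π * k)) ^ (N + 1)) * |c|) := by ring
    _ ≤ √2 * (1 / (k : ℝ) * |c|) := by gcongr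
    _ ≤ _ := by gcongr

theorem IsAdmissibleDatum_zero (N : ℕ) : IsAdmissibleDatum N (fun _ => 0) where
  contDiffOn := contDiffOn_const
  compatible k s _ _ := by simp

/-- The condition of order 1 reads f(1) cos(πk) = f(0); the two parities of `k` give f(1) = ±f(0).
-/
theorem IsAdmissibleDatum.boundary_eq_zero {N : ℕ} {f : ℝ → ℝ} (hf : IsAdmissibleDatum (N + 1) f) :
    f 0 = 0 ∧ f 1 = 0 := by
  have h1 := hf.compatible 1 1 le_rfl (by omega)
  have h2 := hf.compatible 2 1 le_rfl (by omega)
  simp only [Nat.sub_self, iteratedDerivWithin_zero, Nat.cast_one, mul_one, mul_zero, zero_add,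
    Real.sin_add_pi_div_two, Real.sin_pi_div_two, PNat.one_coe, Real.cos_pi] at h1 h2
  have h3 : Real.cos (π * ((2 : ℕ+) : ℕ)) = 1 := by
    rw [show π * ((2 : ℕ+) : ℕ) = 2 * π by push_cast; ring]; exact Real.cos_two_pi
  rw [h3] at h2
  constructor <;> linarith

/-- A continuous function vanishing at the end points is the sum of its sine series if the
coefficients are absolutely summable. -/
theorem hasSum_sineCoeff_mul_sin {f : ℝ → ℝ} (hf : ContinuousOn f (Icc 0 1)) (h0 : f 0 = 0)
    (h1 : f 1 = 0) (hs : Summable fun k : ℕ+ => |sineCoeff f k|) {x : ℝ} (hx : x ∈ Icc (0 : ℝ) 1) :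
    HasSum (fun k : ℕ+ => √2 * (sineCoeff f k * Real.sin (π * k * x))) (f x) := by
  have : Fact ((0 : ℝ) < 2) := ⟨two_pos⟩
  -- The odd extension of f to [-1, 1]: one of the two terms is always f(0) = 0. Oddness leaves only
  -- the sine part of the Fourier series with period 2.
  let G : ℝ → ℂ := fun x => (f (max x 0) : ℂ) - f (max (-x) 0)
  have hG0 : ∀ x, 0 ≤ x → G x = f x := fun x hx => by
    simp only [G]
    rw [max_eq_left hx, max_eq_right (by linarith), h0, Complex.ofReal_zero, sub_zero]
  have hG1 : ∀ x, 0 ≤ x → G (-x) = -f x := fun x hx => by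
    simp only [G]
    rw [neg_neg, max_eq_left hx, max_eq_right (by linarith), h0, Complex.ofReal_zero, zero_sub]
  have hGc : ContinuousOn G (Icc (-1) (-1 + 2)) := by
    refine (Complex.continuous_ofReal.comp_continuousOn (hf.comp (Continuous.continuousOn
      (by fun_prop)) ?_)).sub (Complex.continuous_ofReal.comp_continuousOn (hf.comp
      (Continuous.continuousOn (by fun_prop)) ?_))
    · exact fun y hy => ⟨le_max_right _ _, max_le (by linarith [hy.2]) zero_le_one⟩
    · exact fun y hy => ⟨le_max_right _ _, max_le (by linarith [hy.1]) zero_le_one⟩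
  let F : C(AddCircle (2 : ℝ), ℂ) := ⟨AddCircle.liftIco 2 (-1) G, AddCircle.liftIco_continuous
    (by rw [hG1 1 zero_le_one, hG0 _ (by norm_num)]; norm_num [h1]) hGc⟩
  let S : ℤ → ℝ := fun n => ∫ x in (0 : ℝ)..1, f x * Real.sin (π * n * x)
  let E : ℤ → ℝ → ℂ := fun n x => Complex.exp (-(π * n * x : ℝ) * Complex.I)
  have hEE : ∀ n x, E n x - E n (-x) = -2 * Complex.I * Real.sin (π * n * x) := fun n x => by
    simp only [E]
    rw [show π * n * -x = -(π * n * x) by ring, ← Complex.ofReal_neg, ← Complex.ofReal_neg,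
      Complex.exp_mul_I, Complex.exp_mul_I, ← Complex.ofReal_cos, ← Complex.ofReal_sin,
      ← Complex.ofReal_cos, ← Complex.ofReal_sin, neg_neg, Real.cos_neg, Real.sin_neg]
    push_cast
    ring
  have hEc : ∀ n, Continuous (E n) := fun n => by simp only [E]; fun_prop
  have hcoef : ∀ n, fourierCoeff F n = -Complex.I * S n := by
    intro n
    change fourierCoeff (AddCircle.liftIco 2 (-1) G) n = _
    rw [fourierCoeff_liftIco_eq, fourierCoeffOn_eq_integral]
    have h3 : ∀ x : ℝ, (fourier (-n) (x : AddCircle ((-1 : ℝ) + 2 - -1))) • G x = E n x * G x := by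
      intro x
      rw [fourier_coe_apply, smul_eq_mul]
      simp only [E]
      congr 2
      push_cast
      ring
    simp_rw [h3]
    have hint : ∀ c d : ℝ, c ∈ Icc (-1 : ℝ) 1 → d ∈ Icc (-1 : ℝ) 1 →
        IntervalIntegrable (fun x => E n x * G x) MeasureTheory.volume c d := fun c d hc hd =>
      ContinuousOn.intervalIntegrable (((hEc n).continuousOn.mul hGc).mono (by
        rw [show (-1 : ℝ) + 2 = 1 by norm_num]
        exact uIcc_subset_Icc hc hd))
    rw [show (-1 : ℝ) + 2 = 1 by norm_num, ← intervalIntegral.integral_add_adjacent_intervals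
      (hint (-1) 0 (by norm_num) (by norm_num)) (hint 0 1 (by norm_num) (by norm_num))]
    have h4 : ∫ x in (-1 : ℝ)..0, E n x * G x = ∫ x in (0 : ℝ)..1, E n (-x) * G (-x) := by
      rw [intervalIntegral.integral_comp_neg (fun x => E n x * G x), neg_zero]
    have hint2 : IntervalIntegrable (fun x => E n (-x) * G (-x)) MeasureTheory.volume 0 1 := by
      have := (hint (-1) 0 (by norm_num) (by norm_num)).comp_mul_left (c := -1)
      simpa using this.symm
    rw [h4, ← intervalIntegral.integral_add hint2 (hint 0 1 (by norm_num) (by norm_num))]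
    have h5 : ∫ x in (0 : ℝ)..1, E n (-x) * G (-x) + E n x * G x =
        -2 * Complex.I * S n := by
      simp only [S]
      rw [← intervalIntegral.integral_ofReal, ← intervalIntegral.integral_const_mul]
      refine intervalIntegral.integral_congr fun x hx => ?_
      rw [uIcc_of_le zero_le_one] at hx
      rw [hG0 x hx.1, hG1 x hx.1]
      push_cast
      have := hEE n x
      push_cast at this
      linear_combination (f x : ℂ) * this
    rw [h5, Complex.real_smul]
    push_cast
    ring
  have hSk : ∀ k : ℕ+, √2 * sineCoeff f k = 2 * S k := fun k => by
    rw [sineCoeff, ← mul_assoc, Real.mul_self_sqrt zero_le_two]; simp [S]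
  have hSneg : ∀ n, S (-n) = - S n := fun n => by
    simp only [S]
    rw [← intervalIntegral.integral_neg]
    refine intervalIntegral.integral_congr fun x _ => ?_
    simp only [Int.cast_neg]
    rw [show π * -(n : ℝ) * x = -(π * n * x) by ring, Real.sin_neg]; ring
  have hS0 : S 0 = 0 := by simp [S]
  have hout : ∀ n : ℕ, n ∉ range ((↑) : ℕ+ → ℕ) → n = 0 := fun n hn => by
    by_contra h
    exact hn ⟨⟨n, Nat.pos_of_ne_zero h⟩, rfl⟩
  have hsN : Summable fun n : ℕ => |S n| := by
    refine (PNat.coe_injective.summable_iff fun n hn => ?_).1 ?_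
    · rw [hout n hn]; simp [hS0]
    · refine (hs.mul_left (√2 / 2)).congr fun k => ?_
      have := hSk k
      have h5 : S k = √2 / 2 * sineCoeff f k := by linarith
      simp only [Function.comp_apply]
      rw [show S ((k : ℕ) : ℤ) = √2 / 2 * sineCoeff f k from h5, abs_mul,
        abs_of_nonneg (a := √2 / 2) (by positivity)]
  have hsum : Summable (fourierCoeff F) := by
    refine Summable.of_norm (Summable.of_nat_of_neg ?_ ?_)
    · refine hsN.congr fun n => ?_
      rw [hcoef]; simp
    · refine hsN.congr fun n => ?_
      rw [hcoef, hSneg]; simp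
  -- The lift to the circle uses [-1, 1), so the point 1, where every sine vanishes, is separate.
  rcases hx.2.lt_or_eq with hx1 | rfl
  · have hpt := (has_pointwise_sum_fourier_series_of_summable hsum
      ((x : ℝ) : AddCircle (2 : ℝ))).nat_add_neg
    have hFx : F ((x : ℝ) : AddCircle (2 : ℝ)) = f x := by
      change AddCircle.liftIco 2 (-1) G _ = _
      rw [AddCircle.liftIco_coe_apply ⟨by linarith [hx.1], by linarith⟩, hG0 x hx.1]
    rw [hFx, hcoef 0, hS0] at hpt
    simp only [Complex.ofReal_zero, mul_zero, zero_smul, add_zero] at hpt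
    have hterm : ∀ n : ℕ, fourierCoeff F n • fourier (n : ℤ) ((x : ℝ) : AddCircle (2 : ℝ)) +
        fourierCoeff F (-(n : ℤ)) • fourier (-(n : ℤ)) ((x : ℝ) : AddCircle (2 : ℝ)) =
        ((2 * S n * Real.sin (π * n * x) : ℝ) : ℂ) := by
      intro n
      have e1 : ∀ m : ℤ, fourier m ((x : ℝ) : AddCircle (2 : ℝ)) = E m (-x) := fun m => by
        rw [fourier_coe_apply]
        simp only [E]
        congr 1
        push_cast
        ring
      have e2 : E (-(n : ℤ)) (-x) = E n x := by
        simp only [E]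
        congr 1
        push_cast
        ring
      have e3 := hEE n x
      rw [hcoef, hcoef, hSneg, e1, e1, e2, smul_eq_mul, smul_eq_mul]
      push_cast at e3 ⊢
      linear_combination Complex.I * S n * e3 - 2 * S n * Complex.sin (π * n * x) * Complex.I_mul_I
    simp_rw [hterm] at hpt
    have hpt' := Complex.hasSum_ofReal.1 hpt
    rw [← PNat.coe_injective.hasSum_iff (fun n hn => by rw [hout n hn]; simp [hS0])] at hpt'
    refine hpt'.congr_fun fun k => ?_
    simp only [Function.comp_apply]
    rw [← mul_assoc, hSk k]
  · rw [h1]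
    refine (hasSum_zero (α := ℝ) (β := ℕ+)).congr_fun fun k => ?_
    rw [mul_one, mul_comm π, Real.sin_nat_mul_pi]; simp

/-- A continuous function vanishing at the end points is determined by its sine coefficients. -/
theorem eq_zero_of_sineCoeff_eq_zero {f : ℝ → ℝ} (hf : ContinuousOn f (Icc 0 1)) (h0 : f 0 = 0)
    (h1 : f 1 = 0) (hs : ∀ k : ℕ+, sineCoeff f k = 0) {x : ℝ} (hx : x ∈ Icc (0 : ℝ) 1) :
    f x = 0 := by
  refine (hasSum_sineCoeff_mul_sin hf h0 h1 (by simp [hs]) hx).unique ?_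
  simp [hs]

/-! ### Termwise differentiation -/

/-- The set need not be open, since derivatives at the boundary are one-sided. Convexity gives the
mean value inequality, which dominates the difference quotients of all terms, and the limit is taken
by dominated convergence. -/
theorem hasFDerivWithinAt_tsum_of_convex {ι E : Type*} [NormedAddCommGroup E] [NormedSpace ℝ E]
    {S : Set E} (hS : Convex ℝ S) {f : ι → E → ℝ} {f' : ι → E → E →L[ℝ] ℝ} {β : ι → ℝ}
    (hβ : Summable β) (hf : ∀ k, ∀ x ∈ S, HasFDerivWithinAt (f k) (f' k x) S x)
    (hb : ∀ k, ∀ x ∈ S, ‖f' k x‖ ≤ β k) (hs : ∀ x ∈ S, Summable fun k => f k x) {x : E}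
    (hx : x ∈ S) :
    HasFDerivWithinAt (fun z => ∑' k, f k z) (∑' k, f' k x) S x := by
  rw [hasFDerivWithinAt_iff_tendsto]
  set r : E → ι → ℝ := fun z k => ‖z - x‖⁻¹ * ‖f k z - f k x - f' k x (z - x)‖ with hr
  have hr0 : ∀ k, Tendsto (fun z => r z k) (𝓝[S] x) (𝓝 0) := fun k =>
    hasFDerivWithinAt_iff_tendsto.1 (hf k x hx)
  have hs' : Summable fun k => f' k x := Summable.of_norm_bounded hβ fun k => hb k x hx
  have hrb : ∀ z ∈ S, ∀ k, ‖r z k‖ ≤ 2 * β k := fun z hz k => by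
    have h1 : ‖f k z - f k x‖ ≤ β k * ‖z - x‖ :=
      hS.norm_image_sub_le_of_norm_hasFDerivWithin_le (hf k) (hb k) hx hz
    have h2 : ‖f' k x (z - x)‖ ≤ β k * ‖z - x‖ :=
      ((f' k x).le_opNorm _).trans (mul_le_mul_of_nonneg_right (hb k x hx) (norm_nonneg _))
    have h3 : ‖f k z - f k x - f' k x (z - x)‖ ≤ 2 * β k * ‖z - x‖ := by
      refine (norm_sub_le _ _).trans ?_; linarith
    rw [Real.norm_of_nonneg (by positivity)]
    have hβ0 : 0 ≤ β k := (norm_nonneg _).trans (hb k x hx)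
    rcases eq_or_ne ‖z - x‖ 0 with h0 | h0
    · simp only [r, h0, inv_zero, zero_mul]; linarith
    · calc r z k ≤ ‖z - x‖⁻¹ * (2 * β k * ‖z - x‖) := by simp only [r]; gcongr
        _ = 2 * β k := by field_simp
  have hlim := tendsto_tsum_of_dominated_convergence (hβ.mul_left 2) hr0
    (eventually_nhdsWithin_of_forall hrb)
  rw [tsum_zero] at hlim
  refine squeeze_zero' (Eventually.of_forall fun z => by positivity) ?_ hlim
  filter_upwards [self_mem_nhdsWithin] with z hz
  have hrs : Summable (r z) := Summable.of_norm_bounded (hβ.mul_left 2) (hrb z hz)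
  have e1 : (∑' k, f' k x) (z - x) = ∑' k, f' k x (z - x) := by
    have := (ContinuousLinearMap.apply ℝ ℝ (z - x)).map_tsum hs'
    simpa using this
  have hs2 : Summable fun k => f' k x (z - x) := by
    have := (ContinuousLinearMap.apply ℝ ℝ (z - x)).summable hs'
    simpa using this
  have e2 : ∑' k, f k z - ∑' k, f k x - ∑' k, f' k x (z - x) =
      ∑' k, (f k z - f k x - f' k x (z - x)) := by
    rw [((hs z hz).sub (hs x hx)).tsum_sub hs2, (hs z hz).tsum_sub (hs x hx)]
  rw [e1, e2]
  rcases eq_or_ne ‖z - x‖ 0 with h0 | h0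
  · rw [h0, inv_zero, zero_mul]; exact tsum_nonneg fun k => by positivity
  · have hns : Summable fun k => ‖f k z - f k x - f' k x (z - x)‖ := by
      refine (hrs.mul_left ‖z - x‖).congr fun k => ?_
      simp only [r]; field_simp
    calc _ ≤ ‖z - x‖⁻¹ * ∑' k, ‖f k z - f k x - f' k x (z - x)‖ := by
          gcongr; exact norm_tsum_le_tsum_norm hns
      _ = _ := by rw [← tsum_mul_left]

theorem hasDerivWithinAt_tsum_of_convex {ι : Type*} {S : Set ℝ} (hS : Convex ℝ S)
    {f d : ι → ℝ → ℝ} {β : ι → ℝ} (hβ : Summable β)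
    (hf : ∀ k, ∀ x ∈ S, HasDerivWithinAt (f k) (d k x) S x)
    (hb : ∀ k, ∀ x ∈ S, |d k x| ≤ β k) (hs : ∀ x ∈ S, Summable fun k => f k x) {x : ℝ}
    (hx : x ∈ S) : HasDerivWithinAt (fun z => ∑' k, f k z) (∑' k, d k x) S x := by
  have h := hasFDerivWithinAt_tsum_of_convex hS hβ
    (f' := fun k x => ContinuousLinearMap.toSpanSingleton ℝ (d k x))
    (fun k x hx => (hf k x hx).hasFDerivWithinAt) (fun k x hx => by simpa using hb k x hx) hs hx
  refine h.hasDerivWithinAt.congr_deriv ?_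
  have hs' : Summable fun k => ContinuousLinearMap.toSpanSingleton ℝ (d k x) :=
    Summable.of_norm_bounded hβ fun k => by simpa using hb k x hx
  have := (ContinuousLinearMap.apply ℝ ℝ (1 : ℝ)).map_tsum hs'
  simpa using this

section ProductSeries

variable {ι : Type*} {X Y : ι → ℕ → ℝ → ℝ} {I J : Set ℝ} {M : ℕ} {β : ι → ℝ}

/-- The termwise derivatives of `∑ X k 0 x * Y k 0 y`. -/
noncomputable def productSeries (X Y : ι → ℕ → ℝ → ℝ) (i j : ℕ) (x y : ℝ) : ℝ :=
  ∑' k, X k i x * Y k j y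

theorem isJetOn_productSeries (hI : Convex ℝ I) (hJ : Convex ℝ J) (hβ : Summable β)
    (hX : ∀ k, IsDerivChainOn (X k) I M) (hY : ∀ k, IsDerivChainOn (Y k) J M)
    (hb : ∀ k i j, i + j ≤ M → ∀ x ∈ I, ∀ y ∈ J, |X k i x * Y k j y| ≤ β k) :
    IsJetOn (productSeries X Y) I J M := by
  have hs : ∀ i j, i + j ≤ M → ∀ x ∈ I, ∀ y ∈ J, Summable fun k => X k i x * Y k j y :=
    fun i j hij x hx y hy => Summable.of_norm_bounded hβ fun k => hb k i j hij x hx y hy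
  constructor
  · intro i j hij x hx y hy
    exact hasDerivWithinAt_tsum_of_convex hI hβ
      (fun k x hx => (hX k i (by omega) x hx).mul_const (Y k j y))
      (fun k x hx => hb k (i + 1) j (by omega) x hx y hy)
      (fun x hx => hs i j hij.le x hx y hy) hx
  · intro i j hij x hx y hy
    exact hasDerivWithinAt_tsum_of_convex hJ hβ
      (fun k y hy => (hY k j (by omega) y hy).const_mul (X k i x))
      (fun k y hy => hb k i (j + 1) (by omega) x hx y hy)
      (fun y hy => hs i j hij.le x hx y hy) hy

/-- The total derivative is built from the two series with one index raised, which are of the same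
type; induction on the order of smoothness. -/
theorem contDiffOn_productSeries (hI : Convex ℝ I) (hJ : Convex ℝ J) (hI' : UniqueDiffOn ℝ I)
    (hJ' : UniqueDiffOn ℝ J) (hβ : Summable β)
    (hXc : ∀ k i, ContinuousOn (X k i) I) (hYc : ∀ k, ∀ j ≤ M, ContinuousOn (Y k j) J)
    (hX : ∀ k, IsDerivChainOn (X k) I M) (hY : ∀ k, IsDerivChainOn (Y k) J M)
    (hb : ∀ k i j, i + j ≤ M → ∀ x ∈ I, ∀ y ∈ J, |X k i x * Y k j y| ≤ β k) (m : ℕ) :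
    ∀ i j, i + j + m ≤ M →
      ContDiffOn ℝ m (fun p : ℝ × ℝ => productSeries X Y i j p.1 p.2) (I ×ˢ J) := by
  have hU : UniqueDiffOn ℝ (I ×ˢ J) := hI'.prod hJ'
  have hs : ∀ i j, i + j ≤ M → ∀ x ∈ I, ∀ y ∈ J, Summable fun k => X k i x * Y k j y :=
    fun i j hij x hx y hy => Summable.of_norm_bounded hβ fun k => hb k i j hij x hx y hy
  induction m with
  | zero =>
    intro i j hij
    rw [Nat.cast_zero, contDiffOn_zero]
    refine continuousOn_tsum (fun k => ?_) hβ fun k p hp => hb k i j (by omega) p.1 hp.1 p.2 hp.2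
    exact ((hXc k i).comp continuousOn_fst fun p hp => hp.1).mul
      ((hYc k j (by omega)).comp continuousOn_snd fun p hp => hp.2)
  | succ m ih =>
    intro i j hij
    let D : ℝ × ℝ → ℝ × ℝ →L[ℝ] ℝ := fun p =>
      productSeries X Y (i + 1) j p.1 p.2 • ContinuousLinearMap.fst ℝ ℝ ℝ +
        productSeries X Y i (j + 1) p.1 p.2 • ContinuousLinearMap.snd ℝ ℝ ℝ
    have hD : ∀ p ∈ I ×ˢ J, HasFDerivWithinAt
        (fun p : ℝ × ℝ => productSeries X Y i j p.1 p.2) (D p) (I ×ˢ J) p := by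
      intro p hp
      let d : ι → ℝ × ℝ → ℝ × ℝ →L[ℝ] ℝ := fun k p =>
        (X k (i + 1) p.1 * Y k j p.2) • ContinuousLinearMap.fst ℝ ℝ ℝ +
          (X k i p.1 * Y k (j + 1) p.2) • ContinuousLinearMap.snd ℝ ℝ ℝ
      have h1 := hasFDerivWithinAt_tsum_of_convex (hI.prod hJ) (hβ.mul_left 2)
        (f := fun k p => X k i p.1 * Y k j p.2) (f' := d) (fun k p hp => ?_) (fun k p hp => ?_)
        (fun p hp => hs i j (by omega) _ hp.1 _ hp.2) hp
      · refine h1.congr_fderiv ?_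
        have s1 := hs (i + 1) j (by omega) _ hp.1 _ hp.2
        have s2 := hs i (j + 1) (by omega) _ hp.1 _ hp.2
        simp only [d, D, productSeries]
        rw [(s1.smul_const _).tsum_add (s2.smul_const _), s1.tsum_smul_const, s2.tsum_smul_const]
      · have e1 := (hX k i (by omega) p.1 hp.1).comp_hasFDerivWithinAt p
          (hasFDerivWithinAt_fst : HasFDerivWithinAt Prod.fst (ContinuousLinearMap.fst ℝ ℝ ℝ) (I ×ˢ J) p)
          (fun p (hp : p ∈ I ×ˢ J) => hp.1)
        have e2 := (hY k j (by omega) p.2 hp.2).comp_hasFDerivWithinAt p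
          (hasFDerivWithinAt_snd : HasFDerivWithinAt Prod.snd (ContinuousLinearMap.snd ℝ ℝ ℝ) (I ×ˢ J) p)
          (fun p (hp : p ∈ I ×ˢ J) => hp.2)
        refine (e1.mul e2).congr_fderiv ?_
        ext
        · simp [d]; ring
        · simp [d]
      · refine (norm_add_le _ _).trans ?_
        rw [norm_smul, norm_smul, Real.norm_eq_abs, Real.norm_eq_abs]
        have b1 := hb k (i + 1) j (by omega) _ hp.1 _ hp.2
        have b2 := hb k i (j + 1) (by omega) _ hp.1 _ hp.2
        have n1 := ContinuousLinearMap.norm_fst_le ℝ ℝ ℝ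
        have n2 := ContinuousLinearMap.norm_snd_le ℝ ℝ ℝ
        have := mul_le_of_le_one_right (abs_nonneg (X k (i + 1) p.1 * Y k j p.2)) n1
        have := mul_le_of_le_one_right (abs_nonneg (X k i p.1 * Y k (j + 1) p.2)) n2
        linarith
    have hc : ContDiffOn ℝ m D (I ×ˢ J) :=
      ((ih (i + 1) j (by omega)).smul contDiffOn_const).add
        ((ih i (j + 1) (by omega)).smul contDiffOn_const)
    rw [Nat.cast_succ]
    refine contDiffOn_succ_of_fderivWithin (fun p hp => (hD p hp).differentiableWithinAt)
      (fun h => by simp at h) (hc.congr fun p hp => ?_)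
    exact (hD p hp).fderivWithin (hU p hp)

end ProductSeries

/-! ### Bounds for the solutions of the coefficient problems -/

section ModeBound

variable {n : ℕ} {a : Fin n → ℝ}

/-- The size of a vector of coefficients, relative to the scale of the columns. -/
noncomputable def scaledSize (a : Fin n → ℝ) (k : ℕ+)
    (x : (Fin n ⊕ Fin n) ⊕ (Fin n ⊕ Fin n) → ℝ) : ℝ := ∑ i, |x i / columnScale a k i|

theorem scaledSize_nonneg (k : ℕ+) (x : (Fin n ⊕ Fin n) ⊕ (Fin n ⊕ Fin n) → ℝ) :
    0 ≤ scaledSize a k x := Finset.sum_nonneg fun _ _ => abs_nonneg _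

/-- For y ≤ 1 a growing exponential is at most exp(πk aₛ), which is the weight of its coefficient in
`scaledSize`; the other functions are bounded by 1 on their own side. -/
theorem abs_modeJet_le (hpos : ∀ s, 0 < a s) (k : ℕ+)
    (x : (Fin n ⊕ Fin n) ⊕ (Fin n ⊕ Fin n) → ℝ) (j : ℕ) {y : ℝ} (hy : y ≤ 1) :
    |modeJet a k x j y| ≤ (π * k * (1 + ∑ s, a s)) ^ j * scaledSize a k x := by
  have hk : (0 : ℝ) < π * k := mul_pos Real.pi_pos (by exact_mod_cast k.pos)
  have hB : ∀ s, |π * k * a s| ≤ π * k * (1 + ∑ s, a s) := fun s => by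
    rw [abs_of_pos (mul_pos hk (hpos s))]
    have := Finset.single_le_sum (fun s _ => (hpos s).le) (Finset.mem_univ s)
    gcongr
    linarith
  set B := π * k * (1 + ∑ s, a s)
  have hB0 : 0 ≤ B := mul_nonneg hk.le (by have := Finset.sum_nonneg fun s (_ : s ∈ Finset.univ) => (hpos s).le; linarith)
  have key : ∀ z b c t : ℝ, |b| ≤ B → |c| ≤ t → |z * (b ^ j * c)| ≤ B ^ j * (|z| * t) := by
    intro z b c t h1 h2
    rw [abs_mul, abs_mul, abs_pow]
    calc |z| * (|b| ^ j * |c|) ≤ |z| * (B ^ j * t) := by gcongr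
      _ = _ := by ring
  have hsum : scaledSize a k x = ∑ s, (|x (.inl (.inl s))| * Real.exp (π * k * a s)
      + |x (.inl (.inr s))| * 1) + ∑ s, (|x (.inr (.inl s))| * 1 + |x (.inr (.inr s))| * 1) := by
    simp only [scaledSize, Fintype.sum_sum_type, columnScale, abs_div, abs_one, div_one,
      Finset.sum_add_distrib, mul_one, Real.abs_exp, Real.exp_neg, abs_inv, div_inv_eq_mul]
  rw [hsum, mul_add]
  have n1 : 0 ≤ B ^ j * ∑ s, (|x (.inl (.inl s))| * Real.exp (π * k * a s)
      + |x (.inl (.inr s))| * 1) := by positivity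
  have n2 : 0 ≤ B ^ j * ∑ s, (|x (.inr (.inl s))| * 1 + |x (.inr (.inr s))| * 1) := by positivity
  rcases le_or_gt 0 y with h | h
  · rw [modeJet_of_nonneg h]
    refine le_trans ?_ (le_add_of_nonneg_right n2)
    rw [Finset.mul_sum]
    refine (Finset.abs_sum_le_sum_abs _ _).trans (Finset.sum_le_sum fun s _ => ?_)
    refine (abs_add_le _ _).trans ?_
    rw [mul_add]
    have hs := mul_pos hk (hpos s)
    refine add_le_add (key _ _ _ _ (hB s) ?_) (key _ _ _ _ (by rw [abs_neg]; exact hB s) ?_)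
    · rw [abs_of_pos (Real.exp_pos _), Real.exp_le_exp]; nlinarith
    · rw [abs_of_pos (Real.exp_pos _), Real.exp_le_one_iff]; nlinarith
  · rw [modeJet_of_neg h]
    refine le_trans ?_ (le_add_of_nonneg_left n1)
    rw [Finset.mul_sum]
    refine (Finset.abs_sum_le_sum_abs _ _).trans (Finset.sum_le_sum fun s _ => ?_)
    refine (abs_add_le _ _).trans ?_
    rw [mul_add]
    exact add_le_add (key _ _ _ _ (hB s) (Real.abs_cos_le_one _))
      (key _ _ _ _ (hB s) (Real.abs_sin_le_one _))

theorem abs_sinJet_le (b : ℝ) (i : ℕ) (x : ℝ) : |sinJet b i x| ≤ |b| ^ i := by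
  rw [sinJet, abs_mul, abs_pow]
  exact mul_le_of_le_one_right (by positivity) (Real.abs_sin_le_one _)

theorem abs_sinJet_mul_modeJet_le (hpos : ∀ s, 0 < a s) (k : ℕ+)
    (x : (Fin n ⊕ Fin n) ⊕ (Fin n ⊕ Fin n) → ℝ) {i j M : ℕ} (hij : i + j ≤ M) (x' : ℝ) {y : ℝ}
    (hy : y ≤ 1) :
    |√2 * sinJet (π * k) i x' * modeJet a k x j y| ≤
      √2 * (π * k * (1 + ∑ s, a s)) ^ M * scaledSize a k x := by
  have hk : (1 : ℝ) ≤ π * k := by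
    have : (1 : ℝ) ≤ k := by exact_mod_cast k.pos
    nlinarith [Real.pi_gt_three]
  have hA : 1 ≤ 1 + ∑ s, a s := by
    have := Finset.sum_nonneg fun s (_ : s ∈ Finset.univ) => (hpos s).le
    linarith
  have h1 := abs_modeJet_le hpos k x j hy
  have h2 := abs_sinJet_le (π * k) i x'
  have hle : π * k ≤ π * k * (1 + ∑ s, a s) := le_mul_of_one_le_right (by linarith) hA
  set B := π * k * (1 + ∑ s, a s)
  have h3 := scaledSize_nonneg (a := a) k x
  rw [abs_of_nonneg (by linarith : 0 ≤ π * (k : ℝ))] at h2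
  rw [abs_mul, abs_mul, abs_of_nonneg (sqrt_nonneg 2)]
  have hB0 : 0 ≤ B := by linarith
  calc √2 * |sinJet (π * k) i x'| * |modeJet a k x j y|
      ≤ √2 * B ^ i * (B ^ j * scaledSize a k x) := by
        gcongr
        exact h2.trans (pow_le_pow_left₀ (by linarith) hle _)
    _ = √2 * B ^ (i + j) * scaledSize a k x := by ring
    _ ≤ _ := by gcongr; linarith

theorem sum_abs_dataVector_le (k : ℕ+) (α β : Fin n → ℝ) :
    ∑ j, |dataVector k α β j| ≤ ∑ s, (|α s| + |β s|) := by
  have hk : (1 : ℝ) ≤ π * k := by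
    have : (1 : ℝ) ≤ k := by exact_mod_cast k.pos
    nlinarith [Real.pi_gt_three]
  have key : ∀ (t : ℝ) (m : ℕ), |t / (π * k) ^ m| ≤ |t| := fun t m => by
    rw [abs_div, abs_of_pos (pow_pos (by linarith : 0 < π * (k : ℝ)) m)]
    exact div_le_self (abs_nonneg _) (one_le_pow₀ hk)
  simp only [Fintype.sum_sum_type, dataVector, abs_zero, Finset.sum_const_zero, add_zero, abs_mul,
    abs_pow, abs_neg, abs_one, one_pow, one_mul, Finset.sum_add_distrib]
  exact add_le_add (Finset.sum_le_sum fun s _ => key _ _) (Finset.sum_le_sum fun s _ => key _ _)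

/-- The powers of k balance: 2n from derivatives and at most ⌈γ⌉ from small denominators, against
the decay of the data. This is the majorant for all termwise derivatives. -/
theorem summable_scaledSize (hpos : ∀ s, 0 < a s) (ha : Function.Injective a) {γ : ℝ}
    (h : SmallDenominatorBound a γ) {φ ψ : Fin n → ℝ → ℝ}
    (hφ : ∀ s, IsAdmissibleDatum (dataOrder n γ) (φ s))
    (hψ : ∀ s, IsAdmissibleDatum (dataOrder n γ) (ψ s))
    {x : ℕ+ → (Fin n ⊕ Fin n) ⊕ (Fin n ⊕ Fin n) → ℝ}
    (hx : ∀ k, (mainMatrix a k).mulVec (x k) =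
      dataVector k (fun s => sineCoeff (φ s) k) (fun s => sineCoeff (ψ s) k)) :
    Summable fun k : ℕ+ => √2 * (π * k * (1 + ∑ s, a s)) ^ (2 * n) * scaledSize a k (x k) := by
  obtain ⟨C, hC⟩ := h.eventually_bound hpos ha
  have hord : dataOrder n γ = (2 * n + ⌈γ⌉₊) + 1 := by rw [dataOrder]; ring
  rw [hord] at hφ hψ
  have hs : Summable fun k : ℕ+ => ∑ s, ((k : ℝ) ^ (2 * n + ⌈γ⌉₊) * |sineCoeff (φ s) k| +
      (k : ℝ) ^ (2 * n + ⌈γ⌉₊) * |sineCoeff (ψ s) k|) :=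
    summable_sum fun s _ =>
      (summable_pow_mul_sineCoeff (hφ s)).add (summable_pow_mul_sineCoeff (hψ s))
  have hA : 0 ≤ ∑ s, a s := Finset.sum_nonneg fun s _ => (hpos s).le
  set A := 1 + ∑ s, a s with hAdef
  have hA1 : 0 ≤ A := by linarith
  set c : ℝ := (Fintype.card ((Fin n ⊕ Fin n) ⊕ (Fin n ⊕ Fin n)) : ℝ) with hc
  -- For the finitely many excluded `k` no bound is available, nor is one needed: any solution of
  -- those systems is allowed.
  refine Summable.of_norm_bounded_eventually (hs.mul_left (√2 * (π * A) ^ (2 * n) * (c * |C|))) ?_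
  filter_upwards [hC] with k hk
  have hk1 : (1 : ℝ) ≤ k := by exact_mod_cast k.pos
  have h1 := hk.2 _ _ (hx k)
  have h2 := sum_abs_dataVector_le k (fun s => sineCoeff (φ s) k) (fun s => sineCoeff (ψ s) k)
  set R := ∑ s, (|sineCoeff (φ s) k| + |sineCoeff (ψ s) k|) with hR
  have hR0 : 0 ≤ R := by positivity
  have hγk : (k : ℝ) ^ γ ≤ (k : ℝ) ^ ⌈γ⌉₊ := by
    rw [← Real.rpow_natCast]
    exact Real.rpow_le_rpow_of_exponent_le hk1 (Nat.le_ceil γ)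
  have h3 : ∀ i, |x k i / columnScale a k i| ≤ |C| * (k : ℝ) ^ ⌈γ⌉₊ * R := fun i =>
    (h1 i).trans (by gcongr; exact le_abs_self C)
  have h4 : scaledSize a k (x k) ≤ c * (|C| * (k : ℝ) ^ ⌈γ⌉₊ * R) := by
    have := Finset.sum_le_card_nsmul Finset.univ _ _ fun i _ => h3 i
    rwa [nsmul_eq_mul, Finset.card_univ] at this
  rw [Real.norm_of_nonneg (mul_nonneg (by positivity) (scaledSize_nonneg _ _))]
  calc √2 * (π * k * A) ^ (2 * n) * scaledSize a k (x k)
      ≤ √2 * (π * k * A) ^ (2 * n) * (c * (|C| * (k : ℝ) ^ ⌈γ⌉₊ * R)) := by gcongr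
    _ = √2 * (π * A) ^ (2 * n) * (c * |C|) * ((k : ℝ) ^ (2 * n + ⌈γ⌉₊) * R) := by
        rw [pow_add, mul_pow, mul_pow, mul_pow]; ring
    _ = _ := by rw [hR, Finset.mul_sum]; simp only [mul_add]

end ModeBound

/-! ### The sum of the sine series -/

theorem IsJetOn.iteratedDerivWithin_eq {F : ℕ → ℕ → ℝ → ℝ → ℝ} {I J : Set ℝ} {M : ℕ}
    (h : IsJetOn F I J M) (hI : UniqueDiffOn ℝ I) (hJ : UniqueDiffOn ℝ J) {u : ℝ → ℝ → ℝ}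
    (hu : ∀ x ∈ I, ∀ y ∈ J, u x y = F 0 0 x y) {i j : ℕ} (hij : i + j ≤ M) {x y : ℝ} (hx : x ∈ I)
    (hy : y ∈ J) :
    iteratedDerivWithin i (fun x => iteratedDerivWithin j (fun y => u x y) J y) I x =
      F i j x y :=
  (h.chain_dx j hy).iteratedDerivWithin_eq hI (fun x hx =>
    (h.chain_dy 0 hx).iteratedDerivWithin_eq hJ (fun y hy => hu x hx y hy) j (by omega) hy)
    i (by omega) hx

theorem IsJetOn.iteratedDeriv_eq {F : ℕ → ℕ → ℝ → ℝ → ℝ} {I J : Set ℝ} {M : ℕ}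
    (h : IsJetOn F I J M) (hI : IsOpen I) (hJ : IsOpen J) {u : ℝ → ℝ → ℝ}
    (hu : ∀ x ∈ I, ∀ y ∈ J, u x y = F 0 0 x y) {i j : ℕ} (hij : i + j ≤ M) {x y : ℝ} (hx : x ∈ I)
    (hy : y ∈ J) :
    iteratedDeriv i (fun x => iteratedDeriv j (fun y => u x y) y) x = F i j x y := by
  have e : ∀ x ∈ I, iteratedDeriv j (fun y => u x y) y = F 0 j x y := fun x hx =>
    (h.chain_dy 0 hx).iteratedDeriv_eq hJ (fun y hy => hu x hx y hy) (by omega) hy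
  exact (h.chain_dx j hy).iteratedDeriv_eq hI e (by omega) hx

theorem iteratedDeriv_sin_mul (b : ℝ) (i : ℕ) :
    iteratedDeriv i (fun x => Real.sin (b * x)) = sinJet b i := by
  have h : IsDerivChainOn (sinJet b) univ i := fun j _ y _ =>
    (hasDerivAt_sinJet b j y).hasDerivWithinAt
  funext x
  exact h.iteratedDeriv_eq isOpen_univ (f := fun x => Real.sin (b * x))
    (fun x _ => by simp [sinJet]) le_rfl (mem_univ x)

/-- Every term is a product X(x)Y(y) with explicit derivatives, and one majorant serves all orders
up to 2n. On the closed rectangle only order 2n - 1 is used, because the derivative of order 2n may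
jump at y = 0. -/
theorem sineSeries_isClassicalSolution {n : ℕ} (hn : 1 ≤ n) {a : Fin n → ℝ}
    (hpos : ∀ s, 0 < a s) (ha : Function.Injective a) {γ : ℝ} (h : SmallDenominatorBound a γ)
    {φ ψ : Fin n → ℝ → ℝ} (hφ : ∀ s, IsAdmissibleDatum (dataOrder n γ) (φ s))
    (hψ : ∀ s, IsAdmissibleDatum (dataOrder n γ) (ψ s)) {w : ℕ+ → ℝ → ℝ}
    (hw : ∀ k, IsModeSolution a φ ψ k (w k)) :
    ConvergesTermwise n w ∧ IsClassicalSolution a φ ψ (sineSeries w) := by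
  choose x hx hxo hxc using fun k => (hw k).exists_eq_modeJet hn hpos ha
  have hβ := summable_scaledSize hpos ha h hφ hψ hx
  set β : ℕ+ → ℝ := fun k => √2 * (π * k * (1 + ∑ s, a s)) ^ (2 * n) * scaledSize a k (x k)
  set X : ℕ+ → ℕ → ℝ → ℝ := fun k i x' => √2 * sinJet (π * k) i x' with hX
  set Y : ℕ+ → ℕ → ℝ → ℝ := fun k => modeJet a k (x k) with hY
  have hb : ∀ k i j, i + j ≤ 2 * n → ∀ x' y, y ≤ 1 → |X k i x' * Y k j y| ≤ β k :=
    fun k i j hij x' y hy => abs_sinJet_mul_modeJet_le hpos k (x k) hij x' hy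
  have hXd : ∀ k i x', HasDerivAt (X k i) (X k (i + 1) x') x' := fun k i x' =>
    (hasDerivAt_sinJet _ i x').const_mul _
  have hXch : ∀ k I M, IsDerivChainOn (X k) I M := fun k I M i _ x' _ =>
    (hXd k i x').hasDerivWithinAt
  have hXc : ∀ k i I, ContinuousOn (X k i) I := fun k i I =>
    (continuous_iff_continuousAt.2 fun x' => (hXd k i x').continuousAt).continuousOn
  have hmatch := fun k => (mainMatrix_mulVec_eq_dataVector_iff.1 (hx k)).2.2
  have hu01 : UniqueDiffOn ℝ (Icc (0 : ℝ) 1) := uniqueDiffOn_Icc zero_lt_one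
  have hum := uniqueDiffOn_Icc_neg_one_one
  set F := productSeries X Y with hF
  have hYcl : ∀ k, IsDerivChainOn (Y k) (Icc (-1) 1) (2 * n - 1) := fun k =>
    isDerivChainOn_modeJet_closed (hmatch k) _
  have hYclc : ∀ k, ∀ j ≤ 2 * n - 1, ContinuousOn (Y k j) (Icc (-1) 1) := fun k j hj =>
    (continuous_modeJet (hmatch k j (by omega))).continuousOn
  have hjc : IsJetOn F (Icc 0 1) (Icc (-1) 1) (2 * n - 1) :=
    isJetOn_productSeries (convex_Icc _ _) (convex_Icc _ _) hβ (fun k => hXch k _ _) hYcl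
      fun k i j hij x' _ y hy => hb k i j (by omega) x' y hy.2
  have hFu : ∀ x' y, y ∈ Icc (-1 : ℝ) 1 → sineSeries w x' y = F 0 0 x' y := fun x' y hy => by
    simp only [sineSeries, F, productSeries, ← tsum_mul_left]
    refine tsum_congr fun k => ?_
    have := hxc k 0 (by omega) hy
    rw [iteratedDerivWithin_zero] at this
    simp only [X, Y, ← this, sinJet]
    simp
    ring
  -- the open parts
  have hop : ∀ J : Set ℝ, J = Ioo 0 1 ∨ J = Ioo (-1) 0 → IsJetOn F (Ioo 0 1) J (2 * n) ∧
      ContDiffOn ℝ ((2 * n : ℕ) : WithTop ℕ∞) (Function.uncurry (sineSeries w)) (Ioo 0 1 ×ˢ J) ∧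
      IsOpen J ∧ J ⊆ Icc (-1) 1 ∧ J ⊆ Ioo 0 1 ∪ Ioo (-1) 0 := by
    intro J hJ
    have hJo : IsOpen J := by rcases hJ with rfl | rfl <;> exact isOpen_Ioo
    have hJc : Convex ℝ J := by rcases hJ with rfl | rfl <;> exact convex_Ioo _ _
    have hJs : J ⊆ Icc (-1) 1 := by
      rcases hJ with rfl | rfl
      · exact fun y hy => ⟨by linarith [hy.1], hy.2.le⟩
      · exact fun y hy => ⟨hy.1.le, by linarith [hy.2]⟩
    have hJu : J ⊆ Ioo 0 1 ∪ Ioo (-1) 0 := by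
      rcases hJ with rfl | rfl
      · exact subset_union_left
      · exact subset_union_right
    have hYch : ∀ k M, IsDerivChainOn (Y k) J M := fun k M =>
      (isDerivChainOn_modeJet M).mono hJu le_rfl
    have hb' : ∀ k i j, i + j ≤ 2 * n → ∀ x' ∈ Ioo (0 : ℝ) 1, ∀ y ∈ J, |X k i x' * Y k j y| ≤ β k :=
      fun k i j hij x' _ y hy => hb k i j hij x' y (hJs hy).2
    refine ⟨isJetOn_productSeries (convex_Ioo _ _) hJc hβ (fun k => hXch k _ _) (fun k => hYch k _)
      hb', ?_, hJo, hJs, hJu⟩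
    have := contDiffOn_productSeries (convex_Ioo (0 : ℝ) 1) hJc isOpen_Ioo.uniqueDiffOn
      hJo.uniqueDiffOn hβ (fun k i => hXc k i _)
      (fun k j _ y hy => (hYch k (j + 1) j (by omega) y hy).continuousWithinAt)
      (fun k => hXch k _ _) (fun k => hYch k _) hb' (2 * n) 0 0 (by omega)
    exact this.congr fun p hp => hFu _ _ (hJs hp.2)
  obtain ⟨hjp, hcp, hop', hps, hpu⟩ := hop _ (Or.inl rfl)
  obtain ⟨hjm, hcm, hom', hms, hmu⟩ := hop _ (Or.inr rfl)
  have hsin0 : ∀ k : ℕ+, ∀ s : ℕ, X k (2 * s) 0 = 0 := fun k s => by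
    simp [X, sinJet_two_mul]
  have hsin1 : ∀ k : ℕ+, ∀ s : ℕ, X k (2 * s) 1 = 0 := fun k s => by
    simp only [X, sinJet_two_mul, mul_one]
    rw [mul_comm π, Real.sin_nat_mul_pi]; simp
  -- At y = ±1 the differentiated series becomes the sine series of the datum, which sums to it
  -- since the datum vanishes at both ends.
  have hdata : ∀ (f : ℝ → ℝ) (s : ℕ) (y : ℝ), IsAdmissibleDatum (dataOrder n γ) f →
      (∀ k, Y k (2 * s) y = sineCoeff f k) → ∀ x' ∈ Icc (0 : ℝ) 1, F 0 (2 * s) x' y = f x' := by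
    intro f s y hf hfy x' hx'
    have hf' : IsAdmissibleDatum ((2 * n + ⌈γ⌉₊) + 1) f := by
      rwa [show (2 * n + ⌈γ⌉₊) + 1 = dataOrder n γ by rw [dataOrder]; ring]
    have hb := IsAdmissibleDatum.boundary_eq_zero hf'
    have hs : Summable fun k : ℕ+ => |sineCoeff f k| :=
      (summable_pow_mul_sineCoeff hf').of_nonneg_of_le (fun k => abs_nonneg _) fun k =>
        le_mul_of_one_le_left (abs_nonneg _) (one_le_pow₀ (by exact_mod_cast k.pos))
    rw [← (hasSum_sineCoeff_mul_sin hf.contDiffOn.continuousOn hb.1 hb.2 hs hx').tsum_eq]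
    refine tsum_congr fun k => ?_
    rw [hfy k]
    simp only [X, sinJet]
    simp
    ring
  have hclosed : ∀ (i j : ℕ), i + j ≤ 2 * n - 1 → ∀ p ∈ omegaClosure, ∀ k : ℕ+,
      √2 * (iteratedDerivWithin j (w k) (Icc (-1) 1) p.2
          * iteratedDeriv i (fun x : ℝ => Real.sin (π * k * x)) p.1) = X k i p.1 * Y k j p.2 := by
    intro i j hij p hp k
    rw [hxc k j (by omega) hp.2, iteratedDeriv_sin_mul]
    simp only [X, Y]; ring
  have hopen : ∀ (i j : ℕ), i + j ≤ 2 * n → ∀ p ∈ omegaPlus ∪ omegaMinus, ∀ k : ℕ+,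
      √2 * (iteratedDeriv j (w k) p.2
          * iteratedDeriv i (fun x : ℝ => Real.sin (π * k * x)) p.1) = X k i p.1 * Y k j p.2 := by
    intro i j hij p hp k
    rw [hxo k j (by omega) (hp.imp (fun h => h.2) (fun h => h.2)), iteratedDeriv_sin_mul]
    simp only [X, Y]; ring
  -- The operator may be applied term by term; two x-derivatives of the sine give -(πk)², which
  -- turns each term into the mode equation.
  have heq : ∀ (σ : ℝ) (x' y : ℝ), y ≤ 1 →
      (∀ k, modeSymbol k σ (List.ofFn a) (fun j => Y k j y) = 0) →
      shiftProduct σ (List.ofFn a) (fun p q => F (2 * p) (2 * q) x' y) = 0 := by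
    intro σ x' y hy hz
    have hs := shiftProduct_hasSum σ (List.ofFn a)
      (G := fun k p q => X k (2 * p) x' * Y k (2 * q) y)
      (H := fun p q => F (2 * p) (2 * q) x' y) fun p q hpq => by
        refine (Summable.of_norm_bounded hβ fun k => hb k _ _ ?_ x' y hy).hasSum
        rw [List.length_ofFn] at hpq; omega
    rw [← hs.tsum_eq]
    refine (tsum_congr fun k => ?_).trans tsum_zero
    have h1 : (fun p q => X k (2 * p) x' * Y k (2 * q) y) = fun p q =>
        (√2 * Real.sin (π * k * x')) * ((-(π * k) ^ 2) ^ p * Y k (2 * q) y) := by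
      funext p q
      simp only [X, sinJet_two_mul]; ring
    rw [h1, shiftProduct_smul]
    have h2 := hz k
    rw [modeSymbol] at h2
    rw [h2, mul_zero]
  refine ⟨⟨fun i j hij => ?_, fun i j hij => ?_⟩, ?_, ?_, ?_, ?_, ?_, ?_, ?_⟩
  · refine (HasSumUniformlyOn.of_norm_le_summable hβ fun k p hp => ?_).congr_right fun p hp => ?_
    · rw [hclosed i j hij p hp k]
      exact hb k i j (by omega) _ _ hp.2.2
    · rw [hjc.iteratedDerivWithin_eq hu01 hum (fun x' _ y hy => hFu x' y hy) hij hp.1 hp.2]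
      exact tsum_congr fun k => hclosed i j hij p hp k
  · refine (HasSumUniformlyOn.of_norm_le_summable hβ fun k p hp => ?_).congr_right fun p hp => ?_
    · rw [hopen i j hij p hp k]
      refine hb k i j hij _ _ ?_
      rcases hp with hp | hp
      exacts [(hps hp.2).2, (hms hp.2).2]
    · refine (tsum_congr fun k => hopen i j hij p hp k).trans ?_
      rcases hp with hp | hp
      · exact (hjp.iteratedDeriv_eq isOpen_Ioo isOpen_Ioo
          (fun x' _ y hy => hFu x' y (hps hy)) hij hp.1 hp.2).symm
      · exact (hjm.iteratedDeriv_eq isOpen_Ioo isOpen_Ioo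
          (fun x' _ y hy => hFu x' y (hms hy)) hij hp.1 hp.2).symm
  · have := contDiffOn_productSeries (convex_Icc (0 : ℝ) 1) (convex_Icc (-1 : ℝ) 1) hu01 hum hβ
      (fun k i => hXc k i _) hYclc (fun k => hXch k _ _) hYcl
      (fun k i j hij x' _ y hy => hb k i j (by omega) x' y hy.2) (2 * n - 1) 0 0 (by omega)
    exact this.congr fun p hp => hFu _ _ hp.2
  · exact hcp.union_of_isOpen hcm (isOpen_Ioo.prod isOpen_Ioo) (isOpen_Ioo.prod isOpen_Ioo)
  · rintro x' y (hp | hp)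
    · rw [operatorL, foldr_factorOp_eq isOpen_Ioo isOpen_Ioo hjp (σ := 1)
        (fun y hy => Real.sign_of_pos hy.1) (fun x' _ y hy => hFu x' y (hps hy)) _ (by simp)
        x' hp.1 y hp.2]
      exact heq 1 x' y (hps hp.2).2 fun k => modeSymbol_modeJet_of_pos hp.2.1
    · rw [operatorL, foldr_factorOp_eq isOpen_Ioo isOpen_Ioo hjm (σ := -1)
        (fun y hy => Real.sign_of_neg hy.2) (fun x' _ y hy => hFu x' y (hms hy)) _ (by simp)
        x' hp.1 y hp.2]
      exact heq (-1) x' y (hms hp.2).2 fun k => modeSymbol_modeJet_of_neg hp.2.2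
  · intro s y hy
    rw [(hjc.chain_dx 0 hy).iteratedDerivWithin_eq hu01 (fun x' _ => hFu x' y hy) (2 * s)
      (by omega) (left_mem_Icc.2 zero_le_one)]
    refine (tsum_congr fun k => ?_).trans tsum_zero
    rw [hsin0, zero_mul]
  · intro s y hy
    rw [(hjc.chain_dx 0 hy).iteratedDerivWithin_eq hu01 (fun x' _ => hFu x' y hy) (2 * s)
      (by omega) (right_mem_Icc.2 zero_le_one)]
    refine (tsum_congr fun k => ?_).trans tsum_zero
    rw [hsin1, zero_mul]
  · intro s x' hx'
    have h1 : (1 : ℝ) ∈ Icc (-1 : ℝ) 1 := by norm_num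
    rw [(hjc.chain_dy 0 hx').iteratedDerivWithin_eq hum (fun y hy => hFu x' y hy) (2 * s)
      (by omega) h1]
    exact hdata _ _ _ (hφ s) (fun k => by rw [← (hw k).top s, hxc k (2 * s) (by omega) h1]) x' hx'
  · intro s x' hx'
    have h1 : (-1 : ℝ) ∈ Icc (-1 : ℝ) 1 := by norm_num
    rw [(hjc.chain_dy 0 hx').iteratedDerivWithin_eq hum (fun y hy => hFu x' y hy) (2 * s)
      (by omega) h1]
    exact hdata _ _ _ (hψ s) (fun k => by rw [← (hw k).bottom s, hxc k (2 * s) (by omega) h1]) x' hx'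

/-! ### Partial derivatives of functions of two variables -/

/-- The derivative within `S` in the direction `v`. -/
noncomputable def dirDeriv (S : Set (ℝ × ℝ)) (v : ℝ × ℝ) (g : ℝ × ℝ → ℝ) (p : ℝ × ℝ) : ℝ :=
  fderivWithin ℝ g S p v

section DirDeriv

variable {S : Set (ℝ × ℝ)} {g h : ℝ × ℝ → ℝ}

theorem ContDiffOn.dirDeriv (hS : UniqueDiffOn ℝ S) {m : ℕ} (hg : ContDiffOn ℝ (m + 1 : ℕ) g S)
    (v : ℝ × ℝ) : ContDiffOn ℝ m (dirDeriv S v g) S :=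
  (hg.fderivWithin hS (m := m) (by norm_cast)).clm_apply contDiffOn_const

theorem ContDiffOn.iterate_dirDeriv (hS : UniqueDiffOn ℝ S) (v : ℝ × ℝ) (i : ℕ) :
    ∀ {m : ℕ}, ContDiffOn ℝ (i + m : ℕ) g S → ContDiffOn ℝ m ((_root_.dirDeriv S v)^[i] g) S := by
  induction i with
  | zero => intro m hg; simpa using hg
  | succ i ih =>
    intro m hg
    rw [Function.iterate_succ_apply']
    exact ContDiffOn.dirDeriv hS (ih (by rwa [show i + (m + 1) = i + 1 + m by ring])) v

theorem eqOn_dirDeriv (h' : EqOn g h S) (v : ℝ × ℝ) : EqOn (dirDeriv S v g) (dirDeriv S v h) S :=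
  fun p hp => by rw [dirDeriv, dirDeriv, fderivWithin_congr h' (h' hp)]

/-- Symmetry of the second derivative holds up to the boundary when the set lies in the closure of
its interior. -/
theorem dirDeriv_comm (hS : UniqueDiffOn ℝ S) (hcl : S ⊆ closure (interior S))
    (hg : ContDiffOn ℝ (2 : ℕ) g S) (v w : ℝ × ℝ) :
    EqOn (dirDeriv S v (dirDeriv S w g)) (dirDeriv S w (dirDeriv S v g)) S := by
  intro p hp
  have hd : DifferentiableWithinAt ℝ (fderivWithin ℝ g S) S p :=
    (hg.fderivWithin hS (m := 1) (by norm_cast)).differentiableOn one_ne_zero p hp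
  have key : ∀ v w : ℝ × ℝ, dirDeriv S v (dirDeriv S w g) p =
      fderivWithin ℝ (fderivWithin ℝ g S) S p v w := by
    intro v w
    have h1 := hd.hasFDerivWithinAt.clm_apply (hasFDerivWithinAt_const w p S)
    have h2 : fderivWithin ℝ (dirDeriv S w g) S p = _ := h1.fderivWithin (hS p hp)
    rw [dirDeriv, h2]
    simp
  rw [key, key]
  exact ((hg p hp).isSymmSndFDerivWithinAt (by simp) hS (hcl hp) hp).eq v w

theorem dirDeriv_iterate_comm (hS : UniqueDiffOn ℝ S) (hcl : S ⊆ closure (interior S))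
    (v w : ℝ × ℝ) (i : ℕ) (hg : ContDiffOn ℝ (i + 1 : ℕ) g S) :
    EqOn (dirDeriv S v ((dirDeriv S w)^[i] g)) ((dirDeriv S w)^[i] (dirDeriv S v g)) S := by
  induction i with
  | zero => exact eqOn_refl _ _
  | succ i ih =>
    rw [Function.iterate_succ_apply', Function.iterate_succ_apply']
    exact (dirDeriv_comm hS hcl (ContDiffOn.iterate_dirDeriv hS w i hg) v w).trans
      (eqOn_dirDeriv (ih (hg.of_le (by exact_mod_cast Nat.le_succ _))) w)

/-- A function of class `C^M` on a product has a jet of continuous partial derivatives. -/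
theorem exists_isJetOn {I J : Set ℝ} (hI : UniqueDiffOn ℝ I) (hJ : UniqueDiffOn ℝ J)
    (hcl : I ×ˢ J ⊆ closure (interior (I ×ˢ J))) {M : ℕ} {u : ℝ → ℝ → ℝ}
    (hu : ContDiffOn ℝ M (Function.uncurry u) (I ×ˢ J)) :
    ∃ F : ℕ → ℕ → ℝ → ℝ → ℝ, IsJetOn F I J M ∧
      (∀ i j, i + j ≤ M → ContinuousOn (Function.uncurry (F i j)) (I ×ˢ J)) ∧ F 0 0 = u := by
  have hS : UniqueDiffOn ℝ (I ×ˢ J) := hI.prod hJ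
  set S := I ×ˢ J
  let Φ : ℕ → ℕ → ℝ × ℝ → ℝ := fun i j =>
    (dirDeriv S (1, 0))^[i] ((dirDeriv S (0, 1))^[j] (Function.uncurry u))
  have hy : ∀ j m, j + m ≤ M →
      ContDiffOn ℝ m ((dirDeriv S (0, 1))^[j] (Function.uncurry u)) S := fun j m h =>
    ContDiffOn.iterate_dirDeriv hS _ _ (hu.of_le (by exact_mod_cast h))
  have hΦ : ∀ i j m, i + j + m ≤ M → ContDiffOn ℝ m (Φ i j) S := fun i j m h =>
    ContDiffOn.iterate_dirDeriv hS _ _ (hy j (i + m) (by omega))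
  have hdiff : ∀ i j, i + j < M → ∀ p ∈ S, HasFDerivWithinAt (Φ i j)
      (fderivWithin ℝ (Φ i j) S p) S p := fun i j h p hp =>
    ((hΦ i j 1 h).differentiableOn (by simp) p hp).hasFDerivWithinAt
  refine ⟨fun i j x y => Φ i j (x, y), ⟨fun i j h x hx y hy' => ?_, fun i j h x hx y hy' => ?_⟩,
    fun i j h => ?_, rfl⟩
  · have h1 : HasDerivWithinAt (fun x : ℝ => (x, y)) ((1 : ℝ), (0 : ℝ)) I x :=
      (hasDerivWithinAt_id x I).prodMk (hasDerivWithinAt_const x I y)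
    have h2 := (hdiff i j h (x, y) ⟨hx, hy'⟩).comp_hasDerivWithinAt x h1
      (fun x' hx' => (⟨hx', hy'⟩ : (x', y) ∈ I ×ˢ J))
    refine h2.congr_deriv ?_
    simp only [Φ, Function.iterate_succ_apply']
    rfl
  · have h1 : HasDerivWithinAt (fun y : ℝ => (x, y)) ((0 : ℝ), (1 : ℝ)) J y :=
      (hasDerivWithinAt_const y J x).prodMk (hasDerivWithinAt_id y J)
    have h2 := (hdiff i j h (x, y) ⟨hx, hy'⟩).comp_hasDerivWithinAt y h1
      (fun y' hy' => (⟨hx, hy'⟩ : (x, y') ∈ I ×ˢ J))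
    refine h2.congr_deriv ?_
    -- In the jet the x-derivatives are outermost, so a new y-derivative has to be moved inside past
    -- them.
    simp only [Φ, Function.iterate_succ_apply' _ j]
    exact dirDeriv_iterate_comm hS hcl (0, 1) (1, 0) i (hy j (i + 1) (by omega)) ⟨hx, hy'⟩
  · exact (hΦ i j 0 (by omega)).continuousOn

end DirDeriv

theorem Icc_prod_subset_closure_interior {a b c d : ℝ} (hab : a < b) (hcd : c < d) :
    Icc a b ×ˢ Icc c d ⊆ closure (interior (Icc a b ×ˢ Icc c d)) := by
  rw [interior_prod_eq, interior_Icc, interior_Icc, closure_prod_eq, closure_Ioo hab.ne,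
    closure_Ioo hcd.ne]

theorem IsOpen.subset_closure_interior {X : Type*} [TopologicalSpace X] {s : Set X}
    (hs : IsOpen s) : s ⊆ closure (interior s) := by
  rw [hs.interior_eq]; exact subset_closure

theorem IsJetOn.mono {F : ℕ → ℕ → ℝ → ℝ → ℝ} {I J I' J' : Set ℝ} {M N : ℕ} (h : IsJetOn F I J M)
    (hI : I' ⊆ I) (hJ : J' ⊆ J) (hN : N ≤ M) : IsJetOn F I' J' N where
  dx i j hij x hx y hy := (h.dx i j (hij.trans_le hN) x (hI hx) y (hJ hy)).mono hI
  dy i j hij x hx y hy := (h.dy i j (hij.trans_le hN) x (hI hx) y (hJ hy)).mono hJ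

theorem IsJetOn.eq_of_isOpen {F G : ℕ → ℕ → ℝ → ℝ → ℝ} {I J : Set ℝ} {M : ℕ}
    (hF : IsJetOn F I J M) (hG : IsJetOn G I J M) (hI : IsOpen I) (hJ : IsOpen J)
    (h : ∀ x ∈ I, ∀ y ∈ J, F 0 0 x y = G 0 0 x y) {i j : ℕ} (hij : i + j ≤ M) {x y : ℝ}
    (hx : x ∈ I) (hy : y ∈ J) : F i j x y = G i j x y :=
  (hF.iteratedDeriv_eq hI hJ (fun _ _ _ _ => rfl) hij hx hy).symm.trans
    (hG.iteratedDeriv_eq hI hJ h hij hx hy)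

/-- The parts of the domain: `y > 0` with sign `1` and `y < 0` with sign `-1`. -/
structure IsHalf (J : Set ℝ) (σ : ℝ) : Prop where
  isOpen : IsOpen J
  subset : J ⊆ Icc (-1) 1
  sign : ∀ y ∈ J, Real.sign y = σ
  ordConnected : J.OrdConnected
  ne_zero : σ ≠ 0
  prod_subset : Ioo 0 1 ×ˢ J ⊆ omegaPlus ∪ omegaMinus

theorem isHalf_upper : IsHalf (Ioo 0 1) 1 :=
  ⟨isOpen_Ioo, fun y hy => ⟨by linarith [hy.1], hy.2.le⟩, fun _ hy => Real.sign_of_pos hy.1,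
    ordConnected_Ioo, one_ne_zero, subset_union_left⟩

theorem isHalf_lower : IsHalf (Ioo (-1) 0) (-1) :=
  ⟨isOpen_Ioo, fun y hy => ⟨hy.1.le, by linarith [hy.2]⟩, fun _ hy => Real.sign_of_neg hy.2,
    ordConnected_Ioo, by norm_num, subset_union_right⟩

theorem mem_parts_iff {x y : ℝ} : (x, y) ∈ omegaPlus ∪ omegaMinus →
    ∃ J σ, IsHalf J σ ∧ x ∈ Ioo 0 1 ∧ y ∈ J := by
  rintro (h | h)
  exacts [⟨_, _, isHalf_upper, h.1, h.2⟩, ⟨_, _, isHalf_lower, h.1, h.2⟩]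

section Jets

variable {n : ℕ} {a : Fin n → ℝ} {φ ψ φ' ψ' : Fin n → ℝ → ℝ} {u v : ℝ → ℝ → ℝ}

theorem DirichletProblem.IsClassicalSolution.exists_isJetOn_closure
    (h : IsClassicalSolution a φ ψ u) :
    ∃ F : ℕ → ℕ → ℝ → ℝ → ℝ, IsJetOn F (Icc 0 1) (Icc (-1) 1) (2 * n - 1) ∧
      (∀ i j, i + j ≤ 2 * n - 1 →
        ContinuousOn (Function.uncurry (F i j)) (Icc 0 1 ×ˢ Icc (-1) 1)) ∧ F 0 0 = u :=
  exists_isJetOn (uniqueDiffOn_Icc zero_lt_one) uniqueDiffOn_Icc_neg_one_one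
    (Icc_prod_subset_closure_interior zero_lt_one (by norm_num)) h.contDiffOn_closure

theorem DirichletProblem.IsClassicalSolution.exists_isJetOn_half
    (h : IsClassicalSolution a φ ψ u) {J : Set ℝ} {σ : ℝ} (hJ : IsHalf J σ) :
    ∃ G : ℕ → ℕ → ℝ → ℝ → ℝ, IsJetOn G (Ioo 0 1) J (2 * n) ∧
      (∀ i j, i + j ≤ 2 * n → ContinuousOn (Function.uncurry (G i j)) (Ioo 0 1 ×ˢ J)) ∧
      G 0 0 = u ∧ ∀ x ∈ Ioo (0 : ℝ) 1, ∀ y ∈ J,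
        shiftProduct σ (List.ofFn a) (fun p q => G (2 * p) (2 * q) x y) = 0 := by
  obtain ⟨G, h1, h2, h3⟩ := exists_isJetOn isOpen_Ioo.uniqueDiffOn hJ.isOpen.uniqueDiffOn
    (isOpen_Ioo.prod hJ.isOpen).subset_closure_interior (h.contDiffOn_parts.mono hJ.prod_subset)
  refine ⟨G, h1, h2, h3, fun x hx y hy => ?_⟩
  rw [← foldr_factorOp_eq isOpen_Ioo hJ.isOpen h1 hJ.sign (fun x _ y _ => by rw [h3])
    (List.ofFn a) (by simp) x hx y hy]
  exact h.equation x y (hJ.prod_subset ⟨hx, hy⟩)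

theorem iteratedDerivWithin_add_const_mul {f g : ℝ → ℝ} {s : Set ℝ} {M m : ℕ}
    (hs : UniqueDiffOn ℝ s) (hf : ContDiffOn ℝ M f s) (hg : ContDiffOn ℝ M g s) (hm : m ≤ M)
    (c : ℝ) {y : ℝ} (hy : y ∈ s) : iteratedDerivWithin m (fun y => f y + c * g y) s y =
      iteratedDerivWithin m f s y + c * iteratedDerivWithin m g s y := by
  have hf' := hf.isDerivChainOn hs
  have hg' := hg.isDerivChainOn hs
  have : IsDerivChainOn (fun j y => iteratedDerivWithin j f s y + c * iteratedDerivWithin j g s y)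
      s M := fun j hj y hy => (hf' j hj y hy).add ((hg' j hj y hy).const_mul c)
  exact this.iteratedDerivWithin_eq hs (fun y _ => by simp) m hm hy

/-- The classical solutions depend linearly on the data. -/
theorem DirichletProblem.IsClassicalSolution.add_const_mul (hu : IsClassicalSolution a φ ψ u)
    (hv : IsClassicalSolution a φ' ψ' v) (c : ℝ) :
    IsClassicalSolution a (fun s x => φ s x + c * φ' s x) (fun s x => ψ s x + c * ψ' s x)
      (fun x y => u x y + c * v x y) := by
  have hI : UniqueDiffOn ℝ (Icc (0 : ℝ) 1) := uniqueDiffOn_Icc zero_lt_one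
  have hJ := uniqueDiffOn_Icc_neg_one_one
  have hx : ∀ {w : ℝ → ℝ → ℝ} {φ ψ : Fin n → ℝ → ℝ}, IsClassicalSolution a φ ψ w →
      ∀ y ∈ Icc (-1 : ℝ) 1,
        ContDiffOn ℝ ((2 * n - 1 : ℕ) : WithTop ℕ∞) (fun x => w x y) (Icc 0 1) :=
    fun h y hy => h.contDiffOn_closure.comp (f := fun x : ℝ => (x, y))
      (contDiff_prodMk_left y).contDiffOn fun x hx => ⟨hx, hy⟩
  have hy : ∀ {w : ℝ → ℝ → ℝ} {φ ψ : Fin n → ℝ → ℝ}, IsClassicalSolution a φ ψ w →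
      ∀ x ∈ Icc (0 : ℝ) 1,
        ContDiffOn ℝ ((2 * n - 1 : ℕ) : WithTop ℕ∞) (fun y => w x y) (Icc (-1) 1) :=
    fun h x hx => h.contDiffOn_closure.comp (f := fun y : ℝ => (x, y))
      (contDiff_prodMk_right x).contDiffOn fun y hy => ⟨hx, hy⟩
  refine ⟨hu.contDiffOn_closure.add (contDiffOn_const.mul hv.contDiffOn_closure),
    hu.contDiffOn_parts.add (contDiffOn_const.mul hv.contDiffOn_parts), fun x y hxy => ?_,
    fun s y hy' => ?_, fun s y hy' => ?_, fun s x hx' => ?_, fun s x hx' => ?_⟩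
  · obtain ⟨J, σ, hJ, hx, hy⟩ := mem_parts_iff hxy
    obtain ⟨F, hF, -, rfl, eF⟩ := hu.exists_isJetOn_half hJ
    obtain ⟨G, hG, -, rfl, eG⟩ := hv.exists_isJetOn_half hJ
    have hH : IsJetOn (fun i j x y => F i j x y + c * G i j x y) (Ioo 0 1) J (2 * n) :=
      ⟨fun i j h x hx y hy => (hF.dx i j h x hx y hy).add ((hG.dx i j h x hx y hy).const_mul c),
        fun i j h x hx y hy => (hF.dy i j h x hx y hy).add ((hG.dy i j h x hx y hy).const_mul c)⟩
    rw [operatorL, foldr_factorOp_eq isOpen_Ioo hJ.isOpen hH hJ.sign (fun _ _ _ _ => rfl)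
      (List.ofFn a) (by simp) x hx y hy]
    have := shiftProduct_lin σ (List.ofFn a) 1 c (fun p q => F (2 * p) (2 * q) x y)
      (fun p q => G (2 * p) (2 * q) x y)
    simpa [eF x hx y hy, eG x hx y hy] using this
  · rw [iteratedDerivWithin_add_const_mul hI (hx hu y hy') (hx hv y hy') (by omega) c
      (left_mem_Icc.2 zero_le_one), hu.left s y hy', hv.left s y hy', mul_zero, add_zero]
  · rw [iteratedDerivWithin_add_const_mul hI (hx hu y hy') (hx hv y hy') (by omega) c
      (right_mem_Icc.2 zero_le_one), hu.right s y hy', hv.right s y hy', mul_zero, add_zero]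
  · rw [iteratedDerivWithin_add_const_mul hJ (hy hu x hx') (hy hv x hx') (by omega) c
      (by norm_num), hu.top s x hx', hv.top s x hx']
  · rw [iteratedDerivWithin_add_const_mul hJ (hy hu x hx') (hy hv x hx') (by omega) c
      (by norm_num), hu.bottom s x hx', hv.bottom s x hx']

end Jets

/-! ### Integrals depending on a parameter -/

section Parametric

variable {a b c d : ℝ} {g g' : ℝ → ℝ → ℝ}

/-- Composing with the projections onto the two intervals makes results for globally continuous
integrands applicable. -/
theorem exists_continuous_extension (hab : a ≤ b) (hcd : c ≤ d)
    (hg : ContinuousOn (Function.uncurry g) (Icc a b ×ˢ Icc c d)) :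
    ∃ G : ℝ → ℝ → ℝ, Continuous (Function.uncurry G) ∧
      ∀ x ∈ Icc a b, ∀ y ∈ Icc c d, G x y = g x y := by
  refine ⟨fun x y => g (projIcc a b hab x) (projIcc c d hcd y), ?_, fun x hx y hy => ?_⟩
  · have h1 : Continuous fun p : ℝ × ℝ =>
        ((projIcc a b hab p.1 : ℝ), (projIcc c d hcd p.2 : ℝ)) := by fun_prop
    exact hg.comp_continuous h1 fun p => ⟨(projIcc a b hab p.1).2, (projIcc c d hcd p.2).2⟩
  · simp only [projIcc_of_mem hab hx, projIcc_of_mem hcd hy]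

theorem continuousOn_intervalIntegral_prod (hab : a ≤ b) (hcd : c ≤ d)
    (hg : ContinuousOn (Function.uncurry g) (Icc a b ×ˢ Icc c d)) :
    ContinuousOn (fun y => ∫ x in a..b, g x y) (Icc c d) := by
  obtain ⟨G, hG, hGg⟩ := exists_continuous_extension hab hcd hg
  have h1 : Continuous fun y => ∫ x in a..b, G x y :=
    intervalIntegral.continuous_parametric_intervalIntegral_of_continuous'
      (f := fun y x => G x y) (hG.comp continuous_swap) a b
  refine h1.continuousOn.congr fun y hy => intervalIntegral.integral_congr fun x hx => ?_
  rw [uIcc_of_le hab] at hx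
  exact (hGg x hx y hy).symm

theorem intervalIntegral_swap_of_continuousOn (hab : a ≤ b) (hcd : c ≤ d)
    (hg : ContinuousOn (Function.uncurry g) (Icc a b ×ˢ Icc c d)) :
    ∫ x in a..b, ∫ y in c..d, g x y = ∫ y in c..d, ∫ x in a..b, g x y := by
  refine MeasureTheory.intervalIntegral_intervalIntegral_swap ?_
  rw [uIoc_of_le hab, uIoc_of_le hcd]
  exact (hg.integrableOn_compact (isCompact_Icc.prod isCompact_Icc)).mono_set
    (prod_mono Ioc_subset_Icc_self Ioc_subset_Icc_self)

/-- The fundamental theorem followed by Fubini: an integrated substitute for differentiation under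
the integral sign. -/
theorem integral_sub_mul_eq (hab : a ≤ b) (hcd : c ≤ d)
    (hg' : ContinuousOn (Function.uncurry g') (Icc a b ×ˢ Icc c d))
    (hd : ∀ x ∈ Icc a b, ∀ y ∈ Icc c d,
      HasDerivWithinAt (fun y => g x y) (g' x y) (Icc c d) y) {s : ℝ → ℝ} (hs : Continuous s) :
    ∫ x in a..b, (g x d - g x c) * s x = ∫ y in c..d, ∫ x in a..b, g' x y * s x := by
  rw [← intervalIntegral_swap_of_continuousOn hab hcd (g := fun x y => g' x y * s x)
    (hg'.mul (hs.comp continuous_fst).continuousOn)]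
  refine intervalIntegral.integral_congr fun x hx => ?_
  rw [uIcc_of_le hab] at hx
  simp only [intervalIntegral.integral_mul_const]
  congr 1
  refine (intervalIntegral.integral_eq_sub_of_hasDerivAt_of_le hcd
    (fun y hy => (hd x hx y hy).continuousWithinAt) (fun y hy =>
      (hd x hx y (Ioo_subset_Icc_self hy)).hasDerivAt (Icc_mem_nhds hy.1 hy.2)) ?_).symm
  refine ContinuousOn.intervalIntegrable_of_Icc hcd ?_
  exact hg'.comp (f := fun y : ℝ => (x, y)) (by fun_prop) fun y hy => ⟨hx, hy⟩

theorem sum_integral_sub_eq {ι : Type*} (s : Finset ι) (e : ι → ℝ) {G G' : ι → ℝ → ℝ → ℝ}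
    (hab : a ≤ b) (hcd : c ≤ d)
    (hG : ∀ i ∈ s, ContinuousOn (Function.uncurry (G i)) (Icc a b ×ˢ Icc c d))
    (hG' : ∀ i ∈ s, ContinuousOn (Function.uncurry (G' i)) (Icc a b ×ˢ Icc c d))
    (hd : ∀ i ∈ s, ∀ x ∈ Icc a b, ∀ y ∈ Icc c d,
      HasDerivWithinAt (fun x => G i x y) (G' i x y) (Icc a b) x) :
    (∑ i ∈ s, e i * ∫ y in c..d, G i b y) - ∑ i ∈ s, e i * ∫ y in c..d, G i a y =
      ∫ x in a..b, ∑ i ∈ s, e i * ∫ y in c..d, G' i x y := by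
  have hsw : ∀ {g : ℝ → ℝ → ℝ}, ContinuousOn (Function.uncurry g) (Icc a b ×ˢ Icc c d) →
      ContinuousOn (Function.uncurry fun y x => g x y) (Icc c d ×ˢ Icc a b) := fun h =>
    h.comp continuous_swap.continuousOn fun p hp => ⟨hp.2, hp.1⟩
  have hint : ∀ i ∈ s, ∀ x ∈ Icc a b,
      IntervalIntegrable (fun y => G i x y) MeasureTheory.volume c d := fun i hi x hx =>
    ((hG i hi).comp (f := fun y : ℝ => (x, y)) (by fun_prop)
      fun y hy => ⟨hx, hy⟩).intervalIntegrable_of_Icc hcd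
  rw [intervalIntegral.integral_finsetSum fun i hi =>
    ((continuousOn_intervalIntegral_prod hcd hab (hsw (hG' i hi))).const_mul
      (e i)).intervalIntegrable_of_Icc hab, ← Finset.sum_sub_distrib]
  refine Finset.sum_congr rfl fun i hi => ?_
  rw [intervalIntegral.integral_const_mul, ← mul_sub, ← intervalIntegral.integral_sub
    (hint i hi b (right_mem_Icc.2 hab)) (hint i hi a (left_mem_Icc.2 hab))]
  have := integral_sub_mul_eq hcd hab (hsw (hG' i hi)) (g := fun y x => G i x y)
    (fun y hy x hx => hd i hi x hx y hy) (s := fun _ => 1) continuous_const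
  simp only [mul_one] at this
  rw [this]

/-- Recovers a pointwise derivative from the integrated identities, given continuity of the
candidate. -/
theorem hasDerivAt_of_sub_eq_integral {f f' : ℝ → ℝ} {J : Set ℝ} (hJ : IsOpen J)
    (hf' : ContinuousOn f' J)
    (h : ∀ y₁ ∈ J, ∀ y₂ ∈ J, y₁ ≤ y₂ → f y₂ - f y₁ = ∫ y in y₁..y₂, f' y) {y : ℝ} (hy : y ∈ J) :
    HasDerivAt f (f' y) y := by
  have h1 : HasDerivAt (fun z => f y + ∫ t in y..z, f' t) (f' y) y := by
    have := intervalIntegral.integral_hasDerivAt_right (a := y) (b := y) (f := f')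
      (by simp) (hf'.stronglyMeasurableAtFilter hJ y hy)
      (hf'.continuousAt (hJ.mem_nhds hy))
    exact this.const_add (f y)
  refine h1.congr_of_eventuallyEq ?_
  filter_upwards [hJ.mem_nhds hy] with z hz
  rcases le_total y z with hyz | hyz
  · have := h y hy z hz hyz; linarith
  · have := h z hz y hy hyz
    rw [intervalIntegral.integral_symm]; linarith

end Parametric

/-- Two integrations by parts against `sin (πkx)`. -/
theorem integral_deriv_two_mul_sin {f f' f'' : ℝ → ℝ} (k : ℕ+) (hf : ContinuousOn f (Icc 0 1))
    (hf' : ContinuousOn f' (Icc 0 1)) (hf'' : ContinuousOn f'' (Icc 0 1))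
    (h1 : ∀ x ∈ Ioo (0 : ℝ) 1, HasDerivAt f (f' x) x)
    (h2 : ∀ x ∈ Ioo (0 : ℝ) 1, HasDerivAt f' (f'' x) x) (f0 : f 0 = 0) (f1 : f 1 = 0) :
    ∫ x in (0 : ℝ)..1, f'' x * Real.sin (π * k * x) =
      -(π * k) ^ 2 * ∫ x in (0 : ℝ)..1, f x * Real.sin (π * k * x) := by
  have hu : uIcc (0 : ℝ) 1 = Icc 0 1 := uIcc_of_le zero_le_one
  have hs : ∀ x, HasDerivAt (fun x => Real.sin (π * k * x)) (π * k * Real.cos (π * k * x)) x :=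
    fun x => by
      have := ((hasDerivAt_id x).const_mul (π * k)).sin
      simpa [mul_comm] using this
  have hc : ∀ x, HasDerivAt (fun x => π * k * Real.cos (π * k * x))
      (-(π * k) ^ 2 * Real.sin (π * k * x)) x := fun x => by
      have := (((hasDerivAt_id x).const_mul (π * k)).cos).const_mul (π * k)
      refine this.congr_deriv ?_
      simp; ring
  have e1 := intervalIntegral.integral_mul_deriv_eq_deriv_mul_of_hasDeriv_right
    (a := 0) (b := 1) (u := fun x => Real.sin (π * k * x)) (v := f') (v' := f'')
    (u' := fun x => π * k * Real.cos (π * k * x))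
    (by fun_prop) (by rwa [hu]) (fun x _ => (hs x).hasDerivWithinAt)
    (fun x hx => (h2 x (by simpa using hx)).hasDerivWithinAt)
    (Continuous.intervalIntegrable (by fun_prop) _ _)
    (hf''.intervalIntegrable_of_Icc zero_le_one)
  have e2 := intervalIntegral.integral_mul_deriv_eq_deriv_mul_of_hasDeriv_right
    (a := 0) (b := 1) (u := fun x => π * k * Real.cos (π * k * x)) (v := f) (v' := f')
    (u' := fun x => -(π * k) ^ 2 * Real.sin (π * k * x))
    (by fun_prop) (by rwa [hu]) (fun x _ => (hc x).hasDerivWithinAt)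
    (fun x hx => (h1 x (by simpa using hx)).hasDerivWithinAt)
    (Continuous.intervalIntegrable (by fun_prop) _ _)
    (hf'.intervalIntegrable_of_Icc zero_le_one)
  have s1 : Real.sin (π * k) = 0 := by rw [mul_comm]; exact Real.sin_nat_mul_pi k
  simp only [mul_one, mul_zero, Real.sin_zero, s1, zero_mul, f0, f1, sub_zero] at e1 e2
  have e3 : ∫ x in (0 : ℝ)..1, f'' x * Real.sin (π * k * x) =
      ∫ x in (0 : ℝ)..1, Real.sin (π * k * x) * f'' x := by simp only [mul_comm]
  rw [e3, e1, e2, ← intervalIntegral.integral_const_mul]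
  simp only [zero_sub, neg_neg]
  refine intervalIntegral.integral_congr fun x _ => ?_
  ring

/-! ### The sine coefficients of a classical solution -/

section TopOrder

variable {n : ℕ} {F G : ℕ → ℕ → ℝ → ℝ → ℝ} {J : Set ℝ} {σ : ℝ}

/-- Two integrations by parts replace two x-derivatives by -(πk)², as the even derivatives vanish on
the sides. All derivatives used have order below 2n and are continuous up to the boundary. -/
theorem integral_even_dx_mul_sin (hF : IsJetOn F (Icc 0 1) (Icc (-1) 1) (2 * n - 1))
    (hFc : ∀ i j, i + j ≤ 2 * n - 1 →
      ContinuousOn (Function.uncurry (F i j)) (Icc 0 1 ×ˢ Icc (-1) 1))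
    (hb : ∀ r q, 2 * r + 2 * q ≤ 2 * n - 2 → ∀ y ∈ Icc (-1 : ℝ) 1,
      F (2 * r) (2 * q) 0 y = 0 ∧ F (2 * r) (2 * q) 1 y = 0) (k : ℕ+) {q : ℕ} {y : ℝ}
    (hy : y ∈ Icc (-1 : ℝ) 1) (r : ℕ) (hr : 2 * r + 2 * q ≤ 2 * n - 2) :
    ∫ x in (0 : ℝ)..1, F (2 * r) (2 * q) x y * Real.sin (π * k * x) =
      (-(π * k) ^ 2) ^ r * ∫ x in (0 : ℝ)..1, F 0 (2 * q) x y * Real.sin (π * k * x) := by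
  induction r with
  | zero => simp
  | succ r ih =>
    have hc : ∀ i, i + 2 * q ≤ 2 * n - 1 → ContinuousOn (fun x => F i (2 * q) x y) (Icc 0 1) :=
      fun i hi => (hFc i _ hi).comp (f := fun x : ℝ => (x, y)) (by fun_prop) fun x hx => ⟨hx, hy⟩
    have hd : ∀ i, i + 2 * q < 2 * n - 1 → ∀ x ∈ Ioo (0 : ℝ) 1,
        HasDerivAt (fun x => F i (2 * q) x y) (F (i + 1) (2 * q) x y) x := fun i hi x hx =>
      (hF.dx i _ hi x (Ioo_subset_Icc_self hx) y hy).hasDerivAt (Icc_mem_nhds hx.1 hx.2)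
    have h0 := hb r q (by omega) y hy
    have := integral_deriv_two_mul_sin k (hc (2 * r) (by omega)) (hc (2 * r + 1) (by omega))
      (hc (2 * r + 2) (by omega)) (hd (2 * r) (by omega)) (hd (2 * r + 1) (by omega)) h0.1 h0.2
    rw [show 2 * (r + 1) = 2 * r + 2 by ring, this, ih (by omega)]
    ring

/-- The weak mode equation for the last derivative. Derivatives of order 2n may misbehave near x =
0, 1, so the equation is first integrated in y over [y₁, y₂]. All terms with x-derivatives then form
the second derivative of a function K, and the rest is a difference of derivatives of order 2n - 1.
Thus K'' extends continuously to [0, 1] and can be integrated by parts against the sine. -/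
theorem integral_topDeriv_sub (hn : 1 ≤ n)
    (hF : IsJetOn F (Icc 0 1) (Icc (-1) 1) (2 * n - 1))
    (hFc : ∀ i j, i + j ≤ 2 * n - 1 →
      ContinuousOn (Function.uncurry (F i j)) (Icc 0 1 ×ˢ Icc (-1) 1))
    (hb : ∀ r q, 2 * r + 2 * q ≤ 2 * n - 2 → ∀ y ∈ Icc (-1 : ℝ) 1,
      F (2 * r) (2 * q) 0 y = 0 ∧ F (2 * r) (2 * q) 1 y = 0)
    (hJ : IsHalf J σ) (hG : IsJetOn G (Ioo 0 1) J (2 * n))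
    (hGc : ∀ i j, i + j ≤ 2 * n → ContinuousOn (Function.uncurry (G i j)) (Ioo 0 1 ×ˢ J))
    (hFG : F 0 0 = G 0 0) {e : ℕ → ℝ}
    (he : ∀ x ∈ Ioo (0 : ℝ) 1, ∀ y ∈ J,
      ∑ r ∈ Finset.range n, e (r + 1) * G (2 * (r + 1)) (2 * (n - (r + 1))) x y
        + e 0 * G 0 (2 * n) x y = 0) (k : ℕ+) {y₁ y₂ : ℝ} (h₁ : y₁ ∈ J) (h₂ : y₂ ∈ J)
    (h₁₂ : y₁ ≤ y₂) :
    e 0 * ∫ x in (0 : ℝ)..1, (F 0 (2 * n - 1) x y₂ - F 0 (2 * n - 1) x y₁) *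
        Real.sin (π * k * x) =
      -∑ r ∈ Finset.range n, e (r + 1) * (-(π * k) ^ 2) ^ (r + 1) *
        ∫ y in y₁..y₂, ∫ x in (0 : ℝ)..1,
          F 0 (2 * (n - (r + 1))) x y * Real.sin (π * k * x) := by
  have hsub : Icc y₁ y₂ ⊆ J := hJ.ordConnected.out h₁ h₂
  have hsub' : Icc y₁ y₂ ⊆ Icc (-1) 1 := hsub.trans hJ.subset
  have h01 : Ioo (0 : ℝ) 1 ⊆ Icc 0 1 := Ioo_subset_Icc_self
  have hFGij : ∀ i j, i + j ≤ 2 * n - 1 → ∀ x ∈ Ioo (0 : ℝ) 1, ∀ y ∈ J, F i j x y = G i j x y :=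
    fun i j hij x hx y hy => (hF.mono h01 hJ.subset le_rfl).eq_of_isOpen
      (hG.mono subset_rfl subset_rfl (by omega)) isOpen_Ioo hJ.isOpen
      (fun x _ y _ => by rw [hFG]) hij hx hy
  -- All terms of the equation containing x-derivatives, with two of those removed.
  set K : ℝ → ℝ := fun x => ∑ r ∈ Finset.range n,
    e (r + 1) * ∫ y in y₁..y₂, F (2 * r) (2 * (n - (r + 1))) x y with hK
  set K' : ℝ → ℝ := fun x => ∑ r ∈ Finset.range n,
    e (r + 1) * ∫ y in y₁..y₂, F (2 * r + 1) (2 * (n - (r + 1))) x y with hK'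
  set D : ℝ → ℝ := fun x => F 0 (2 * n - 1) x y₂ - F 0 (2 * n - 1) x y₁ with hD
  have hsw : ∀ i j, i + j ≤ 2 * n - 1 →
      ContinuousOn (Function.uncurry fun y x => F i j x y) (Icc y₁ y₂ ×ˢ Icc 0 1) :=
    fun i j hij => (hFc i j hij).comp continuous_swap.continuousOn
      fun p hp => ⟨hp.2, hsub' hp.1⟩
  have hidx : ∀ r ∈ Finset.range n, 2 * r + 2 * (n - (r + 1)) = 2 * n - 2 := fun r hr => by
    have := Finset.mem_range.1 hr; omega
  have hpar : ∀ i j, i + j ≤ 2 * n - 1 →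
      ContinuousOn (fun x => ∫ y in y₁..y₂, F i j x y) (Icc 0 1) := fun i j hij =>
    continuousOn_intervalIntegral_prod h₁₂ zero_le_one (hsw i j hij)
  have hKc : ContinuousOn K (Icc 0 1) := continuousOn_finsetSum _ fun r hr =>
    (hpar _ _ (by have := hidx r hr; omega)).const_mul _
  have hKc' : ContinuousOn K' (Icc 0 1) := continuousOn_finsetSum _ fun r hr =>
    (hpar _ _ (by have := hidx r hr; omega)).const_mul _
  have hsl : ∀ y ∈ Icc (-1 : ℝ) 1, ContinuousOn (fun x => F 0 (2 * n - 1) x y) (Icc 0 1) :=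
    fun y hy => (hFc 0 (2 * n - 1) (by omega)).comp (f := fun x : ℝ => (x, y)) (by fun_prop)
      fun x hx => ⟨hx, hy⟩
  have hDc : ContinuousOn D (Icc 0 1) := (hsl _ (hJ.subset h₂)).sub (hsl _ (hJ.subset h₁))
  have hdK : ∀ x ∈ Ioo (0 : ℝ) 1, HasDerivAt K (K' x) x := fun x hx => by
    refine hasDerivAt_of_sub_eq_integral isOpen_Ioo (hKc'.mono h01) (fun x₁ hx₁ x₂ hx₂ hx₁₂ => ?_) hx
    have hs : Icc x₁ x₂ ⊆ Icc 0 1 := Icc_subset_Icc hx₁.1.le hx₂.2.le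
    exact sum_integral_sub_eq _ _ hx₁₂ h₁₂
      (fun r hr => (hFc _ _ (by have := hidx r hr; omega)).mono (prod_mono hs hsub'))
      (fun r hr => (hFc _ _ (by have := hidx r hr; omega)).mono (prod_mono hs hsub'))
      fun r hr x hx y hy => (hF.dx _ _ (by have := hidx r hr; omega) x (hs hx) y
        (hsub' hy)).mono hs
  -- Only here does the equation enter; integrating its pure y-term leaves a boundary difference.
  have htop : ∀ x ∈ Ioo (0 : ℝ) 1, ∑ r ∈ Finset.range n,
      e (r + 1) * ∫ y in y₁..y₂, G (2 * r + 1 + 1) (2 * (n - (r + 1))) x y = -e 0 * D x := by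
    intro x hx
    have hGi : ∀ i j, i + j ≤ 2 * n →
        IntervalIntegrable (fun y => G i j x y) MeasureTheory.volume y₁ y₂ := fun i j hij =>
      ((hGc i j hij).comp (f := fun y : ℝ => (x, y)) (by fun_prop)
        fun y hy => ⟨hx, hsub hy⟩).intervalIntegrable_of_Icc h₁₂
    have e1 : ∫ y in y₁..y₂, G 0 (2 * n) x y = D x := by
      have hch := hG.chain_dy 0 hx
      have := intervalIntegral.integral_eq_sub_of_hasDerivAt
        (f := fun y => G 0 (2 * n - 1) x y) (f' := fun y => G 0 (2 * n) x y) (a := y₁) (b := y₂)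
        (fun y hy => by
          rw [uIcc_of_le h₁₂] at hy
          have := hch.hasDerivAt hJ.isOpen (j := 2 * n - 1) (by omega) (hsub hy)
          rwa [show 2 * n - 1 + 1 = 2 * n by omega] at this) (hGi _ _ (by omega))
      rw [this, hD]
      simp only []
      rw [hFGij 0 (2 * n - 1) (by omega) x hx y₁ h₁, hFGij 0 (2 * n - 1) (by omega) x hx y₂ h₂]
    rw [← e1, ← intervalIntegral.integral_const_mul]
    simp only [← intervalIntegral.integral_const_mul]
    rw [← intervalIntegral.integral_finsetSum fun r hr =>
      (hGi _ _ (by have := hidx r hr; omega)).const_mul _]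
    refine intervalIntegral.integral_congr fun y hy => ?_
    rw [uIcc_of_le h₁₂] at hy
    have := he x hx y (hsub hy)
    simp only [show ∀ r, 2 * (r + 1) = 2 * r + 1 + 1 from fun r => by ring] at this
    linarith
  have hdK' : ∀ x ∈ Ioo (0 : ℝ) 1, HasDerivAt K' (-e 0 * D x) x := fun x hx => by
    refine hasDerivAt_of_sub_eq_integral (f' := fun x => -e 0 * D x) isOpen_Ioo
      ((hDc.mono h01).const_mul _) (fun x₁ hx₁ x₂ hx₂ hx₁₂ => ?_) hx
    have hs : Icc x₁ x₂ ⊆ Ioo 0 1 := Icc_subset_Ioo hx₁.1 hx₂.2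
    have hKG : ∀ x ∈ Ioo (0 : ℝ) 1, K' x = ∑ r ∈ Finset.range n,
        e (r + 1) * ∫ y in y₁..y₂, G (2 * r + 1) (2 * (n - (r + 1))) x y := fun x hx => by
      refine Finset.sum_congr rfl fun r hr => ?_
      congr 1
      refine intervalIntegral.integral_congr fun y hy => ?_
      rw [uIcc_of_le h₁₂] at hy
      exact hFGij _ _ (by have := hidx r hr; omega) x hx y (hsub hy)
    rw [hKG _ hx₁, hKG _ hx₂, sum_integral_sub_eq _ _ hx₁₂ h₁₂
      (fun r hr => (hGc _ _ (by have := hidx r hr; omega)).mono (prod_mono hs hsub))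
      (fun r hr => (hGc (2 * r + 1 + 1) (2 * (n - (r + 1)))
        (by have := hidx r hr; omega)).mono (prod_mono hs hsub))
      fun r hr x hx y hy => (hG.dx _ _ (by have := hidx r hr; omega) x (hs hx) y
        (hsub hy)).mono hs]
    refine intervalIntegral.integral_congr fun x hx => ?_
    rw [uIcc_of_le hx₁₂] at hx
    exact htop x (hs hx)
  -- The even derivatives in K vanish on the sides, so the boundary terms of both integrations by
  -- parts drop out.
  have hK0 : K 0 = 0 ∧ K 1 = 0 := by
    have : ∀ x, (∀ r q, 2 * r + 2 * q ≤ 2 * n - 2 → ∀ y ∈ Icc (-1 : ℝ) 1,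
        F (2 * r) (2 * q) x y = 0) → K x = 0 := fun x h => by
      refine Finset.sum_eq_zero fun r hr => ?_
      rw [intervalIntegral.integral_congr (g := fun _ => 0) fun y hy => ?_]
      · simp
      · rw [uIcc_of_le h₁₂] at hy
        exact h _ _ (hidx r hr).le y (hsub' hy)
    exact ⟨this 0 fun r q h y hy => (hb r q h y hy).1, this 1 fun r q h y hy => (hb r q h y hy).2⟩
  have hparts := integral_deriv_two_mul_sin k hKc hKc' (hDc.const_mul (-e 0)) hdK hdK' hK0.1 hK0.2
  have hsin : Continuous fun x : ℝ => Real.sin (π * k * x) := by fun_prop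
  have hKs : ∫ x in (0 : ℝ)..1, K x * Real.sin (π * k * x) = ∑ r ∈ Finset.range n,
      e (r + 1) * ((-(π * k) ^ 2) ^ r * ∫ y in y₁..y₂, ∫ x in (0 : ℝ)..1,
          F 0 (2 * (n - (r + 1))) x y * Real.sin (π * k * x)) := by
    simp only [K, Finset.sum_mul]
    have hint : ∀ r ∈ Finset.range n, IntervalIntegrable (fun x => (e (r + 1) *
        ∫ y in y₁..y₂, F (2 * r) (2 * (n - (r + 1))) x y) * Real.sin (π * k * x))
        MeasureTheory.volume 0 1 := fun r hr =>
      (((hpar _ _ (by have := hidx r hr; omega)).const_mul _).mul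
        hsin.continuousOn).intervalIntegrable_of_Icc zero_le_one
    rw [intervalIntegral.integral_finsetSum hint]
    refine Finset.sum_congr rfl fun r hr => ?_
    simp only [mul_assoc, ← intervalIntegral.integral_mul_const]
    rw [intervalIntegral.integral_const_mul]
    congr 1
    rw [intervalIntegral_swap_of_continuousOn zero_le_one h₁₂
      (g := fun x y => F (2 * r) (2 * (n - (r + 1))) x y * Real.sin (π * (k * x)))
      (((hFc _ _ (by have := hidx r hr; omega)).mono (prod_mono subset_rfl hsub')).mul
        (by fun_prop)), ← intervalIntegral.integral_const_mul]
    refine intervalIntegral.integral_congr fun y hy => ?_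
    rw [uIcc_of_le h₁₂] at hy
    have := integral_even_dx_mul_sin hF hFc hb k (hsub' hy) r (hidx r hr).le
    simpa only [mul_assoc] using this
  rw [hKs] at hparts
  simp only [mul_assoc, intervalIntegral.integral_const_mul, Finset.mul_sum] at hparts ⊢
  rw [neg_mul, neg_eq_iff_eq_neg] at hparts
  rw [hparts]
  congr 1
  refine Finset.sum_congr rfl fun r _ => ?_
  ring

end TopOrder

/-! ### Uniqueness and non-uniqueness -/

theorem IsDerivChainOn.eqOn_zero {W : ℕ → ℝ → ℝ} {s : Set ℝ} {M : ℕ} (h : IsDerivChainOn W s M)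
    (hs : UniqueDiffOn ℝ s) (h0 : ∀ y ∈ s, W 0 y = 0) {j : ℕ} (hj : j ≤ M) {y : ℝ} (hy : y ∈ s) :
    W j y = 0 := by
  have hz : IsDerivChainOn (fun _ _ => 0) s M := fun j _ y _ => hasDerivWithinAt_const y s 0
  exact (h.iteratedDerivWithin_eq hs (eqOn_refl _ _) j hj hy).symm.trans
    (hz.iteratedDerivWithin_eq hs (fun y hy => h0 y hy) j hj hy)

section Uniqueness

variable {n : ℕ} {a : Fin n → ℝ}

theorem modeJet_zero (k : ℕ+) (j : ℕ) (y : ℝ) : modeJet a k 0 j y = 0 := by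
  simp [modeJet, upperJet, lowerJet]

/-- Each sine coefficient in x solves the homogeneous linear system, so it is zero when the
determinant is not; completeness of the sines finishes. -/
theorem eq_zero_of_isClassicalSolution_zero (hn : 1 ≤ n) (hpos : ∀ s, 0 < a s)
    (ha : Function.Injective a) (hΔ : ∀ k : ℕ+, delta a k ≠ 0) {u : ℝ → ℝ → ℝ}
    (h : IsClassicalSolution a (fun _ _ => 0) (fun _ _ => 0) u) {x y : ℝ}
    (hx : x ∈ Icc (0 : ℝ) 1) (hy : y ∈ Icc (-1 : ℝ) 1) : u x y = 0 := by
  obtain ⟨F, hF, hFc, hFu⟩ := h.exists_isJetOn_closure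
  have hI : UniqueDiffOn ℝ (Icc (0 : ℝ) 1) := uniqueDiffOn_Icc zero_lt_one
  have hum := uniqueDiffOn_Icc_neg_one_one
  have h0 : (0 : ℝ) ∈ Icc (0 : ℝ) 1 := left_mem_Icc.2 zero_le_one
  have h1 : (1 : ℝ) ∈ Icc (0 : ℝ) 1 := right_mem_Icc.2 zero_le_one
  have hb : ∀ r q, 2 * r + 2 * q ≤ 2 * n - 2 → ∀ y ∈ Icc (-1 : ℝ) 1,
      F (2 * r) (2 * q) 0 y = 0 ∧ F (2 * r) (2 * q) 1 y = 0 := by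
    intro r q hrq y hy
    -- A function vanishing along a whole side also has vanishing tangential derivatives.
    have key : ∀ (b : ℝ) (hb : b ∈ Icc (0 : ℝ) 1), (∀ y ∈ Icc (-1 : ℝ) 1,
        iteratedDerivWithin (2 * r) (fun x => u x y) (Icc 0 1) b = 0) →
        F (2 * r) (2 * q) b y = 0 := fun b hb hz =>
      (hF.chain_dy (2 * r) hb).eqOn_zero hum (fun y hy => by
        rw [← hz y hy]
        exact ((hF.chain_dx 0 hy).iteratedDerivWithin_eq hI (fun x _ => by rw [hFu])
          (2 * r) (by omega) hb).symm) (by omega) hy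
    exact ⟨key 0 h0 fun y hy => h.left ⟨r, by omega⟩ y hy,
      key 1 h1 fun y hy => h.right ⟨r, by omega⟩ y hy⟩
  have hcoeff : ∀ k : ℕ+, ∀ y ∈ Icc (-1 : ℝ) 1,
      ∫ x in (0 : ℝ)..1, F 0 0 x y * Real.sin (π * k * x) = 0 := by
    intro k
    set Z : ℕ → ℝ → ℝ := fun j y => ∫ x in (0 : ℝ)..1, F 0 j x y * Real.sin (π * k * x) with hZ
    have hsin : Continuous fun x : ℝ => Real.sin (π * k * x) := by fun_prop
    have hZc : ∀ j < 2 * n, ContinuousOn (Z j) (Icc (-1) 1) := fun j hj =>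
      continuousOn_intervalIntegral_prod zero_le_one (by norm_num)
        (g := fun x y => F 0 j x y * Real.sin (π * k * x))
        ((hFc 0 j (by omega)).mul (hsin.comp continuous_fst).continuousOn)
    have hint : ∀ j < 2 * n, ∀ y ∈ Icc (-1 : ℝ) 1, IntervalIntegrable
        (fun x => F 0 j x y * Real.sin (π * k * x)) MeasureTheory.volume 0 1 := fun j hj y hy =>
      (((hFc 0 j (by omega)).comp (f := fun x : ℝ => (x, y)) (by fun_prop)
        fun x hx => ⟨hx, hy⟩).mul hsin.continuousOn).intervalIntegrable_of_Icc zero_le_one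
    have hsub : ∀ j < 2 * n, ∀ y₁ ∈ Icc (-1 : ℝ) 1, ∀ y₂ ∈ Icc (-1 : ℝ) 1, Z j y₂ - Z j y₁ =
        ∫ x in (0 : ℝ)..1, (F 0 j x y₂ - F 0 j x y₁) * Real.sin (π * k * x) := by
      intro j hj y₁ h₁ y₂ h₂
      rw [← intervalIntegral.integral_sub (hint j hj y₂ h₂) (hint j hj y₁ h₁)]
      simp only [sub_mul]
    have hlow : ∀ {J : Set ℝ} {σ : ℝ}, IsHalf J σ → ∀ j, j + 1 < 2 * n → ∀ y ∈ J,
        HasDerivAt (Z j) (Z (j + 1) y) y := by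
      intro J σ hJ j hj y hy
      refine hasDerivAt_of_sub_eq_integral hJ.isOpen ((hZc (j + 1) hj).mono hJ.subset)
        (fun y₁ h₁ y₂ h₂ h₁₂ => ?_) hy
      have hs : Icc y₁ y₂ ⊆ Icc (-1) 1 := (hJ.ordConnected.out h₁ h₂).trans hJ.subset
      rw [hsub j (by omega) _ (hJ.subset h₁) _ (hJ.subset h₂)]
      exact integral_sub_mul_eq zero_le_one h₁₂
        ((hFc 0 (j + 1) (by omega)).mono (prod_mono subset_rfl hs))
        (fun x hx y hy => (hF.dy 0 j (by omega) x hx y (hs hy)).mono hs) hsin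
    -- The integral defining Z of order 2n is not known to converge, so this order is taken as the
    -- derivative of the previous one.
    set W : ℕ → ℝ → ℝ := fun j => if j < 2 * n then Z j else deriv (Z (2 * n - 1)) with hW
    have hWZ : ∀ j < 2 * n, W j = Z j := fun j hj => if_pos hj
    have hWtop : W (2 * n) = deriv (Z (2 * n - 1)) := if_neg (lt_irrefl _)
    have hhalf : ∀ {J : Set ℝ} {σ : ℝ}, IsHalf J σ → IsDerivChainOn W J (2 * n) ∧
        ∀ y ∈ J, modeSymbol k σ (List.ofFn a) (fun j => W j y) = 0 := by
      intro J σ hJ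
      obtain ⟨G, hG, hGc, hGu, heq⟩ := h.exists_isJetOn_half hJ
      obtain ⟨e, he0, he⟩ := exists_shiftProduct_eq_sum σ (List.ofFn a)
      simp only [List.length_ofFn, Finset.sum_range_succ', Nat.sub_zero] at he he0
      have he0' : e 0 ≠ 0 := by rw [he0]; exact pow_ne_zero _ hJ.ne_zero
      -- The value the mode equation prescribes for the derivative of order 2n; the division is
      -- possible because `e 0` is a power of ±1.
      set T : ℝ → ℝ := fun y => -(∑ r ∈ Finset.range n, e (r + 1) * (-(π * k) ^ 2) ^ (r + 1) *
        Z (2 * (n - (r + 1))) y) / e 0 with hT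
      have hTc : ContinuousOn T J := by
        refine (continuousOn_finsetSum _ fun r hr => ?_).neg.div_const _
        exact ((hZc _ (by have := Finset.mem_range.1 hr; omega)).mono hJ.subset).const_mul _
      have hd : ∀ y ∈ J, HasDerivAt (Z (2 * n - 1)) (T y) y := fun y hy => by
        refine hasDerivAt_of_sub_eq_integral hJ.isOpen hTc (fun y₁ h₁ y₂ h₂ h₁₂ => ?_) hy
        have hs : Icc y₁ y₂ ⊆ Icc (-1) 1 := (hJ.ordConnected.out h₁ h₂).trans hJ.subset
        have := integral_topDeriv_sub hn hF hFc hb hJ hG hGc (hFu.trans hGu.symm)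
          (fun x hx y hy => by rw [← he fun p q => G (2 * p) (2 * q) x y]; exact heq x hx y hy)
          k h₁ h₂ h₁₂
        rw [← hsub (2 * n - 1) (by omega) _ (hJ.subset h₁) _ (hJ.subset h₂)] at this
        rw [hT, intervalIntegral.integral_div, intervalIntegral.integral_neg,
          intervalIntegral.integral_finsetSum fun r hr =>
            ((((hZc _ (by have := Finset.mem_range.1 hr; omega)).mono hs).const_mul
              _)).intervalIntegrable_of_Icc h₁₂, eq_div_iff he0', mul_comm, this]
        simp only [intervalIntegral.integral_const_mul, Z]
      refine ⟨fun j hj y hy => ?_, fun y hy => ?_⟩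
      · refine HasDerivAt.hasDerivWithinAt ?_
        rw [hWZ j hj]
        rcases Nat.lt_or_ge (j + 1) (2 * n) with hj' | hj'
        · rw [hWZ _ hj']
          exact hlow hJ j hj' y hy
        · obtain rfl : j = 2 * n - 1 := by omega
          rw [show 2 * n - 1 + 1 = 2 * n by omega, hWtop, (hd y hy).deriv]
          exact hd y hy
      · rw [modeSymbol, he, hWtop, (hd y hy).deriv, hT]
        rw [Finset.sum_congr rfl fun r hr => by
          rw [hWZ (2 * (n - (r + 1))) (by have := Finset.mem_range.1 hr; omega), ← mul_assoc]]
        field_simp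
        ring
    have hU := hhalf isHalf_upper
    have hL := hhalf isHalf_lower
    have hbd : ∀ b ∈ Icc (-1 : ℝ) 1, (∀ s : Fin n, ∀ x ∈ Icc (0 : ℝ) 1,
        iteratedDerivWithin (2 * s) (fun y => u x y) (Icc (-1) 1) b = 0) →
        ∀ m : Fin n, W (2 * m) b = (0 : Fin n → ℝ) m := fun b hb hz m => by
      rw [hWZ _ (by omega)]
      refine (intervalIntegral.integral_congr (g := fun _ => 0) fun x hx => ?_).trans (by simp)
      rw [uIcc_of_le zero_le_one] at hx
      have := (hF.chain_dy 0 hx).iteratedDerivWithin_eq hum (f := fun y => u x y)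
        (fun y _ => by rw [hFu]) (2 * m) (by omega) hb
      rw [hz m x hx] at this
      simp only [← this, zero_mul]
    obtain ⟨c, hc, -, hcW⟩ := exists_eq_modeJet hpos ha k W 0 0
      (fun j hj => by rw [hWZ j hj]; exact hZc j hj) hU.1 hL.1 hU.2 hL.2
      (hbd 1 (by norm_num) h.top) (hbd (-1) (by norm_num) h.bottom)
    rw [dataVector_zero] at hc
    obtain rfl := Matrix.eq_zero_of_mulVec_eq_zero (hΔ k) hc
    intro y hy
    have := hcW 0 (by omega) hy
    rwa [modeJet_zero, hWZ 0 (by omega)] at this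
  rw [← hFu]
  refine eq_zero_of_sineCoeff_eq_zero (f := fun x => F 0 0 x y) ?_ (hb 0 0 (by omega) y hy).1
    (hb 0 0 (by omega) y hy).2 (fun k => ?_) hx
  · exact (hFc 0 0 (by omega)).comp (f := fun x : ℝ => (x, y)) (by fun_prop) fun x hx => ⟨hx, hy⟩
  · rw [sineCoeff, hcoeff k y hy, mul_zero]

/-- A kernel vector of the system gives a nonzero mode w, and w(y) sin(πkx) violates uniqueness. -/
theorem exists_isClassicalSolution_zero_ne (hn : 1 ≤ n) (hpos : ∀ s, 0 < a s)
    (ha : Function.Injective a) {γ : ℝ} (h : SmallDenominatorBound a γ) {k : ℕ+}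
    (hk : delta a k = 0) :
    ∃ z : ℝ → ℝ → ℝ, IsClassicalSolution a (fun _ _ => 0) (fun _ _ => 0) z ∧
      ∃ x ∈ Icc (0 : ℝ) 1, ∃ y ∈ Icc (-1 : ℝ) 1, z x y ≠ 0 := by
  classical
  have hz : ∀ k, sineCoeff (fun _ => 0) k = 0 := fun k => by simp [sineCoeff]
  obtain ⟨w, hw, y, hy, hwy⟩ := exists_isModeSolution_ne_zero hn hpos ha hk
    (φ := fun _ _ => 0) (ψ := fun _ _ => 0) (fun _ => hz k) (fun _ => hz k)
  let v : ℕ+ → ℝ → ℝ := fun l => if l = k then w else modeJet a l 0 0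
  have hv : ∀ l, IsModeSolution a (fun _ _ => 0) (fun _ _ => 0) l (v l) := fun l => by
    by_cases hl : l = k
    · subst hl; simpa [v] using hw
    · simp only [v, if_neg hl]
      refine isModeSolution_modeJet hn ?_
      simp only [hz]
      rw [Matrix.mulVec_zero]
      exact dataVector_zero l |>.symm
  refine ⟨sineSeries v, (sineSeries_isClassicalSolution hn hpos ha h
    (fun _ => IsAdmissibleDatum_zero _) (fun _ => IsAdmissibleDatum_zero _) hv).2, ?_⟩
  have hk1 : (1 : ℝ) ≤ k := by exact_mod_cast k.pos
  -- At this x the sine equals 1.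
  refine ⟨1 / (2 * k), ⟨by positivity, ?_⟩, y, hy, ?_⟩
  · rw [div_le_one (by positivity)]; linarith
  · rw [sineSeries, tsum_eq_single k fun l hl => by simp [v, if_neg hl, modeJet_zero],
      show π * k * (1 / (2 * k)) = π / 2 by field_simp, Real.sin_pi_div_two]
    simpa [v] using hwy

end Uniqueness

/-! ### Assembly of the theorem -/

theorem theorem3 (n : ℕ) (hn : 1 ≤ n) (a : Fin n → ℝ)
    (ha_pos : ∀ j, 0 < a j) (ha_mono : StrictMono a) :
    -- the small-denominator bound holds with exponent `0` for natural coefficients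
    ((∀ j, ∃ m : ℕ, a j = m) → SmallDenominatorBound a 0) ∧
    -- and for rational coefficients under the arithmetic condition
    (∀ q : Fin n → ℚ, (∀ j, a j = q j) → RationalCondition q → SmallDenominatorBound a 0) ∧
    ∀ γ : ℝ, 0 ≤ γ → SmallDenominatorBound a γ →
      -- the main determinant vanishes for at most finitely many `k`
      {k : ℕ+ | delta a k = 0}.Finite ∧
      ∀ φ ψ : Fin n → ℝ → ℝ,
        (∀ s, IsAdmissibleDatum (dataOrder n γ) (φ s)) →
        (∀ s, IsAdmissibleDatum (dataOrder n γ) (ψ s)) →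
        -- if `Δ(k) ≠ 0`, then the `k`-th coefficient of the series exists and is unique
        (∀ k : ℕ+, delta a k ≠ 0 →
          ∃ w : ℝ → ℝ, IsModeSolution a φ ψ k w ∧
            ∀ w' : ℝ → ℝ, IsModeSolution a φ ψ k w' → EqOn w' w (Icc (-1) 1)) ∧
        -- the sine series with such coefficients is a classical solution
        (∀ w : ℕ+ → ℝ → ℝ, (∀ k, IsModeSolution a φ ψ k (w k)) →
          ConvergesTermwise n w ∧ IsClassicalSolution a φ ψ (sineSeries w)) ∧
        -- a solution of this form exists if the data have no component along the exceptional `k`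
        ((∀ k : ℕ+, delta a k = 0 → ∀ s, sineCoeff (φ s) k = 0 ∧ sineCoeff (ψ s) k = 0) →
          ∃ w : ℕ+ → ℝ → ℝ, (∀ k, IsModeSolution a φ ψ k (w k)) ∧
            ConvergesTermwise n w ∧ IsClassicalSolution a φ ψ (sineSeries w)) ∧
        -- the solution is unique if `Δ` never vanishes
        ((∀ k : ℕ+, delta a k ≠ 0) → ∀ u v : ℝ → ℝ → ℝ,
          IsClassicalSolution a φ ψ u → IsClassicalSolution a φ ψ v →
            EqOn (Function.uncurry u) (Function.uncurry v) omegaClosure) ∧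
        -- and is never unique if `Δ` vanishes for some `k`
        ((∃ k : ℕ+, delta a k = 0) → ∀ u : ℝ → ℝ → ℝ, IsClassicalSolution a φ ψ u →
          ∃ v : ℝ → ℝ → ℝ, IsClassicalSolution a φ ψ v ∧
            ¬ EqOn (Function.uncurry u) (Function.uncurry v) omegaClosure) := by
  have hinj := ha_mono.injective
  refine ⟨smallDenominatorBound_of_nat a ha_pos hinj, fun q hq hrat => ?_, fun γ hγ hsd => ?_⟩
  · obtain rfl : a = fun j => (q j : ℝ) := funext hq
    exact smallDenominatorBound_of_rat q (fun j => Rat.cast_pos.1 (ha_pos j))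
      (fun i j hij => hinj (by simp only [hij])) hrat
  · obtain ⟨C, hC⟩ := hsd.eventually_bound ha_pos hinj
    refine ⟨(hC.mono fun k hk => hk.1).subset fun k hk => not_not.2 hk, fun φ ψ hφ hψ => ?_⟩
    have hseries := fun w hw => sineSeries_isClassicalSolution hn ha_pos hinj hsd hφ hψ (w := w) hw
    refine ⟨fun k hk => exists_isModeSolution hn ha_pos hinj hk φ ψ, hseries, fun hz => ?_,
      fun hΔ u v hu hv p hp => ?_, ?_⟩
    · have hex : ∀ k : ℕ+, ∃ w, IsModeSolution a φ ψ k w := fun k => by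
        by_cases hk : delta a k = 0
        · obtain ⟨w, hw, -⟩ := exists_isModeSolution_ne_zero hn ha_pos hinj hk
            (fun s => (hz k hk s).1) (fun s => (hz k hk s).2)
          exact ⟨w, hw⟩
        · obtain ⟨w, hw, -⟩ := exists_isModeSolution hn ha_pos hinj hk φ ψ
          exact ⟨w, hw⟩
      choose w hw using hex
      exact ⟨w, hw, hseries w hw⟩
    · have hdiff := hu.add_const_mul hv (-1)
      simp only [neg_one_mul, add_neg_cancel] at hdiff
      have := eq_zero_of_isClassicalSolution_zero hn ha_pos hinj hΔ hdiff hp.1 hp.2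
      exact sub_eq_zero.1 ((sub_eq_add_neg _ _).trans this)
    · rintro ⟨k, hk⟩ u hu
      obtain ⟨z, hz, x, hx, y, hy, hxy⟩ :=
        exists_isClassicalSolution_zero_ne hn ha_pos hinj hsd hk
      have hv := hu.add_const_mul hz 1
      simp only [mul_zero, add_zero, one_mul] at hv
      refine ⟨_, hv, fun he => hxy ?_⟩
      have := he (x := (x, y)) ⟨hx, hy⟩
      simpa [Function.uncurry] using this
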